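/- Let $S$ be a scheme, $0<r<d$ integers, $\mathscr E_1,\mathscr E_2$ vector bundles of rank $d$ on $S$, $f:\mathscr E_1\to\mathscr E_2$ and $g:\mathscr E_2\to\mathscr E_1$ homomorphisms and $s\in\Gamma(S,\mathscr O_S)$, such that $fg$ and $gf$ are multiplication by $s$ and such that, for all integers $r_1,r_2\ge 0$ with $r_1+r_2<d$, there is no point of $S$ at which $f$ has rank at most $r_1$ and $g$ has rank at most $r_2$ (ranks are taken on the fibers over the residue field). For an $S$-scheme $T$ let $\mathcal{LG}(T)$ be the set of pairs $(V_1,V_2)$ of sub-bundles $V_i\subseteq\mathscr E_{i,T}$ of rank $r$ (locally direct summands of rank $r$) with $f_T(V_1)\subseteq V_2$ and $g_T(V_2)\subseteq V_1$. For $\ell\ge 0$, a scheme $T$ and $t\in\Gamma(T,\mathscr O_T)$, let $M_{\ell,T}(2,t)$ be the affine $T$-scheme of pairs of $\ell\times\ell$ matrices $M,N$ with $MN=NM=t$. Then the functor $\mathcal{LG}$ is represented by an $S$-scheme $\pi:LG\to S$, and the following holds. Let $k$ be a field and let $x=(V_1,V_2)$ be a $k$-valued point of $LG$. Put $$\ell=\begin{cases}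 r-\dim_k g(V_2)-\dim_k f(V_1) & \text{if } s=0 \text{ at } x,\\ 0 & \text{if } s\ne 0\text{ at }x,\end{cases}\qquad m=r(d-r)-\ell^2 .$$ Then $\ell, m\ge 0$, and there are an open neighborhood $U$ of $x$ in $LG$ whose image $S'=\pi(U)$ is open in $S$, and an isomorphism of $S'$-schemes $$U\xrightarrow{\ \sim\ }\mathbb A^m_{S'}\times_{S'}M_{\ell,S'}(2,s|_{S'})$$ such that the $M_{\ell,S'}(2,s|_{S'})$-component of the image of $x$ is the pair of zero matrices and such that, if the residue field of $LG$ at the underlying point of $x$ equals the residue field of $S$ at its image (for instance, if $k$ is the residue field of $S$ at the image of $x$), then $x$ is sent to the origin, that is, its $\mathbb A^m_{S'}$-component is zero as well. -/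

import Mathlib

open CategoryTheory AlgebraicGeometry

universe u

namespace LinkedGr

noncomputable section

/-! ### Vector bundles and sub-bundles -/

/-- Restriction of a section of a sheaf of modules to a smaller open set. -/
def res {X : Scheme.{u}} (E : X.Modules) {W U : X.Opens} (h : W ≤ U) (v : Γ(E, U)) : Γ(E, W) :=
  E.presheaf.map (homOfLE h).op v

/-- A family `e` of sections of `E` over `U` is a frame if it is a basis of `Γ(E, W)` for every open
`W ⊆ U`, i.e. if it induces an isomorphism of the free module on `ι` over `U` with `E|_U`. -/
def IsFrame {X : Scheme.{u}} (E : X.Modules) (U : X.Opens) {ι : Type} (e : ι → Γ(E, U)) : Prop :=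
  ∀ (W : X.Opens) (h : W ≤ U),
    LinearIndependent Γ(X, W) (fun i => res E h (e i)) ∧
      Submodule.span Γ(X, W) (Set.range fun i => res E h (e i)) = ⊤

/-- `E` is a vector bundle of rank `d`: it has frames of `d` elements locally. -/
def IsVectorBundle {X : Scheme.{u}} (E : X.Modules) (d : ℕ) : Prop :=
  ∀ x : X, ∃ U : X.Opens, x ∈ U ∧ ∃ e : Fin d → Γ(E, U), IsFrame E U e

/-- A sub-bundle of rank `r` of `E`: a subsheaf of submodules which locally is spanned by the first
`r` elements of some (finite) frame of `E`, so it is locally free of rank `r` with locally free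
quotient. -/
@[ext]
structure Subbundle {X : Scheme.{u}} (E : X.Modules) (r : ℕ) where
  /-- the sections of the sub-bundle over each open set -/
  carrier : ∀ U : X.Opens, Submodule Γ(X, U) Γ(E, U)
  res_mem : ∀ {W U : X.Opens} (h : W ≤ U) (v : Γ(E, U)), v ∈ carrier U → res E h v ∈ carrier W
  mem_of_local : ∀ (U : X.Opens) (v : Γ(E, U)),
    (∀ x ∈ U, ∃ (W : X.Opens) (h : W ≤ U), x ∈ W ∧ res E h v ∈ carrier W) → v ∈ carrier U
  exists_frame : ∀ x : X, ∃ U : X.Opens, x ∈ U ∧ ∃ (n : ℕ) (e : Fin r ⊕ Fin n → Γ(E, U)),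
    IsFrame E U e ∧ ∀ (W : X.Opens) (h : W ≤ U),
      carrier W = Submodule.span Γ(X, W) (Set.range fun i => res E h (e (Sum.inl i)))

/-- The linear map on sections over `U` induced by a morphism of sheaves of modules. -/
def sectionMap {X : Scheme.{u}} {E F : X.Modules} (f : E ⟶ F) (U : X.Opens) :
    Γ(E, U) →ₗ[Γ(X, U)] Γ(F, U) where
  toFun v := f.app U v
  map_add' v w := map_add (f.app U).hom v w
  map_smul' a v := Scheme.Modules.Hom.app_smul f a v

/-- The base change `p^* E` of a sheaf of modules on `S` along `p : T ⟶ S`. -/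
abbrev bc {S T : Scheme.{u}} (p : T ⟶ S) (E : S.Modules) : T.Modules :=
  (Scheme.Modules.pullback p).obj E

/-- The base change `p^* f` of a morphism of sheaves of modules on `S` along `p : T ⟶ S`. -/
abbrev bcMap {S T : Scheme.{u}} (p : T ⟶ S) {E F : S.Modules} (f : E ⟶ F) : bc p E ⟶ bc p F :=
  (Scheme.Modules.pullback p).map f

/-- For `h : T' ⟶ T` over `S`, the canonical isomorphism `h^* (p^* E) ⟶ q^* E`. -/
def bcComp {S T T' : Scheme.{u}} (h : T' ⟶ T) (p : T ⟶ S) (q : T' ⟶ S) (w : h ≫ p = q)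
    (E : S.Modules) : bc h (bc p E) ⟶ bc q E :=
  (Scheme.Modules.pullbackComp h p).hom.app E ≫ (Scheme.Modules.pullbackCongr w).hom.app E

/-- For `h : T' ⟶ T` over `S`, the inverse image `h^* v` of a section `v` of `p^* E` over `U`, as a
section of `q^* E` over `h⁻¹ U`. -/
def pullSection {S T T' : Scheme.{u}} (h : T' ⟶ T) (p : T ⟶ S) (q : T' ⟶ S) (w : h ≫ p = q)
    (E : S.Modules) (U : T.Opens) (v : Γ(bc p E, U)) : Γ(bc q E, h ⁻¹ᵁ U) :=
  (bcComp h p q w E).app (h ⁻¹ᵁ U)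
    (((Scheme.Modules.pullbackPushforwardAdjunction h).unit.app (bc p E)).app U v)

/-- `W` is the base change `h^* V` of `V` along `h : T' ⟶ T` over `S`: the subsheaf of modules of
`q^* E = h^* p^* E` generated by the inverse images of the sections of `V`. -/
def IsBaseChange {S T T' : Scheme.{u}} (h : T' ⟶ T) {p : T ⟶ S} {q : T' ⟶ S} (w : h ≫ p = q)
    {E : S.Modules} {r : ℕ} (V : Subbundle (bc p E) r) (W : Subbundle (bc q E) r) : Prop :=
  ∀ (U' : T'.Opens) (v : Γ(bc q E, U')), v ∈ W.carrier U' ↔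
    ∀ x ∈ U', ∃ (U : T.Opens) (A : T'.Opens) (hA : A ≤ U') (hAU : A ≤ h ⁻¹ᵁ U), x ∈ A ∧
      res (bc q E) hA v ∈ Submodule.span Γ(T', A)
        ((fun v₀ => res (bc q E) hAU (pullSection h p q w E U v₀)) '' (V.carrier U : Set _))

/-! ### Linked Grassmannians of length two -/

/-- The rank of a morphism of vector bundles at a point `t`, i.e. the rank of the linear map it
induces between the fibers over the residue field of `t`. -/
def rankAt {S : Scheme.{u}} {E F : S.Modules} (f : E ⟶ F) (t : S) : ℕ :=
  Module.finrank Γ(Spec (S.residueField t), ⊤)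
    (LinearMap.range (sectionMap (bcMap (S.fromSpecResidueField t) f) ⊤))

/-- The conditions on `E₁, E₂, f, g, s` for a linked Grassmannian of length two: `E₁, E₂` are vector
bundles of rank `d`, both composites of `f` and `g` are multiplication by `s`, and for
`r₁ + r₂ < d` the locus where `f` has rank at most `r₁` and `g` has rank at most `r₂` is empty. -/
structure IsLinked {S : Scheme.{u}} (d : ℕ) {E₁ E₂ : S.Modules} (f : E₁ ⟶ E₂) (g : E₂ ⟶ E₁)
    (s : Γ(S, ⊤)) : Prop where
  bundle₁ : IsVectorBundle E₁ d
  bundle₂ : IsVectorBundle E₂ d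
  g_f : ∀ (U : S.Opens) (v : Γ(E₁, U)), g.app U (f.app U v) =
    S.presheaf.map (homOfLE (le_top : U ≤ ⊤)).op s • v
  f_g : ∀ (U : S.Opens) (v : Γ(E₂, U)), f.app U (g.app U v) =
    S.presheaf.map (homOfLE (le_top : U ≤ ⊤)).op s • v
  rank : ∀ r₁ r₂ : ℕ, r₁ + r₂ < d → ∀ t : S, ¬ (rankAt f t ≤ r₁ ∧ rankAt g t ≤ r₂)

/-- A `T`-valued point over `p : T ⟶ S` of the linked Grassmannian functor: a pair of sub-bundles of
rank `r` of the base changes of `E₁` and `E₂` to `T` that are mapped into each other by `f` and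
`g`. -/
structure LinkedPair {S T : Scheme.{u}} (p : T ⟶ S) {E₁ E₂ : S.Modules} (f : E₁ ⟶ E₂)
    (g : E₂ ⟶ E₁) (r : ℕ) where
  V₁ : Subbundle (bc p E₁) r
  V₂ : Subbundle (bc p E₂) r
  map_f : ∀ (U : T.Opens), ∀ v ∈ V₁.carrier U, (bcMap p f).app U v ∈ V₂.carrier U
  map_g : ∀ (U : T.Opens), ∀ v ∈ V₂.carrier U, (bcMap p g).app U v ∈ V₁.carrier U

/-- `h : T' ⟶ T` is a morphism over `S` along which the pair `V` over `T` pulls back to the pair `W`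
over `T'`. -/
def Classifies {S T T' : Scheme.{u}} {p : T ⟶ S} {q : T' ⟶ S} {E₁ E₂ : S.Modules} {f : E₁ ⟶ E₂}
    {g : E₂ ⟶ E₁} {r : ℕ} (h : T' ⟶ T) (V : LinkedPair p f g r) (W : LinkedPair q f g r) : Prop :=
  ∃ w : h ≫ p = q, IsBaseChange h w V.V₁ W.V₁ ∧ IsBaseChange h w V.V₂ W.V₂

/-- `π : LG ⟶ S` with the universal pair `𝒱` is the linked Grassmannian scheme, i.e. it represents
the linked Grassmannian functor: every linked pair over an `S`-scheme `T` is the base change of `𝒱`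
along exactly one `S`-morphism `T ⟶ LG`. -/
def IsLinkedGrassmannian {S LG : Scheme.{u}} (π : LG ⟶ S) {E₁ E₂ : S.Modules} {f : E₁ ⟶ E₂}
    {g : E₂ ⟶ E₁} {r : ℕ} (𝒱 : LinkedPair π f g r) : Prop :=
  ∀ (T : Scheme.{u}) (p : T ⟶ S) (W : LinkedPair p f g r), ∃! h : T ⟶ LG, Classifies h 𝒱 W

/-! ### The scheme of pairs of matrices `M, N` with `M N = N M = s` -/

/-- Index type of the entries of a pair of `l × l` matrices. -/
abbrev PairIdx (l : ℕ) : Type u := ULift.{u} ((Fin l × Fin l) ⊕ (Fin l × Fin l))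

/-- The first universal matrix, over the affine space of pairs of `l × l` matrices. -/
def univM (l : ℕ) (S : Scheme.{u}) : Matrix (Fin l) (Fin l) Γ(𝔸(PairIdx.{u} l; S), ⊤) :=
  fun i j => AffineSpace.coord S ⟨Sum.inl (i, j)⟩

/-- The second universal matrix, over the affine space of pairs of `l × l` matrices. -/
def univN (l : ℕ) (S : Scheme.{u}) : Matrix (Fin l) (Fin l) Γ(𝔸(PairIdx.{u} l; S), ⊤) :=
  fun i j => AffineSpace.coord S ⟨Sum.inr (i, j)⟩

/-- The scalar matrix `s` over the affine space of pairs of `l × l` matrices. -/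
def scalarMat (l : ℕ) (S : Scheme.{u}) (s : Γ(S, ⊤)) :
    Matrix (Fin l) (Fin l) Γ(𝔸(PairIdx.{u} l; S), ⊤) :=
  Matrix.scalar (Fin l) ((𝔸(PairIdx.{u} l; S) ↘ S).appTop s)

/-- The ideal generated by the entries of `M N - s` and `N M - s`. -/
def pairIdeal (l : ℕ) (S : Scheme.{u}) (s : Γ(S, ⊤)) : Ideal Γ(𝔸(PairIdx.{u} l; S), ⊤) :=
  Ideal.span
    ((Set.range fun ij : Fin l × Fin l => (univM l S * univN l S - scalarMat l S s) ij.1 ij.2) ∪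
      Set.range fun ij : Fin l × Fin l => (univN l S * univM l S - scalarMat l S s) ij.1 ij.2)

/-- The affine `S`-scheme parametrizing pairs of `l × l` matrices `M, N` with `M N = N M = s`, as a
closed subscheme of the affine space of pairs of `l × l` matrices. -/
def MatPairs (l : ℕ) (S : Scheme.{u}) (s : Γ(S, ⊤)) : Scheme.{u} :=
  (Scheme.IdealSheafData.ofIdealTop (pairIdeal l S s)).subscheme

/-- The closed immersion of `MatPairs l S s` into the affine space of pairs of matrices. -/
def MatPairs.toAffine (l : ℕ) (S : Scheme.{u}) (s : Γ(S, ⊤)) :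
    MatPairs l S s ⟶ 𝔸(PairIdx.{u} l; S) :=
  (Scheme.IdealSheafData.ofIdealTop (pairIdeal l S s)).subschemeι

/-- The structure morphism of `MatPairs l S s`. -/
def MatPairs.toBase (l : ℕ) (S : Scheme.{u}) (s : Γ(S, ⊤)) : MatPairs l S s ⟶ S :=
  MatPairs.toAffine l S s ≫ (𝔸(PairIdx.{u} l; S) ↘ S)

/-- The fiber product over `S` of affine `m`-space and `MatPairs l S s`. -/
abbrev LocalModel (m l : ℕ) (S : Scheme.{u}) (s : Γ(S, ⊤)) : Scheme.{u} :=
  Limits.pullback (𝔸(ULift.{u} (Fin m); S) ↘ S) (MatPairs.toBase l S s)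

/-- The structure morphism of the local model. -/
def LocalModel.toBase (m l : ℕ) (S : Scheme.{u}) (s : Γ(S, ⊤)) : LocalModel m l S s ⟶ S :=
  Limits.pullback.snd _ _ ≫ MatPairs.toBase l S s

/-- The component of `y : T ⟶ LocalModel m l S s` in affine `m`-space is the origin: all `m`
coordinates of `y` vanish. -/
def AffineCoordsVanish {m l : ℕ} {S : Scheme.{u}} {s : Γ(S, ⊤)} {T : Scheme.{u}}
    (y : T ⟶ LocalModel m l S s) : Prop :=
  ∀ i : ULift.{u} (Fin m), (y ≫ Limits.pullback.fst _ _).appTop (AffineSpace.coord S i) = 0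

/-- The component of `y : T ⟶ LocalModel m l S s` in `MatPairs l S s` is the origin: all entries of
both matrices vanish. -/
def MatrixCoordsVanish {m l : ℕ} {S : Scheme.{u}} {s : Γ(S, ⊤)} {T : Scheme.{u}}
    (y : T ⟶ LocalModel m l S s) : Prop :=
  ∀ i : PairIdx.{u} l,
    (y ≫ Limits.pullback.snd _ _ ≫ MatPairs.toAffine l S s).appTop (AffineSpace.coord S i) = 0

/-! ### Field-valued points -/

/-- For a `k`-point `V = (V₁, V₂)` over `p : Spec k ⟶ S`, the dimension of `f(V₁)`. -/
def dimF {S : Scheme.{u}} {k : Type u} [Field k] {p : Spec (CommRingCat.of k) ⟶ S}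
    {E₁ E₂ : S.Modules} {f : E₁ ⟶ E₂} {g : E₂ ⟶ E₁} {r : ℕ} (V : LinkedPair p f g r) : ℕ :=
  Module.finrank Γ(Spec (CommRingCat.of k), ⊤)
    ((V.V₁.carrier ⊤).map (sectionMap (bcMap p f) ⊤))

/-- For a `k`-point `V = (V₁, V₂)` over `p : Spec k ⟶ S`, the dimension of `g(V₂)`. -/
def dimG {S : Scheme.{u}} {k : Type u} [Field k] {p : Spec (CommRingCat.of k) ⟶ S}
    {E₁ E₂ : S.Modules} {f : E₁ ⟶ E₂} {g : E₂ ⟶ E₁} {r : ℕ} (V : LinkedPair p f g r) : ℕ :=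
  Module.finrank Γ(Spec (CommRingCat.of k), ⊤)
    ((V.V₂.carrier ⊤).map (sectionMap (bcMap p g) ⊤))

/-- The point of the underlying space of `X` defined by a field-valued point of `X`. -/
def underlyingPoint {X : Scheme.{u}} {k : Type u} [Field k] (x : Spec (CommRingCat.of k) ⟶ X) : X :=
  x (IsLocalRing.closedPoint k)

end

end LinkedGr

/-! The rank condition serves to normalise `f` and `g`. Let `σ` be the value of `s` at a point. If
`σ ≠ 0`, then `f` is invertible there. If `σ = 0`, then `im g ⊆ ker f`, so the ranks add up to at
most `d`; the hypothesis forces equality. Lifting suitable basis vectors gives local frames indexed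
by `A ⊕ B` in which `f = diag(1, s)` and `g = diag(s, 1)`, with `B` empty when `σ ≠ 0`
(`exists_adapted_bases`, `IsLinked.exists_local_frames`).

Now take a pair `(V₁, V₂)` over a field `k` with `s = 0`. Then `f` and `g` are the projections to
`k^A` and `k^B`, so `f(V₁) = pr_A V₁ ⊆ V₂ ∩ k^A` and `g(V₂) = pr_B V₂ ⊆ V₁ ∩ k^B`. By rank-nullity
both inclusions have codimension `ℓ = r - dim f(V₁) - dim g(V₂)`. Choose pivot coordinates `I ⊆ A`
of `f(V₁)` and add `ℓ` of them, `L`, to get pivots of `V₂ ∩ k^A`; choose `J` and a second copy of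
`L` in `B` in the same way (`exists_linked_pivots`). The remaining coordinates are `K ⊆ A` and `K' ⊆
B`. Then `V₁` is a graph over the coordinates `I`, `J` and the `L` of `B`, and `V₂` is a graph over
`I`, `J` and the `L` of `A`. Having this graph shape is an open condition on a linked pair.

For a pair of such graphs over any ring, let `M` be the block of the first from the `L` of `B` to
the `L` of `A`, and `N` the block of the second in the other direction. The conditions `f(V₁) ⊆ V₂`,
`g(V₂) ⊆ V₁` say exactly that `MN = NM = s` and that the other blocks are given by explicit formulas
in `M`, `N`, `s` and freely chosen blocks (`exists_params`, with converses `inGraph_mapF`,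
`inGraph_mapG` and uniqueness `graph_params_inj`). The number of free entries is `ℓ(r - ℓ) + r(d - r
- ℓ) = r(d - r) - ℓ²`. So each chart is represented by the local model. At the given field-valued
point `M = N = 0`, because on `V₁` the `I`-coordinates already control the whole `A`-part, and
symmetrically on `V₂`.

Linked pairs form a Zariski sheaf (`linkedFunctor_isSheaf`), and the charts are open subfunctors
which cover it, as is checked over residue fields; hence it is representable. In any representing
scheme the locus of a chart is isomorphic to the model (`OpenChart.exists_iso`). The free parameters
of the point need not vanish, but if its residue field comes from `S` their values lift to functions
on an open set of `S`, and a translation moves the point to the origin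
(`ChartData.exists_translate`).

Sections of `p^* E` are controlled through the adjunction and through pulled-back frames
(`IsFrame.basePull`): identities between pulled-back sections are checked locally on combinations of
inverse images of sections of `E`. -/

namespace LinkedGr

noncomputable section

/-! ### Restriction of functions and sections -/

/-- Restriction of functions to a smaller open set. -/
def fres {X : Scheme.{u}} {W U : X.Opens} (h : W ≤ U) : Γ(X, U) →+* Γ(X, W) :=
  (X.presheaf.map (homOfLE h).op).hom

section res

variable {X : Scheme.{u}} {E F : X.Modules} {W W' U : X.Opens}

theorem fres_apply (h : W ≤ U) (a : Γ(X, U)) : fres h a = X.presheaf.map (homOfLE h).op a := rfl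

@[simp]
theorem fres_self (a : Γ(X, U)) : fres le_rfl a = a :=
  congr($(X.presheaf.map_id _) a)

@[simp]
theorem fres_fres (h : W ≤ U) (h' : W' ≤ W) (a : Γ(X, U)) :
    fres h' (fres h a) = fres (h'.trans h) a :=
  congr($((X.presheaf.map_comp (homOfLE h).op (homOfLE h').op).symm) a)

@[simp]
theorem res_self (v : Γ(E, U)) : res E le_rfl v = v :=
  congr($(E.presheaf.map_id _) v)

@[simp]
theorem res_res (h : W ≤ U) (h' : W' ≤ W) (v : Γ(E, U)) :
    res E h' (res E h v) = res E (h'.trans h) v :=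
  congr($((E.presheaf.map_comp (homOfLE h).op (homOfLE h').op).symm) v)

theorem res_smul (h : W ≤ U) (a : Γ(X, U)) (v : Γ(E, U)) :
    res E h (a • v) = fres h a • res E h v :=
  Scheme.Modules.map_smul E _ _ _

/-- Restriction of sections as a semilinear map. -/
def resₗ (E : X.Modules) (h : W ≤ U) : Γ(E, U) →ₛₗ[fres (X := X) h] Γ(E, W) where
  toFun := res E h
  map_add' v w := map_add (E.presheaf.map (homOfLE h).op).hom v w
  map_smul' := res_smul h

theorem res_add (h : W ≤ U) (v w : Γ(E, U)) : res E h (v + w) = res E h v + res E h w :=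
  map_add (resₗ E h) v w

theorem res_zero (h : W ≤ U) : res E h (0 : Γ(E, U)) = 0 :=
  map_zero (resₗ E h)

theorem res_sum {ι : Type*} (s : Finset ι) (h : W ≤ U) (v : ι → Γ(E, U)) :
    res E h (∑ i ∈ s, v i) = ∑ i ∈ s, res E h (v i) :=
  map_sum (resₗ E h) v s

theorem app_res (f : E ⟶ F) (h : W ≤ U) (v : Γ(E, U)) :
    f.app W (res E h v) = res F h (f.app U v) :=
  congr($(f.mapPresheaf.naturality (homOfLE h).op) v)

theorem app_smul (f : E ⟶ F) (a : Γ(X, U)) (v : Γ(E, U)) :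
    f.app U (a • v) = a • f.app U v := Scheme.Modules.Hom.app_smul f a v

theorem app_sum {ι : Type*} (s : Finset ι) (f : E ⟶ F) (v : ι → Γ(E, U)) :
    f.app U (∑ i ∈ s, v i) = ∑ i ∈ s, f.app U (v i) :=
  map_sum (sectionMap f U) v s

/-- Sections of a sheaf of modules which agree locally are equal. -/
theorem section_ext (v w : Γ(E, U))
    (H : ∀ x ∈ U, ∃ (W : X.Opens) (h : W ≤ U), x ∈ W ∧ res E h v = res E h w) : v = w := by
  choose! W h hx hv using H
  have := TopCat.Sheaf.eq_of_locally_eq' (X := X) (⟨E.presheaf, E.isSheaf⟩ : TopCat.Sheaf Ab X)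
    (fun x : U => W x) U (fun x => homOfLE (h x x.2))
    (fun x hx' => TopologicalSpace.Opens.mem_iSup.mpr ⟨⟨x, hx'⟩, hx x hx'⟩) v w
    (fun x => hv x x.2)
  exact this

/-- Functions which agree locally are equal. -/
theorem function_ext (v w : Γ(X, U))
    (H : ∀ x ∈ U, ∃ (W : X.Opens) (h : W ≤ U), x ∈ W ∧ fres h v = fres h w) : v = w := by
  choose! W h hx hv using H
  exact TopCat.Sheaf.eq_of_locally_eq' X.sheaf
    (fun x : U => W x) U (fun x => homOfLE (h x x.2))
    (fun x hx' => TopologicalSpace.Opens.mem_iSup.mpr ⟨⟨x, hx'⟩, hx x hx'⟩) v w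
    (fun x => hv x x.2)

/-- A compatible family of functions on an open cover comes from a function on the union. -/
theorem exists_glue {ι : Type u} (W : ι → X.Opens) (a : ∀ i, Γ(X, W i))
    (H : ∀ i j, fres (inf_le_left : W i ⊓ W j ≤ W i) (a i) = fres inf_le_right (a j)) :
    ∃ b : Γ(X, iSup W), ∀ i, fres (le_iSup W i) b = a i := by
  obtain ⟨b, hb, -⟩ := TopCat.Sheaf.existsUnique_gluing X.sheaf W a H
  exact ⟨b, hb⟩

end res

/-! ### Pulling back sections -/

section homMk

variable {X : Scheme.{u}} {M N : X.Modules}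

/-- A morphism of sheaves of modules given on sections. -/
def homMk (φ : ∀ U : X.Opens, Γ(M, U) →ₗ[Γ(X, U)] Γ(N, U))
    (H : ∀ {W U : X.Opens} (h : W ≤ U) (v : Γ(M, U)), φ W (res M h v) = res N h (φ U v)) :
    M ⟶ N :=
  ⟨PresheafOfModules.homMk
    { app := fun U => AddCommGrpCat.ofHom (φ U.unop).toAddMonoidHom
      naturality := fun U W i => by
        ext v
        exact H i.unop.le v }
    (fun U a v => (φ U.unop).map_smul a v)⟩

end homMk

section pull

variable {S T : Scheme.{u}} (p : T ⟶ S) (E F : S.Modules)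

/-- The inverse image of sections of `E` over `U`, restricted to an open subset of `p⁻¹ U`. -/
def basePull {U : S.Opens} {A : T.Opens} (hA : A ≤ p ⁻¹ᵁ U) :
    Γ(E, U) →ₛₗ[(p.appLE U A hA).hom] Γ(bc p E, A) where
  toFun v := res (bc p E) hA (((Scheme.Modules.pullbackPushforwardAdjunction p).unit.app E).app U v)
  map_add' v w := by
    rw [map_add (((Scheme.Modules.pullbackPushforwardAdjunction p).unit.app E).app U).hom]
    exact res_add _ _ _
  map_smul' a v := by
    have : ((Scheme.Modules.pullbackPushforwardAdjunction p).unit.app E).app U (a • v) =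
      p.app U a • (show Γ(bc p E, p ⁻¹ᵁ U) from
        ((Scheme.Modules.pullbackPushforwardAdjunction p).unit.app E).app U v) :=
      Scheme.Modules.Hom.app_smul _ _ _
    rw [this]
    exact res_smul _ _ _

end pull

section semilinear

variable {X Y : Scheme.{u}} {h : Y ⟶ X} {M : X.Modules} {N : Y.Modules} {U : X.Opens} {A : Y.Opens}
  {hA : A ≤ h ⁻¹ᵁ U}

theorem semilinear_smul (φ : Γ(M, U) →ₛₗ[(h.appLE U A hA).hom] Γ(N, A)) (a : Γ(X, U))
    (v : Γ(M, U)) : φ (a • v) = h.appLE U A hA a • φ v := LinearMap.map_smulₛₗ _ _ _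

theorem semilinear_add (φ : Γ(M, U) →ₛₗ[(h.appLE U A hA).hom] Γ(N, A))
    (v w : Γ(M, U)) : φ (v + w) = φ v + φ w := map_add _ _ _

theorem semilinear_zero (φ : Γ(M, U) →ₛₗ[(h.appLE U A hA).hom] Γ(N, A)) : φ 0 = 0 := map_zero _

theorem semilinear_sum (φ : Γ(M, U) →ₛₗ[(h.appLE U A hA).hom] Γ(N, A)) {κ : Type*} (s : Finset κ)
    (v : κ → Γ(M, U)) : φ (∑ i ∈ s, v i) = ∑ i ∈ s, φ (v i) := map_sum _ _ _

end semilinear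

section pull

variable {S T T' : Scheme.{u}} (p : T ⟶ S) {E F : S.Modules}

theorem appLE_fres {X Y : Scheme.{u}} (h : X ⟶ Y) {U W : Y.Opens} {A : X.Opens} (hW : W ≤ U)
    (hA : A ≤ h ⁻¹ᵁ W) (a : Γ(Y, U)) :
    h.appLE W A hA (fres hW a) = h.appLE U A (hA.trans (h.preimage_mono hW)) a :=
  congr($(h.map_appLE hA (homOfLE hW).op) a)

theorem fres_appLE {X Y : Scheme.{u}} (h : X ⟶ Y) {U : Y.Opens} {A B : X.Opens}
    (hA : A ≤ h ⁻¹ᵁ U) (hB : B ≤ A) (a : Γ(Y, U)) :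
    fres hB (h.appLE U A hA a) = h.appLE U B (hB.trans hA) a :=
  congr($(h.appLE_map hA (homOfLE hB).op) a)

theorem appLE_appLE {X Y Z : Scheme.{u}} (h : X ⟶ Y) (p : Y ⟶ Z) (q : X ⟶ Z) (w : h ≫ p = q)
    {U : Z.Opens} {A : Y.Opens} {B : X.Opens}
    (hA : A ≤ p ⁻¹ᵁ U) (hB : B ≤ h ⁻¹ᵁ A) (hB' : B ≤ q ⁻¹ᵁ U) (a : Γ(Z, U)) :
    h.appLE A B hB (p.appLE U A hA a) = q.appLE U B hB' a := by
  subst w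
  exact congr($(Scheme.Hom.appLE_comp_appLE h p U A B hA hB) a)

theorem le_preimage_comp {h : T' ⟶ T} {p : T ⟶ S} {q : T' ⟶ S} (w : h ≫ p = q) {U : S.Opens}
    {A : T.Opens} {B : T'.Opens} (hA : A ≤ p ⁻¹ᵁ U) (hB : B ≤ h ⁻¹ᵁ A) : B ≤ q ⁻¹ᵁ U := by
  subst w
  exact hB.trans (h.preimage_mono hA)

variable (E) in
/-- The inverse image of sections of `E` over `U`. -/
def unitSection (U : S.Opens) (v : Γ(E, U)) : Γ(bc p E, p ⁻¹ᵁ U) :=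
  ((Scheme.Modules.pullbackPushforwardAdjunction p).unit.app E).app U v

theorem unitSection_res {U W : S.Opens} (hW : W ≤ U) (v : Γ(E, U)) :
    unitSection p E W (res E hW v) =
      res (bc p E) (p.preimage_mono hW) (unitSection p E U v) :=
  app_res ((Scheme.Modules.pullbackPushforwardAdjunction p).unit.app E) hW v

theorem basePull_apply {U : S.Opens} {A : T.Opens} (hA : A ≤ p ⁻¹ᵁ U) (v : Γ(E, U)) :
    basePull p E hA v = res (bc p E) hA (unitSection p E U v) := rfl

theorem basePull_res {U W : S.Opens} {A : T.Opens} (hW : W ≤ U) (hA : A ≤ p ⁻¹ᵁ W) (v : Γ(E, U)) :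
    basePull p E hA (res E hW v) = basePull p E (hA.trans (p.preimage_mono hW)) v := by
  rw [basePull_apply, basePull_apply, unitSection_res, res_res]

theorem res_basePull {U : S.Opens} {A B : T.Opens} (hA : A ≤ p ⁻¹ᵁ U) (hB : B ≤ A) (v : Γ(E, U)) :
    res (bc p E) hB (basePull p E hA v) = basePull p E (hB.trans hA) v := by
  rw [basePull_apply, basePull_apply, res_res]

theorem bcMap_basePull {U : S.Opens} {A : T.Opens} (hA : A ≤ p ⁻¹ᵁ U) (f : E ⟶ F) (v : Γ(E, U)) :
    (bcMap p f).app A (basePull p E hA v) = basePull p F hA (f.app U v) := by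
  rw [basePull_apply, basePull_apply, app_res]
  congr 1
  have := congr(($((Scheme.Modules.pullbackPushforwardAdjunction p).unit.naturality f)).app U v)
  exact this.symm

theorem basePull_smul {U : S.Opens} {A : T.Opens} (hA : A ≤ p ⁻¹ᵁ U) (a : Γ(S, U)) (v : Γ(E, U)) :
    basePull p E hA (a • v) = p.appLE U A hA a • basePull p E hA v :=
  semilinear_smul (basePull p E hA) a v

theorem basePull_sum {U : S.Opens} {A : T.Opens} (hA : A ≤ p ⁻¹ᵁ U) {κ : Type*} (s : Finset κ)
    (v : κ → Γ(E, U)) : basePull p E hA (∑ i ∈ s, v i) = ∑ i ∈ s, basePull p E hA (v i) :=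
  semilinear_sum (basePull p E hA) s v

variable {p}

/-- Stated as an existence so that `pull`, which is chosen from it, does not unfold to pullback
functors; everything about it goes through semilinearity and `pull_apply`. -/
theorem exists_pull (h : T' ⟶ T) {p : T ⟶ S} {q : T' ⟶ S} (w : h ≫ p = q) (E : S.Modules)
    {U : T.Opens} {A : T'.Opens} (hA : A ≤ h ⁻¹ᵁ U) :
    ∃ φ : Γ(bc p E, U) →ₛₗ[(h.appLE U A hA).hom] Γ(bc q E, A),
      ∀ v, φ v = (bcComp h p q w E).app A (basePull h (bc p E) hA v) :=
  ⟨(sectionMap (bcComp h p q w E) A).comp (basePull h (bc p E) hA), fun _ => rfl⟩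

/-- The inverse image along `h : T' ⟶ T` of sections of `p^* E`, as sections of `q^* E` over an open
subset of the preimage. -/
def pull (h : T' ⟶ T) {p : T ⟶ S} {q : T' ⟶ S} (w : h ≫ p = q) (E : S.Modules)
    {U : T.Opens} {A : T'.Opens} (hA : A ≤ h ⁻¹ᵁ U) :
    Γ(bc p E, U) →ₛₗ[(h.appLE U A hA).hom] Γ(bc q E, A) :=
  (exists_pull h w E hA).choose

variable {h : T' ⟶ T} {q : T' ⟶ S} (w : h ≫ p = q)

theorem pull_apply {U : T.Opens} {A : T'.Opens} (hA : A ≤ h ⁻¹ᵁ U) (v : Γ(bc p E, U)) :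
    pull h w E hA v = (bcComp h p q w E).app A (basePull h (bc p E) hA v) :=
  (exists_pull h w E hA).choose_spec v

theorem pull_smul {U : T.Opens} {A : T'.Opens} (hA : A ≤ h ⁻¹ᵁ U) (a : Γ(T, U))
    (v : Γ(bc p E, U)) : pull h w E hA (a • v) = h.appLE U A hA a • pull h w E hA v :=
  semilinear_smul (pull h w E hA) a v

theorem pull_add {U : T.Opens} {A : T'.Opens} (hA : A ≤ h ⁻¹ᵁ U)
    (v v' : Γ(bc p E, U)) : pull h w E hA (v + v') = pull h w E hA v + pull h w E hA v' :=
  semilinear_add (pull h w E hA) v v'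

theorem pull_zero {U : T.Opens} {A : T'.Opens} (hA : A ≤ h ⁻¹ᵁ U) :
    pull h w E hA (0 : Γ(bc p E, U)) = 0 :=
  semilinear_zero (pull h w E hA)

theorem pull_sum {U : T.Opens} {A : T'.Opens} (hA : A ≤ h ⁻¹ᵁ U) {κ : Type*} (s : Finset κ)
    (v : κ → Γ(bc p E, U)) : pull h w E hA (∑ i ∈ s, v i) = ∑ i ∈ s, pull h w E hA (v i) :=
  semilinear_sum (pull h w E hA) s v

theorem res_pullSection {U : T.Opens} {A : T'.Opens} (hA : A ≤ h ⁻¹ᵁ U) (v : Γ(bc p E, U)) :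
    res (bc q E) hA (pullSection h p q w E U v) = pull h w E hA v := by
  rw [pull_apply, basePull_apply, app_res, pullSection, unitSection]

theorem pull_res {U W : T.Opens} {A : T'.Opens} (hW : W ≤ U) (hA : A ≤ h ⁻¹ᵁ W)
    (v : Γ(bc p E, U)) :
    pull h w E hA (res _ hW v) = pull h w E (hA.trans (h.preimage_mono hW)) v := by
  rw [pull_apply, pull_apply, basePull_res]

theorem res_pull {U : T.Opens} {A B : T'.Opens} (hA : A ≤ h ⁻¹ᵁ U) (hB : B ≤ A)
    (v : Γ(bc p E, U)) :
    res _ hB (pull h w E hA v) = pull h w E (hB.trans hA) v := by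
  rw [pull_apply, pull_apply, ← app_res, res_basePull]

/-- Under `pullbackComp` the composite of the units for `p` and `h` becomes the unit for `h ≫ p`,
because `pullbackComp` is conjugate to the comparison of pushforwards. -/
theorem pull_basePull {U : S.Opens} {A : T.Opens} {B : T'.Opens} (hA : A ≤ p ⁻¹ᵁ U)
    (hB : B ≤ h ⁻¹ᵁ A) (v : Γ(E, U)) :
    pull h w E hB (basePull p E hA v) = basePull q E (le_preimage_comp w hA hB) v := by
  subst w
  have key := unit_conjugateEquiv
    ((Scheme.Modules.pullbackPushforwardAdjunction p).comp
      (Scheme.Modules.pullbackPushforwardAdjunction h))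
    (Scheme.Modules.pullbackPushforwardAdjunction (h ≫ p)) (Scheme.Modules.pullbackComp h p).inv E
  rw [Scheme.Modules.conjugateEquiv_pullbackComp_inv] at key
  have key2 := congr($key ≫ (Scheme.Modules.pushforward (h ≫ p)).map
    ((Scheme.Modules.pullbackComp h p).hom.app E))
  rw [Category.assoc, Category.assoc, ← Functor.map_comp, Iso.inv_hom_id_app,
    CategoryTheory.Functor.map_id] at key2
  have key3 := congr(($key2).app U v)
  rw [basePull_apply, basePull_apply, pull_res, pull_apply, basePull_apply, app_res]
  have h1 : bcComp h p (h ≫ p) rfl E = (Scheme.Modules.pullbackComp h p).hom.app E := by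
    simp [bcComp, Scheme.Modules.pullbackCongr]
  rw [h1]
  exact congr(res (bc (h ≫ p) E) (le_preimage_comp rfl hA hB) $key3)

end pull

/-! ### Frames -/

section frame

variable {X : Scheme.{u}} {E F : X.Modules} {U W W' : X.Opens} {ι κ : Type} {e : ι → Γ(E, U)}

/-- The basis of sections over a smaller open set defined by a frame. -/
def IsFrame.basis (he : IsFrame E U e) (h : W ≤ U) : Module.Basis ι Γ(X, W) Γ(E, W) :=
  Module.Basis.mk (he W h).1 (he W h).2.ge

@[simp]
theorem IsFrame.basis_apply (he : IsFrame E U e) (h : W ≤ U) (i : ι) :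
    he.basis h i = res E h (e i) := Module.Basis.mk_apply _ _ _

theorem IsFrame.mono (he : IsFrame E U e) (h : W ≤ U) : IsFrame E W (fun i => res E h (e i)) := by
  intro W' h'
  simpa using he W' (h'.trans h)

theorem IsFrame.reindex (he : IsFrame E U e) (σ : κ ≃ ι) : IsFrame E U (e ∘ σ) := by
  intro W h
  refine ⟨(he W h).1.comp σ σ.injective, ?_⟩
  rw [← (he W h).2]
  congr 1
  exact σ.surjective.range_comp (fun i => res E h (e i))

variable [Fintype ι]

/-- The coordinates of a section with respect to a frame. -/
def IsFrame.coord (he : IsFrame E U e) (h : W ≤ U) : Γ(E, W) ≃ₗ[Γ(X, W)] (ι → Γ(X, W)) :=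
  (he.basis h).equivFun

theorem IsFrame.sum_coord (he : IsFrame E U e) (h : W ≤ U) (v : Γ(E, W)) :
    ∑ i, he.coord h v i • res E h (e i) = v := by
  simpa [IsFrame.coord] using (he.basis h).sum_equivFun v

theorem IsFrame.coord_sum (he : IsFrame E U e) (h : W ≤ U) (a : ι → Γ(X, W)) :
    he.coord h (∑ i, a i • res E h (e i)) = a := by
  have := (he.basis h).equivFun.apply_symm_apply a
  rw [Module.Basis.equivFun_symm_apply] at this
  simp only [he.basis_apply] at this
  exact this

theorem IsFrame.coord_eq (he : IsFrame E U e) (h : W ≤ U) {v : Γ(E, W)} {a : ι → Γ(X, W)}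
    (hv : v = ∑ i, a i • res E h (e i)) : he.coord h v = a := by
  rw [hv, he.coord_sum]

theorem IsFrame.coord_self [DecidableEq ι] (he : IsFrame E U e) (h : W ≤ U) (i : ι) :
    he.coord h (res E h (e i)) = Pi.single i 1 := by
  refine he.coord_eq h ?_
  simp [Pi.single_apply, Finset.sum_ite_eq', ite_smul]

theorem IsFrame.coord_res (he : IsFrame E U e) (h : W ≤ U) (h' : W' ≤ W) (v : Γ(E, W)) (i : ι) :
    he.coord (h'.trans h) (res E h' v) i = fres h' (he.coord h v i) := by
  refine congrFun (he.coord_eq (a := fun i => fres h' (he.coord h v i)) _ ?_) i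
  conv_lhs => rw [← he.sum_coord h v]
  rw [res_sum]
  simp [res_smul]

theorem IsFrame.ext_coord (he : IsFrame E U e) (h : W ≤ U) {v w : Γ(E, W)}
    (H : ∀ i, he.coord h v i = he.coord h w i) : v = w :=
  (he.coord h).injective (funext H)

theorem IsFrame.coord_reindex [Fintype κ] (he : IsFrame E U e) (σ : κ ≃ ι) (h : W ≤ U)
    (v : Γ(E, W)) (i : κ) : (he.reindex σ).coord h v i = he.coord h v (σ i) := by
  refine congrFun ((he.reindex σ).coord_eq (a := fun i => he.coord h v (σ i)) _ ?_) i
  conv_lhs => rw [← he.sum_coord h v]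
  exact (Equiv.sum_comp σ (fun i => he.coord h v i • res E h (e i))).symm

theorem IsFrame.coord_mono (he : IsFrame E U e) (h : W ≤ U) (h' : W' ≤ W) (v : Γ(E, W')) :
    (he.mono h).coord h' v = he.coord (h'.trans h) v := by
  refine (he.mono h).coord_eq h' ?_
  conv_lhs => rw [← he.sum_coord (h'.trans h) v]
  simp

/-- A family of sections with coordinate functions is a frame. -/
theorem isFrame_of_coord [DecidableEq ι] (c : ∀ (W : X.Opens), W ≤ U → (Γ(E, W) →ₗ[Γ(X, W)] (ι → Γ(X, W))))
    (hc : ∀ W h i, c W h (res E h (e i)) = Pi.single i 1)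
    (hv : ∀ W h v, ∑ i, c W h v i • res E h (e i) = v) : IsFrame E U e := by
  intro W h
  constructor
  · rw [Fintype.linearIndependent_iff]
    intro g hg i
    have := congr(c W h $hg)
    rw [map_sum] at this
    simp only [map_smul, hc, map_zero] at this
    simpa [Finset.sum_apply, Pi.single_apply] using congrFun this i
  · rw [eq_top_iff]
    rintro v -
    rw [← hv W h v]
    exact Submodule.sum_mem _ fun i _ => Submodule.smul_mem _ _ (Submodule.subset_span ⟨i, rfl⟩)

/-- The family with matrix `G` with respect to a frame. -/
def combine {κ : Type*} (e : ι → Γ(E, U)) (G : Matrix ι κ Γ(X, U)) (k : κ) : Γ(E, U) := ∑ i, G i k • e i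

theorem IsFrame.coord_combine {κ : Type*} (he : IsFrame E U e) (G : Matrix ι κ Γ(X, U)) (h : W ≤ U) (k : κ) (i : ι) :
    he.coord h (res E h (combine e G k)) i = fres h (G i k) := by
  refine congrFun (he.coord_eq (a := fun i => fres h (G i k)) h ?_) i
  simp [combine, res_sum, res_smul]

/-- An invertible change of a frame is a frame. -/
theorem IsFrame.combine [Fintype κ] [DecidableEq ι] [DecidableEq κ] (he : IsFrame E U e)
    (G : Matrix ι κ Γ(X, U)) (H : Matrix κ ι Γ(X, U)) (hGH : G * H = 1) (hHG : H * G = 1) :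
    IsFrame E U (combine e G) := by
  refine isFrame_of_coord (fun W h => (Matrix.mulVecLin (H.map (fres h))).comp
    (he.coord h).toLinearMap) ?_ ?_
  · intro W h k
    have : he.coord h (res E h (LinkedGr.combine e G k)) = (G.map (fres h)).col k := by
      ext i; rw [he.coord_combine]; rfl
    rw [LinearMap.comp_apply, LinearEquiv.coe_coe, this, Matrix.mulVecLin_apply]
    have h2 : H.map (fres h) * G.map (fres h) = 1 := by
      rw [← Matrix.map_mul, hHG, Matrix.map_one _ (map_zero _) (map_one _)]
    rw [← Matrix.mulVec_single_one, Matrix.mulVec_mulVec, h2, Matrix.one_mulVec]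
  · intro W h v
    apply he.ext_coord h
    intro i
    have h2 : G.map (fres h) * H.map (fres h) = 1 := by
      rw [← Matrix.map_mul, hGH, Matrix.map_one _ (map_zero _) (map_one _)]
    have h3 : he.coord h v i = (G.map (fres h) * H.map (fres h)).mulVec (he.coord h v) i := by
      rw [h2, Matrix.one_mulVec]
    rw [map_sum, Finset.sum_apply, h3, ← Matrix.mulVec_mulVec]
    refine Finset.sum_congr rfl fun k _ => ?_
    rw [map_smul, Pi.smul_apply, he.coord_combine, smul_eq_mul, mul_comm]
    rfl

end frame

/-! ### The inverse image of a frame is a frame -/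

section desc

variable {S T : Scheme.{u}} {p : T ⟶ S} {E : S.Modules}

/-- By adjunction a morphism out of `p^* E` is a morphism out of `E`, so it is determined on inverse
images of sections, although these do not exhaust the sections of `p^* E`. -/
theorem bc_hom_ext {N : T.Modules} {φ ψ : bc p E ⟶ N}
    (H : ∀ (U : S.Opens) (v : Γ(E, U)),
      φ.app _ (unitSection p E U v) = ψ.app _ (unitSection p E U v)) : φ = ψ := by
  apply ((Scheme.Modules.pullbackPushforwardAdjunction p).homEquiv _ _).injective
  rw [Adjunction.homEquiv_unit, Adjunction.homEquiv_unit]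
  ext U v
  exact H U v

/-- The three hypotheses make `φ` a morphism from `E` to `p_* N`; its adjoint is the required map.
-/
theorem bc_desc {N : T.Modules} (φ : ∀ U : S.Opens, Γ(E, U) → Γ(N, p ⁻¹ᵁ U))
    (hadd : ∀ U v w, φ U (v + w) = φ U v + φ U w)
    (hsmul : ∀ (U : S.Opens) (a : Γ(S, U)) v, φ U (a • v) = p.app U a • φ U v)
    (hres : ∀ {W U : S.Opens} (h : W ≤ U) (v : Γ(E, U)),
      φ W (res E h v) = res N (p.preimage_mono h) (φ U v)) :
    ∃ ψ : bc p E ⟶ N, ∀ U v, ψ.app _ (unitSection p E U v) = φ U v := by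
  let φ' : E ⟶ (Scheme.Modules.pushforward p).obj N :=
    homMk (fun U => { toFun := φ U, map_add' := hadd U, map_smul' := hsmul U })
      (fun h v => hres h v)
  refine ⟨((Scheme.Modules.pullbackPushforwardAdjunction p).homEquiv _ _).symm φ', fun U v => ?_⟩
  have := ((Scheme.Modules.pullbackPushforwardAdjunction p).homEquiv _ _).apply_symm_apply φ'
  rw [Adjunction.homEquiv_unit] at this
  exact congr(($this).app U v)

end desc

/-! ### The extension `j_* j^* M` of a restriction to an open set. -/

section restrictTo

variable {T : Scheme.{u}} (P : T.Opens) (M : T.Modules)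

/-- The sheaf of modules of sections of `M` over `V ∩ P`. -/
def restrictTo : T.Modules :=
  (Scheme.Modules.pushforward P.ι).obj (Scheme.Modules.restrict M P.ι)

theorem restrictTo_le (V : T.Opens) : P.ι ''ᵁ P.ι ⁻¹ᵁ V ≤ V := P.ι.image_preimage_le V

theorem restrictTo_le' (V : T.Opens) : P.ι ''ᵁ P.ι ⁻¹ᵁ V ≤ P := by
  rw [Scheme.Hom.image_preimage_eq_opensRange_inf]
  simp

theorem le_restrictTo {V : T.Opens} (h : V ≤ P) : V ≤ P.ι ''ᵁ P.ι ⁻¹ᵁ V := by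
  rw [Scheme.Hom.image_preimage_eq_opensRange_inf]
  simpa using h

/-- Sections of `restrictTo P M` are sections of `M`. -/
def ofRestrictTo {V : T.Opens} (v : Γ(restrictTo P M, V)) : Γ(M, P.ι ''ᵁ P.ι ⁻¹ᵁ V) := v

/-- Sections of `M` as sections of `restrictTo P M`. -/
def toRestrictTo {V : T.Opens} (v : Γ(M, P.ι ''ᵁ P.ι ⁻¹ᵁ V)) : Γ(restrictTo P M, V) := v

theorem toRestrictTo_smul {V : T.Opens} (a : Γ(T, V)) (v : Γ(M, P.ι ''ᵁ P.ι ⁻¹ᵁ V)) :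
    toRestrictTo P M (fres (restrictTo_le P V) a • v) = a • toRestrictTo P M v := by
  have h : fres (restrictTo_le P V) a = (P.ι.appIso (P.ι ⁻¹ᵁ V)).inv (P.ι.app V a) :=
    congr($(P.ι.app_appIso_inv V) a).symm
  rw [h]
  rfl

theorem res_toRestrictTo {V W : T.Opens} (h : W ≤ V) (v : Γ(M, P.ι ''ᵁ P.ι ⁻¹ᵁ V)) :
    res (restrictTo P M) h (toRestrictTo P M v) =
      toRestrictTo P M (res M (P.ι.image_mono (P.ι.preimage_mono h)) v) := rfl

end restrictTo

/-! ### Frames of the pulled-back module. -/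

section basePullFrame

variable {S T : Scheme.{u}} (p : T ⟶ S) {E : S.Modules} {U : S.Opens} {ι : Type} [Fintype ι]
  {e : ι → Γ(E, U)}

/-- The structure sheaf as a sheaf of modules. -/
abbrev unitMod (T : Scheme.{u}) : T.Modules := SheafOfModules.unit T.ringCatSheaf

/-- A function as a section of the structure sheaf. -/
def toUnit {T : Scheme.{u}} {V : T.Opens} (a : Γ(T, V)) : Γ(unitMod T, V) := a

/-- A section of the structure sheaf as a function. -/
def ofUnit {T : Scheme.{u}} {V : T.Opens} (a : Γ(unitMod T, V)) : Γ(T, V) := a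

/-- A coordinate function of the frame exists only over `U`. To pull it back as a globally defined
morphism its target is taken to be `j_* j^* 𝒪`, with `j` the inclusion of `p⁻¹ U`. -/
theorem IsFrame.exists_coord_hom (he : IsFrame E U e) (i : ι) :
    ∃ l : bc p E ⟶ restrictTo (p ⁻¹ᵁ U) (unitMod T), ∀ (W : S.Opens) (v : Γ(E, W)),
      l.app _ (unitSection p E W v) = toRestrictTo (p ⁻¹ᵁ U) _ (toUnit
        (p.appLE (W ⊓ U) _ (le_inf (restrictTo_le _ _) (restrictTo_le' _ _))
          (he.coord inf_le_right (res E (inf_le_left : W ⊓ U ≤ W) v) i))) := by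
  apply bc_desc (p := p) (E := E) (N := restrictTo (p ⁻¹ᵁ U) (unitMod T))
  · intro W v w
    rw [res_add, map_add, Pi.add_apply, map_add]
    rfl
  · intro W a v
    rw [res_smul, map_smul, Pi.smul_apply, smul_eq_mul, map_mul, ← toRestrictTo_smul]
    congr 1
    erw [appLE_fres]
    rw [Scheme.Hom.app_eq_appLE, fres_appLE]
    rfl
  · intro W' W h v
    rw [res_toRestrictTo]
    congr 1
    have h1 : res E (inf_le_left : W' ⊓ U ≤ W') (res E h v) =
      res E (inf_le_inf_right U h) (res E (inf_le_left : W ⊓ U ≤ W) v) := by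
      rw [res_res, res_res]
    rw [h1, he.coord_res (inf_le_right : W ⊓ U ≤ U) (inf_le_inf_right U h)]
    erw [appLE_fres]
    exact (fres_appLE p _ _ _).symm

theorem map_ofRestrictTo {P : T.Opens} {M N : T.Modules} (l : M ⟶ restrictTo P N) {V W : T.Opens}
    (h : W ≤ V) (v : Γ(M, V)) : ofRestrictTo P N (l.app W (res M h v)) =
      res N (P.ι.image_mono (P.ι.preimage_mono h)) (ofRestrictTo P N (l.app V v)) :=
  app_res l h v

/-- The inverse image of a frame is a frame. -/
theorem IsFrame.basePull [DecidableEq ι] (he : IsFrame E U e) :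
    IsFrame (bc p E) (p ⁻¹ᵁ U) (fun i => LinkedGr.basePull p E le_rfl (e i)) := by
  -- The pulled-back coordinate functionals take Kronecker delta values on the pulled-back frame,
  -- which gives linear independence.
  choose l hl using he.exists_coord_hom p
  let c : ∀ (V : T.Opens), V ≤ (p ⁻¹ᵁ U) → (Γ((bc p E), V) →ₗ[Γ(T, V)] (ι → Γ(T, V))) := fun V hV =>
    { toFun := fun v i => fres (le_restrictTo (p ⁻¹ᵁ U) hV) (ofUnit (ofRestrictTo (p ⁻¹ᵁ U) _ ((l i).app V v)))
      map_add' := by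
        intro v w
        ext i
        have : (l i).app V (v + w) = (l i).app V v + (l i).app V w := map_add (sectionMap (l i) V) v w
        rw [this]
        exact map_add (fres (le_restrictTo (p ⁻¹ᵁ U) hV)) _ _
      map_smul' := by
        intro a v
        ext i
        have : (l i).app V (a • v) = a • (l i).app V v := (sectionMap (l i) V).map_smul a v
        rw [this]
        have h2 := (toRestrictTo_smul (p ⁻¹ᵁ U) (unitMod T) a ((l i).app V v)).symm
        have h3 := congr(fres (le_restrictTo (p ⁻¹ᵁ U) hV) (ofUnit (ofRestrictTo (p ⁻¹ᵁ U) _ $h2)))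
        refine h3.trans ?_
        refine (map_mul (fres (le_restrictTo (p ⁻¹ᵁ U) hV)) _ _).trans ?_
        rw [fres_fres, fres_self]
        rfl }
  refine isFrame_of_coord c ?_ ?_
  · intro V hV i
    ext j
    have h1 : res (bc p E) hV (LinkedGr.basePull p E le_rfl (e i)) = res (bc p E) hV (unitSection p E U (e i)) := by
      rw [basePull_apply, res_self]
    show fres (le_restrictTo (p ⁻¹ᵁ U) hV) (ofUnit (ofRestrictTo (p ⁻¹ᵁ U) _ ((l j).app V _))) = _
    rw [h1, map_ofRestrictTo, hl]
    refine (fres_fres ((p ⁻¹ᵁ U).ι.image_mono ((p ⁻¹ᵁ U).ι.preimage_mono hV)) (le_restrictTo (p ⁻¹ᵁ U) hV) _).trans ?_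
    refine (fres_appLE p _ _ _).trans ?_
    have h2 := he.coord_self (inf_le_right : U ⊓ U ≤ U) i
    rw [h2]
    by_cases hij : j = i
    · subst hij; simp
    · simp [hij]
  -- For spanning, two morphisms `p^* E ⟶ j_* j^* p^* E` are compared: `ε` is restriction and `δ`
  -- expands a section by its coordinates. They agree on inverse images of sections of `E`, hence
  -- everywhere by `bc_hom_ext`.
  · let ε : (bc p E) ⟶ restrictTo (p ⁻¹ᵁ U) (bc p E) := (Scheme.Modules.restrictAdjunction (p ⁻¹ᵁ U).ι).unit.app (bc p E)
    have hε : ∀ V (v : Γ((bc p E), V)), ε.app V v = toRestrictTo (p ⁻¹ᵁ U) (bc p E) (res (bc p E) (restrictTo_le (p ⁻¹ᵁ U) V) v) :=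
      fun V v => rfl
    let δ : (bc p E) ⟶ restrictTo (p ⁻¹ᵁ U) (bc p E) := homMk (fun V =>
      { toFun := fun v => toRestrictTo (p ⁻¹ᵁ U) (bc p E) (∑ i, ofUnit (ofRestrictTo (p ⁻¹ᵁ U) _ ((l i).app V v)) •
          res (bc p E) (restrictTo_le' (p ⁻¹ᵁ U) V) (LinkedGr.basePull p E le_rfl (e i)))
        map_add' := by
          intro v w
          have : ∀ i, (l i).app V (v + w) = (l i).app V v + (l i).app V w :=
            fun i => map_add (sectionMap (l i) V) v w
          simp only [this]
          refine Eq.trans ?_ (congrArg (toRestrictTo (p ⁻¹ᵁ U) (bc p E)) Finset.sum_add_distrib)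
          congr 1
          exact Finset.sum_congr rfl fun i _ => add_smul _ _ _
        map_smul' := by
          intro a v
          have : ∀ i, (l i).app V (a • v) = toRestrictTo (p ⁻¹ᵁ U) _
              (fres (restrictTo_le (p ⁻¹ᵁ U) V) a • ofRestrictTo (p ⁻¹ᵁ U) _ ((l i).app V v)) :=
            fun i => ((sectionMap (l i) V).map_smul a v).trans (toRestrictTo_smul (p ⁻¹ᵁ U) _ _ _).symm
          simp only [this]
          refine Eq.trans ?_ (toRestrictTo_smul (p ⁻¹ᵁ U) _ _ _)
          congr 1
          rw [Finset.smul_sum]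
          exact Finset.sum_congr rfl fun i _ => mul_smul _ _ _ }) (by
        intro W V h v
        refine Eq.trans ?_ (res_toRestrictTo (p ⁻¹ᵁ U) (bc p E) h _).symm
        refine congrArg (toRestrictTo (p ⁻¹ᵁ U) (bc p E)) ?_
        refine Eq.trans ?_ (res_sum _ _ _).symm
        refine Finset.sum_congr rfl fun i _ => ?_
        rw [res_smul, res_res, map_ofRestrictTo]
        rfl)
    have hδ : ∀ V (v : Γ((bc p E), V)), δ.app V v = toRestrictTo (p ⁻¹ᵁ U) (bc p E) (∑ i,
        ofUnit (ofRestrictTo (p ⁻¹ᵁ U) _ ((l i).app V v)) •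
          res (bc p E) (restrictTo_le' (p ⁻¹ᵁ U) V) (LinkedGr.basePull p E le_rfl (e i))) := fun V v => rfl
    have key : ε = δ := by
      apply bc_hom_ext
      intro W v
      rw [hε, hδ]
      congr 1
      have h1 : (p ⁻¹ᵁ U).ι ''ᵁ (p ⁻¹ᵁ U).ι ⁻¹ᵁ p ⁻¹ᵁ W ≤ p ⁻¹ᵁ (W ⊓ U) :=
        le_inf (restrictTo_le _ _) (restrictTo_le' _ _)
      have h2 : res (bc p E) (restrictTo_le (p ⁻¹ᵁ U) (p ⁻¹ᵁ W)) (unitSection p E W v) =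
          LinkedGr.basePull p E h1 (res E inf_le_left v) := by
        rw [basePull_res, basePull_apply]
      rw [h2]
      conv_lhs => rw [← he.sum_coord inf_le_right (res E inf_le_left v)]
      rw [basePull_sum]
      refine Finset.sum_congr rfl fun i _ => ?_
      rw [basePull_smul, hl, basePull_res]
      congr 1
      exact (res_basePull p _ _ _).symm
    intro V hV v
    have h1 : toRestrictTo (p ⁻¹ᵁ U) (bc p E) (res (bc p E) (restrictTo_le (p ⁻¹ᵁ U) V) v) = _ :=
      ((hε V v).symm.trans congr(($key).app V v)).trans (hδ V v)
    have h2 := congr(res (bc p E) (le_restrictTo (p ⁻¹ᵁ U) hV) (ofRestrictTo (p ⁻¹ᵁ U) (bc p E) $h1))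
    have h3 : res (bc p E) (le_restrictTo (p ⁻¹ᵁ U) hV) (ofRestrictTo (p ⁻¹ᵁ U) (bc p E) (toRestrictTo (p ⁻¹ᵁ U) (bc p E)
      (res (bc p E) (restrictTo_le (p ⁻¹ᵁ U) V) v))) = v := (res_res _ _ _).trans (res_self _)
    rw [h3] at h2
    refine Eq.trans ?_ h2.symm
    refine Eq.trans ?_ (res_sum _ _ _).symm
    refine Finset.sum_congr rfl fun i _ => ?_
    rw [res_smul, res_res]
    rfl

end basePullFrame

/-! ### Frames and sections along morphisms over the base. -/

section framePull

variable {S T T' T'' : Scheme.{u}} {p : T ⟶ S} {E F : S.Modules} {h : T' ⟶ T} {q : T' ⟶ S}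
  {ι : Type}

theorem IsFrame.map_iso {X : Scheme.{u}} {E F : X.Modules} {U : X.Opens} {e : ι → Γ(E, U)}
    (he : IsFrame E U e) (φ : E ⟶ F) [IsIso φ] : IsFrame F U (fun i => φ.app U (e i)) := by
  have hinv : ∀ W (v : Γ(E, W)), (inv φ).app W (φ.app W v) = v := fun W v =>
    congr(($(IsIso.hom_inv_id φ)).app W v)
  have hinv' : ∀ W (v : Γ(F, W)), φ.app W ((inv φ).app W v) = v := fun W v =>
    congr(($(IsIso.inv_hom_id φ)).app W v)
  intro W hW
  let l : Γ(E, W) ≃ₗ[Γ(X, W)] Γ(F, W) := LinearEquiv.ofLinearMap (sectionMap φ W)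
    (sectionMap (inv φ) W) (LinearMap.ext (hinv' W)) (LinearMap.ext (hinv W))
  have h1 : (fun i => res F hW (φ.app U (e i))) = l ∘ (fun i => res E hW (e i)) := by
    ext i
    exact (app_res φ hW (e i)).symm
  rw [h1]
  refine ⟨(he W hW).1.map' l.toLinearMap l.ker, ?_⟩
  rw [Set.range_comp, ← LinearEquiv.coe_coe, Submodule.span_image, (he W hW).2, Submodule.map_top,
    LinearEquiv.range]

theorem IsFrame.pull [Fintype ι] (w : h ≫ p = q) {U : T.Opens} {e : ι → Γ(bc p E, U)}
    (he : IsFrame (bc p E) U e) :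
    IsFrame (bc q E) (h ⁻¹ᵁ U) (fun i => LinkedGr.pull h w E le_rfl (e i)) := by
  classical
  have : IsIso (bcComp h p q w E) := by
    unfold bcComp
    infer_instance
  have key := (he.basePull h).map_iso (bcComp h p q w E)
  simp only [← pull_apply w] at key
  exact key

theorem IsFrame.coord_pull [Fintype ι] (w : h ≫ p = q) {U W : T.Opens} {e : ι → Γ(bc p E, U)}
    (he : IsFrame (bc p E) U e) (hW : W ≤ U) {A : T'.Opens} (hA : A ≤ h ⁻¹ᵁ W)
    (v : Γ(bc p E, W)) (i : ι) :
    (he.pull w).coord (hA.trans (h.preimage_mono hW)) (LinkedGr.pull h w E hA v) i =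
      h.appLE W A hA (he.coord hW v i) := by
  refine congrFun ((he.pull w).coord_eq (a := fun i => h.appLE W A hA (he.coord hW v i)) _ ?_) i
  conv_lhs => rw [← he.sum_coord hW v]
  rw [LinkedGr.pull_sum]
  refine Finset.sum_congr rfl fun i _ => ?_
  rw [LinkedGr.pull_smul, pull_res, res_pull]

theorem IsFrame.coord_basePull [Fintype ι] [DecidableEq ι] {U W : S.Opens} {e : ι → Γ(E, U)}
    (he : IsFrame E U e) (hW : W ≤ U) {A : T.Opens} (hA : A ≤ p ⁻¹ᵁ W)
    (v : Γ(E, W)) (i : ι) :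
    (he.basePull p).coord (hA.trans (p.preimage_mono hW)) (LinkedGr.basePull p E hA v) i =
      p.appLE W A hA (he.coord hW v i) := by
  refine congrFun ((he.basePull p).coord_eq (a := fun i => p.appLE W A hA (he.coord hW v i)) _ ?_) i
  conv_lhs => rw [← he.sum_coord hW v]
  rw [basePull_sum]
  refine Finset.sum_congr rfl fun i _ => ?_
  rw [basePull_smul, basePull_res, res_basePull]

variable {d : ℕ}

/-- Locally, sections of `p^* E` are combinations of inverse images of sections of `E`. -/
theorem IsVectorBundle.exists_repr (hE : IsVectorBundle E d) (p : T ⟶ S) {U : T.Opens}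
    (v : Γ(bc p E, U)) (x : T) (hx : x ∈ U) : ∃ (U₀ : S.Opens) (e : Fin d → Γ(E, U₀)) (W : T.Opens)
      (hW : W ≤ U) (hW' : W ≤ p ⁻¹ᵁ U₀) (a : Fin d → Γ(T, W)), x ∈ W ∧
      res _ hW v = ∑ i, a i • basePull p E hW' (e i) := by
  obtain ⟨U₀, hx₀, e, he⟩ := hE (p x)
  refine ⟨U₀, e, U ⊓ p ⁻¹ᵁ U₀, inf_le_left, inf_le_right,
    (he.basePull p).coord inf_le_right (res _ inf_le_left v), ⟨hx, hx₀⟩, ?_⟩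
  conv_lhs => rw [← (he.basePull p).sum_coord inf_le_right (res _ inf_le_left v)]
  refine Finset.sum_congr rfl fun i _ => ?_
  rw [res_basePull]

/-- Both sides are semilinear for the same map of functions, and on inverse images of sections of
`E`, which generate locally, both are the direct inverse image by `pull_basePull`. The next two
statements are proved in the same way. -/
theorem IsVectorBundle.pull_pull (hE : IsVectorBundle E d) {h' : T'' ⟶ T'} {q' : T'' ⟶ S}
    {h'' : T'' ⟶ T} (w : h ≫ p = q) (w' : h' ≫ q = q') (w'' : h'' ≫ p = q') (hh : h' ≫ h = h'')
    {U : T.Opens} {A : T'.Opens} {B : T''.Opens} (hA : A ≤ h ⁻¹ᵁ U) (hB : B ≤ h' ⁻¹ᵁ A)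
    (v : Γ(bc p E, U)) :
    pull h' w' E hB (pull h w E hA v) = pull h'' w'' E (le_preimage_comp hh hA hB) v := by
  apply section_ext
  intro x hx
  have hx' : h'' x ∈ U := le_preimage_comp hh hA hB hx
  obtain ⟨U₀, e, W, hW, hW', a, hxW, hv⟩ := hE.exists_repr p v (h'' x) hx'
  have hBW : B ⊓ h'' ⁻¹ᵁ W ≤ h' ⁻¹ᵁ (A ⊓ h ⁻¹ᵁ W) := by
    subst hh
    intro y hy
    exact ⟨hB hy.1, hy.2⟩
  refine ⟨B ⊓ h'' ⁻¹ᵁ W, inf_le_left, ⟨hx, hxW⟩, ?_⟩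
  rw [res_pull, res_pull, ← pull_res w'' hW inf_le_right, hv,
    ← pull_res w' (inf_le_left : A ⊓ h ⁻¹ᵁ W ≤ A) hBW, res_pull, ← pull_res w hW inf_le_right, hv]
  simp only [pull_sum, pull_smul, pull_basePull]
  refine Finset.sum_congr rfl fun i _ => ?_
  congr 1
  exact appLE_appLE h' h h'' hh _ _ _ _

theorem IsVectorBundle.pull_id (hE : IsVectorBundle E d) (w : 𝟙 T ≫ p = p) {U A : T.Opens}
    (hA : A ≤ 𝟙 T ⁻¹ᵁ U) (hA' : A ≤ U) (v : Γ(bc p E, U)) :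
    pull (𝟙 T) w E hA v = res _ hA' v := by
  apply section_ext
  intro x hx
  obtain ⟨U₀, e, W, hW, hW', a, hxW, hv⟩ := hE.exists_repr p v x (hA' hx)
  refine ⟨A ⊓ W, inf_le_left, ⟨hx, hxW⟩, ?_⟩
  have h1 : res (bc p E) (inf_le_left : A ⊓ W ≤ A) (res (bc p E) hA' v) =
    res (bc p E) inf_le_right (res (bc p E) hW v) := by rw [res_res, res_res]
  have h2 : A ⊓ W ≤ 𝟙 T ⁻¹ᵁ W := inf_le_right
  rw [h1, res_pull, ← pull_res w hW h2, hv]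
  simp only [pull_sum, pull_smul, pull_basePull, res_sum, res_smul, res_basePull]
  refine Finset.sum_congr rfl fun i _ => ?_
  congr 1

theorem IsVectorBundle.bcMap_pull (hE : IsVectorBundle E d) (w : h ≫ p = q) (f : E ⟶ F)
    {U : T.Opens} {A : T'.Opens} (hA : A ≤ h ⁻¹ᵁ U) (v : Γ(bc p E, U)) :
    (bcMap q f).app A (pull h w E hA v) = pull h w F hA ((bcMap p f).app U v) := by
  apply section_ext
  intro x hx
  obtain ⟨U₀, e, W, hW, hW', a, hxW, hv⟩ := hE.exists_repr p v (h x) (hA hx)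
  refine ⟨A ⊓ h ⁻¹ᵁ W, inf_le_left, ⟨hx, hxW⟩, ?_⟩
  rw [← app_res, res_pull, res_pull, ← pull_res w hW inf_le_right, ← pull_res w hW inf_le_right,
    ← app_res, hv]
  simp only [pull_sum, pull_smul, pull_basePull, app_sum, app_smul, bcMap_basePull]

end framePull

/-! ### Sub-bundles and adapted frames -/

section adapted

variable {X : Scheme.{u}} {E : X.Modules} {U W : X.Opens} {ι κ : Type} {r : ℕ}

/-- A sub-bundle is adapted to a family over `U` if it is spanned by the first part of it. -/
def Subbundle.Adapted (V : Subbundle E r) (e : ι ⊕ κ → Γ(E, U)) : Prop :=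
  ∀ (W : X.Opens) (h : W ≤ U),
    V.carrier W = Submodule.span Γ(X, W) (Set.range fun i => res E h (e (Sum.inl i)))

theorem Subbundle.Adapted.mono {V : Subbundle E r} {e : ι ⊕ κ → Γ(E, U)} (hV : V.Adapted e)
    (h : W ≤ U) : V.Adapted (fun i => res E h (e i)) := by
  intro W' h'
  simpa using hV W' (h'.trans h)

theorem Subbundle.Adapted.mem {V : Subbundle E r} {e : ι ⊕ κ → Γ(E, U)} (hV : V.Adapted e)
    (h : W ≤ U) (i : ι) : res E h (e (Sum.inl i)) ∈ V.carrier W := by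
  rw [hV W h]
  exact Submodule.subset_span ⟨i, rfl⟩

variable [Fintype ι] [Fintype κ]

theorem IsFrame.mem_span_iff {e : ι ⊕ κ → Γ(E, U)} (he : IsFrame E U e) (h : W ≤ U)
    (v : Γ(E, W)) : v ∈ Submodule.span Γ(X, W) (Set.range fun i => res E h (e (Sum.inl i))) ↔
      ∀ j, he.coord h v (Sum.inr j) = 0 := by
  classical
  constructor
  · intro hv j
    have : Submodule.span Γ(X, W) (Set.range fun i => res E h (e (Sum.inl i))) ≤
        LinearMap.ker ((LinearMap.proj (Sum.inr j)).comp (he.coord h).toLinearMap) := by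
      rw [Submodule.span_le]
      rintro _ ⟨i, rfl⟩
      simp [he.coord_self]
    exact this hv
  · intro hv
    rw [← he.sum_coord h v, Fintype.sum_sum_type]
    simp only [hv, zero_smul, Finset.sum_const_zero, add_zero]
    exact Submodule.sum_mem _ fun i _ => Submodule.smul_mem _ _ (Submodule.subset_span ⟨i, rfl⟩)

theorem Subbundle.Adapted.mem_iff {V : Subbundle E r} {e : ι ⊕ κ → Γ(E, U)} (hV : V.Adapted e)
    (he : IsFrame E U e) (h : W ≤ U) (v : Γ(E, W)) :
    v ∈ V.carrier W ↔ ∀ j, he.coord h v (Sum.inr j) = 0 := by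
  rw [hV W h, he.mem_span_iff]

theorem Subbundle.adapted_of_mem_iff {V : Subbundle E r} {e : ι ⊕ κ → Γ(E, U)}
    (he : IsFrame E U e)
    (H : ∀ (W : X.Opens) (h : W ≤ U) v, v ∈ V.carrier W ↔ ∀ j, he.coord h v (Sum.inr j) = 0) :
    V.Adapted e := by
  intro W h
  ext v
  rw [H W h, he.mem_span_iff]

theorem Subbundle.exists_adapted (V : Subbundle E r) (x : X) :
    ∃ U : X.Opens, x ∈ U ∧ ∃ (n : ℕ) (e : Fin r ⊕ Fin n → Γ(E, U)), IsFrame E U e ∧ V.Adapted e :=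
  V.exists_frame x

end adapted

/-! ### Base change of sub-bundles -/

section baseChange

variable {S T T' T'' : Scheme.{u}} {p : T ⟶ S} {E F : S.Modules} {h : T' ⟶ T} {q : T' ⟶ S}
  {ι κ : Type} [Fintype ι] [Fintype κ] {r : ℕ} (w : h ≫ p = q)

/-- The section and the frame live on different open sets; on `U₁ ⊓ U` the coordinate of the
pulled-back section is the pull-back of a coordinate which is zero. -/
theorem Subbundle.Adapted.coord_pull_eq_zero {V : Subbundle (bc p E) r} {U U₁ : T.Opens}
    {e : ι ⊕ κ → Γ(bc p E, U)} (hV : V.Adapted e) (he : IsFrame (bc p E) U e)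
    {v : Γ(bc p E, U₁)} (hv : v ∈ V.carrier U₁) {A : T'.Opens} (hA : A ≤ h ⁻¹ᵁ U)
    (hA₁ : A ≤ h ⁻¹ᵁ U₁) (j : κ) : (he.pull w).coord hA (pull h w E hA₁ v) (Sum.inr j) = 0 := by
  have hA₂ : A ≤ h ⁻¹ᵁ (U₁ ⊓ U) := le_inf hA₁ hA
  have h1 := he.coord_pull w (inf_le_right : U₁ ⊓ U ≤ U) hA₂ (res _ inf_le_left v) (Sum.inr j)
  rw [pull_res] at h1
  rw [h1, (hV.mem_iff he inf_le_right _).mp (V.res_mem _ _ hv) j, map_zero]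

theorem Subbundle.Adapted.coord_eq_zero_of_mem_span {V : Subbundle (bc p E) r} {U U₁ : T.Opens}
    {e : ι ⊕ κ → Γ(bc p E, U)} (hV : V.Adapted e) (he : IsFrame (bc p E) U e)
    {A A₁ : T'.Opens} (hA : A ≤ h ⁻¹ᵁ U) (hA₁ : A₁ ≤ h ⁻¹ᵁ U₁) (hAA : A ≤ A₁)
    {v : Γ(bc q E, A₁)} (hv : v ∈ Submodule.span Γ(T', A₁)
        ((fun v₀ => res (bc q E) hA₁ (pullSection h p q w E U₁ v₀)) '' (V.carrier U₁ : Set _)))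
    (j : κ) : (he.pull w).coord hA (res _ hAA v) (Sum.inr j) = 0 := by
  induction hv using Submodule.span_induction with
  | mem v hv =>
    obtain ⟨v₀, hv₀, rfl⟩ := hv
    dsimp only
    rw [res_pullSection, res_pull]
    exact hV.coord_pull_eq_zero w he hv₀ _ _ j
  | zero => rw [res_zero, map_zero]; rfl
  | add v v' _ _ h1 h2 => rw [res_add, map_add, Pi.add_apply, h1, h2, add_zero]
  | smul a v _ h1 => rw [res_smul, map_smul, Pi.smul_apply, h1, smul_zero]

variable {w}

theorem IsBaseChange.pull_mem {V : Subbundle (bc p E) r} {V' : Subbundle (bc q E) r}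
    (H : IsBaseChange h w V V') {U : T.Opens} {A : T'.Opens} (hA : A ≤ h ⁻¹ᵁ U) {v : Γ(bc p E, U)}
    (hv : v ∈ V.carrier U) : pull h w E hA v ∈ V'.carrier A := by
  rw [H]
  intro x hx
  refine ⟨U, A, le_rfl, hA, hx, ?_⟩
  rw [res_self]
  exact Submodule.subset_span ⟨v, hv, res_pullSection w hA v⟩

theorem IsBaseChange.adapted {V : Subbundle (bc p E) r} {V' : Subbundle (bc q E) r}
    (H : IsBaseChange h w V V') {U : T.Opens} {e : ι ⊕ κ → Γ(bc p E, U)}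
    (he : IsFrame (bc p E) U e) (hV : V.Adapted e) :
    V'.Adapted (U := h ⁻¹ᵁ U) (fun i => pull h w E le_rfl (e i)) := by
  refine Subbundle.adapted_of_mem_iff (he.pull w) fun B hB v => ⟨fun hv j => ?_, fun hv => ?_⟩
  · rw [H] at hv
    apply function_ext
    intro x hx
    obtain ⟨U₁, A, hA, hAU, hxA, hv'⟩ := hv x hx
    refine ⟨A, hA, hxA, ?_⟩
    rw [← (he.pull w).coord_res hB hA, map_zero]
    have := hV.coord_eq_zero_of_mem_span w he (hA.trans hB) hAU le_rfl hv' j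
    rwa [res_self] at this
  · rw [← (he.pull w).mem_span_iff] at hv
    refine Submodule.span_le.mpr ?_ hv
    rintro _ ⟨i, rfl⟩
    dsimp only
    rw [res_pull]
    refine H.pull_mem _ ?_
    have := hV.mem le_rfl i
    rwa [res_self] at this

/-- Base changes are recognised by one adapted frame near the image of each point: over the domain
of such a frame both membership conditions say that the second-part coordinates vanish. -/
theorem isBaseChange_of_adapted {V : Subbundle (bc p E) r} {V' : Subbundle (bc q E) r}
    (H : ∀ x : T', ∃ (U : T.Opens) (n : ℕ) (e : Fin r ⊕ Fin n → Γ(bc p E, U))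
      (A : T'.Opens) (hA : A ≤ h ⁻¹ᵁ U), x ∈ A ∧ IsFrame (bc p E) U e ∧ V.Adapted e ∧
        V'.Adapted (fun i => pull h w E hA (e i))) : IsBaseChange h w V V' := by
  intro B v
  constructor
  · intro hv x hx
    obtain ⟨U, n, e, A, hA, hxA, he, hV, hV'⟩ := H x
    refine ⟨U, B ⊓ A, inf_le_left, inf_le_right.trans hA, ⟨hx, hxA⟩, ?_⟩
    have := V'.res_mem (inf_le_left : B ⊓ A ≤ B) _ hv
    rw [hV' _ inf_le_right] at this
    refine Submodule.span_mono ?_ this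
    rintro _ ⟨i, rfl⟩
    refine ⟨e (Sum.inl i), ?_, ?_⟩
    · have := hV.mem le_rfl i
      rwa [res_self] at this
    · dsimp only
      rw [res_pullSection, res_pull]
  · intro hv
    refine V'.mem_of_local B v fun x hx => ?_
    obtain ⟨U, n, e, A, hA, hxA, he, hV, hV'⟩ := H x
    obtain ⟨U₁, A₁, hA₁, hAU₁, hxA₁, hv₁⟩ := hv x hx
    refine ⟨A₁ ⊓ A, inf_le_left.trans hA₁, ⟨hxA₁, hxA⟩, ?_⟩
    rw [hV' _ inf_le_right]
    have h1 := ((he.pull w).mem_span_iff (inf_le_right.trans hA : A₁ ⊓ A ≤ _)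
      (res _ (inf_le_left.trans hA₁) v)).mpr fun j => by
        have := hV.coord_eq_zero_of_mem_span w he (inf_le_right.trans hA)
          hAU₁ (inf_le_left : A₁ ⊓ A ≤ A₁) hv₁ j
        rwa [res_res] at this
    simpa only [res_pull] using h1

/-- The candidate consists of the sections whose second-part coordinates vanish in the pull-back of
every adapted frame. Quantifying over all frames makes this a sheaf without choices. A single
adapted frame suffices for the test, since the pull-back of its first part satisfies the condition
for every other adapted frame. -/
theorem exists_isBaseChange (w : h ≫ p = q) (V : Subbundle (bc p E) r) :
    ∃ V' : Subbundle (bc q E) r, IsBaseChange h w V V' := by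
  let V' : Subbundle (bc q E) r :=
    { carrier := fun B =>
        { carrier := {v | ∀ (U : T.Opens) (n : ℕ) (e : Fin r ⊕ Fin n → Γ(bc p E, U))
            (he : IsFrame (bc p E) U e), V.Adapted e → ∀ (A : T'.Opens) (hAB : A ≤ B)
            (hA : A ≤ h ⁻¹ᵁ U) (j : Fin n),
            (he.pull w).coord hA (res _ hAB v) (Sum.inr j) = 0}
          add_mem' := by
            intro v v' h1 h2 U n e he hV A hAB hA j
            rw [res_add, map_add, Pi.add_apply, h1 U n e he hV, h2 U n e he hV, add_zero]
          zero_mem' := by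
            intro U n e he hV A hAB hA j
            rw [res_zero, map_zero]
            rfl
          smul_mem' := by
            intro a v h1 U n e he hV A hAB hA j
            rw [res_smul, map_smul, Pi.smul_apply, h1 U n e he hV, smul_zero] }
      res_mem := by
        intro B' B hB v hv U n e he hV A hAB hA j
        rw [res_res]
        exact hv U n e he hV A (hAB.trans hB) hA j
      mem_of_local := by
        intro B v hv U n e he hV A hAB hA j
        apply function_ext
        intro x hx
        obtain ⟨W, hW, hxW, hvW⟩ := hv x (hAB hx)
        refine ⟨A ⊓ W, inf_le_left, ⟨hx, hxW⟩, ?_⟩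
        have := hvW U n e he hV (A ⊓ W) inf_le_right (inf_le_left.trans hA) j
        rw [← (he.pull w).coord_res hA inf_le_left, map_zero, res_res, ← this, res_res]
      exists_frame := by
        intro x
        obtain ⟨U, hxU, n, e, he, hV⟩ := V.exists_adapted (h x)
        refine ⟨h ⁻¹ᵁ U, hxU, n, _, he.pull w, fun B hB => ?_⟩
        ext v
        rw [(he.pull w).mem_span_iff]
        constructor
        · intro hv j
          have := hv U n e he hV B le_rfl hB j
          rwa [res_self] at this
        · intro hv U₁ n₁ e₁ he₁ hV₁ A hAB hA j
          rw [← (he.pull w).mem_span_iff] at hv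
          induction hv using Submodule.span_induction with
          | mem v hv =>
            obtain ⟨i, rfl⟩ := hv
            dsimp only
            rw [res_res, res_pull]
            refine hV₁.coord_pull_eq_zero w he₁ ?_ _ _ j
            have := hV.mem le_rfl i
            rwa [res_self] at this
          | zero => rw [res_zero, map_zero]; rfl
          | add v v' _ _ h1 h2 => rw [res_add, map_add, Pi.add_apply, h1, h2, add_zero]
          | smul a v _ h1 => rw [res_smul, map_smul, Pi.smul_apply, h1, smul_zero] }
  refine ⟨V', isBaseChange_of_adapted fun x => ?_⟩
  obtain ⟨U, hxU, n, e, he, hV⟩ := V.exists_adapted (h x)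
  refine ⟨U, n, e, h ⁻¹ᵁ U, le_rfl, hxU, he, hV, ?_⟩
  refine Subbundle.adapted_of_mem_iff (he.pull w) fun B hB v => ⟨fun hv j => ?_, fun hv => ?_⟩
  · have := hv U n e he hV B le_rfl hB j
    rwa [res_self] at this
  · intro U₁ n₁ e₁ he₁ hV₁ A hAB hA j
    rw [← (he.pull w).mem_span_iff] at hv
    induction hv using Submodule.span_induction with
    | mem v hv =>
      obtain ⟨i, rfl⟩ := hv
      dsimp only
      rw [res_res, res_pull]
      refine hV₁.coord_pull_eq_zero w he₁ ?_ _ _ j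
      have := hV.mem le_rfl i
      rwa [res_self] at this
    | zero => rw [res_zero, map_zero]; rfl
    | add v v' _ _ h1 h2 => rw [res_add, map_add, Pi.add_apply, h1, h2, add_zero]
    | smul a v _ h1 => rw [res_smul, map_smul, Pi.smul_apply, h1, smul_zero]

theorem IsBaseChange.unique {V : Subbundle (bc p E) r} {V' V'' : Subbundle (bc q E) r}
    (H : IsBaseChange h w V V') (H' : IsBaseChange h w V V'') : V' = V'' := by
  ext U v
  rw [H, H']

variable {d : ℕ}

theorem IsBaseChange.comp (hE : IsVectorBundle E d) {h' : T'' ⟶ T'} {q' : T'' ⟶ S}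
    {h'' : T'' ⟶ T} {w' : h' ≫ q = q'} (w'' : h'' ≫ p = q') (hh : h' ≫ h = h'')
    {V : Subbundle (bc p E) r} {V' : Subbundle (bc q E) r} {V'' : Subbundle (bc q' E) r}
    (H : IsBaseChange h w V V') (H' : IsBaseChange h' w' V' V'') : IsBaseChange h'' w'' V V'' := by
  apply isBaseChange_of_adapted
  intro x
  obtain ⟨U, hxU, n, e, he, hV⟩ := V.exists_adapted (h'' x)
  have hle : h'' ⁻¹ᵁ U ≤ h' ⁻¹ᵁ h ⁻¹ᵁ U := by subst hh; exact le_rfl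
  refine ⟨U, n, e, h'' ⁻¹ᵁ U, le_rfl, hxU, he, hV, ?_⟩
  have h1 := (H'.adapted (he.pull w) (H.adapted he hV)).mono hle
  have h2 : ∀ i, res (bc q' E) hle (pull h' w' E le_rfl (pull h w E le_rfl (e i))) =
      pull h'' w'' E le_rfl (e i) := by
    intro i
    rw [res_pull, hE.pull_pull w w' w'' hh]
  simpa only [h2] using h1

theorem isBaseChange_id (hE : IsVectorBundle E d) (w : 𝟙 T ≫ p = p) (V : Subbundle (bc p E) r) :
    IsBaseChange (𝟙 T) w V V := by
  apply isBaseChange_of_adapted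
  intro x
  obtain ⟨U, hxU, n, e, he, hV⟩ := V.exists_adapted x
  have hle : U ≤ 𝟙 T ⁻¹ᵁ U := fun y hy => hy
  refine ⟨U, n, e, U, hle, hxU, he, hV, ?_⟩
  have h1 : ∀ i, pull (𝟙 T) w E hle (e i) = e i := by
    intro i
    rw [hE.pull_id w hle le_rfl, res_self]
  simpa only [h1] using hV

/-! ### Base change of linked pairs -/

theorem IsBaseChange.map_mem {E₁ E₂ : S.Modules} (hE : IsVectorBundle E₁ d) {f : E₁ ⟶ E₂}
    {V₁ : Subbundle (bc p E₁) r} {V₂ : Subbundle (bc p E₂) r} {V₁' : Subbundle (bc q E₁) r}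
    {V₂' : Subbundle (bc q E₂) r} (H₁ : IsBaseChange h w V₁ V₁') (H₂ : IsBaseChange h w V₂ V₂')
    (hf : ∀ (U : T.Opens), ∀ v ∈ V₁.carrier U, (bcMap p f).app U v ∈ V₂.carrier U)
    (U : T'.Opens) (v : Γ(bc q E₁, U)) (hv : v ∈ V₁'.carrier U) :
    (bcMap q f).app U v ∈ V₂'.carrier U := by
  refine V₂'.mem_of_local _ _ fun x hx => ?_
  rw [H₁] at hv
  obtain ⟨W, A, hA, hAW, hxA, hvA⟩ := hv x hx
  refine ⟨A, hA, hxA, ?_⟩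
  rw [← app_res]
  have : Submodule.span Γ(T', A)
      ((fun v₀ => res (bc q E₁) hAW (pullSection h p q w E₁ W v₀)) '' (V₁.carrier W : Set _)) ≤
      (V₂'.carrier A).comap (sectionMap (bcMap q f) A) := by
    rw [Submodule.span_le]
    rintro _ ⟨v₀, hv₀, rfl⟩
    show (bcMap q f).app A (res (bc q E₁) hAW (pullSection h p q w E₁ W v₀)) ∈ V₂'.carrier A
    rw [res_pullSection, hE.bcMap_pull]
    exact H₂.pull_mem _ (hf _ _ hv₀)
  exact this hvA

end baseChange

/-! ### Gluing sub-bundles along open immersions -/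

section glue

variable {S T T' : Scheme.{u}} {p : T ⟶ S} {E : S.Modules} {q : T' ⟶ S} {r d : ℕ}

theorem appLE_bijective (u : T' ⟶ T) [IsOpenImmersion u] {N : T.Opens} (hN : N ≤ u.opensRange)
    {A : T'.Opens} (hA : A = u ⁻¹ᵁ N) :
    Function.Bijective (u.appLE N A hA.le) := by
  subst hA
  rw [← Scheme.Hom.app_eq_appLE]
  have : IsIso (u.app N) := u.isIso_app N hN
  exact ConcreteCategory.bijective_of_isIso (u.app N)

/-- Frames descend locally along open immersions. -/
theorem exists_descend_frame (hE : IsVectorBundle E d) (u : T' ⟶ T) [IsOpenImmersion u]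
    (w : u ≫ p = q) {ι : Type} [Fintype ι] [DecidableEq ι] {U : T'.Opens} {e : ι → Γ(bc q E, U)}
    (he : IsFrame (bc q E) U e) (y : T') (hy : y ∈ U) :
    ∃ (N : T.Opens) (_ : N ≤ u.opensRange) (hU : u ⁻¹ᵁ N ≤ U) (e' : ι → Γ(bc p E, N)),
      u y ∈ N ∧ IsFrame (bc p E) N e' ∧
        ∀ i, pull u w E le_rfl (e' i) = res (bc q E) hU (e i) := by
  obtain ⟨B, hB, b, hb⟩ := hE (q y)
  let N : T.Opens := u ''ᵁ (U ⊓ q ⁻¹ᵁ B)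
  have hNr : N ≤ u.opensRange := (u.image_le_opensRange _)
  have huN : u ⁻¹ᵁ N = U ⊓ q ⁻¹ᵁ B := u.preimage_image_eq _
  have hUN : u ⁻¹ᵁ N ≤ U := huN.le.trans inf_le_left
  have hyN : u y ∈ N := ⟨y, ⟨hy, hB⟩, rfl⟩
  have hNB : N ≤ p ⁻¹ᵁ B := by
    rintro _ ⟨z, hz, rfl⟩
    subst w
    exact hz.2
  have hb' := (hb.basePull p).mono hNB
  have hbq := hb'.pull w
  have hbij := appLE_bijective u hNr (rfl : u ⁻¹ᵁ N = u ⁻¹ᵁ N)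
  let σ := RingEquiv.ofBijective (u.appLE N (u ⁻¹ᵁ N) le_rfl).hom hbij
  have hσ : ∀ a, u.appLE N (u ⁻¹ᵁ N) le_rfl (σ.symm a) = a := fun a => σ.apply_symm_apply a
  have heN := he.mono hUN
  -- `G` and `H` compare the given frame with the pull-back of a frame of `E`. Their entries are
  -- functions on `u⁻¹ N`, which are the same as functions on `N` because `u` is an open immersion,
  -- so the transition matrices descend.
  let G : Matrix (Fin d) ι Γ(T', u ⁻¹ᵁ N) := fun i k => hbq.coord le_rfl (res _ hUN (e k)) i
  let H : Matrix ι (Fin d) Γ(T', u ⁻¹ᵁ N) := fun k i => heN.coord le_rfl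
    (pull u w E le_rfl (res _ hNB (basePull p E le_rfl (b i)))) k
  have hG : ∀ k, res _ hUN (e k) =
      ∑ i, G i k • pull u w E le_rfl (res _ hNB (basePull p E le_rfl (b i))) := by
    intro k
    conv_lhs => rw [← hbq.sum_coord le_rfl (res _ hUN (e k))]
    simp only [res_self]
    rfl
  have hH : ∀ i, pull u w E le_rfl (res _ hNB (basePull p E le_rfl (b i))) =
      ∑ k, H k i • res _ hUN (e k) := by
    intro i
    conv_lhs => rw [← heN.sum_coord le_rfl (pull u w E le_rfl (res _ hNB (basePull p E le_rfl (b i))))]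
    simp only [res_self]
    rfl
  have hGH : G * H = 1 := by
    ext i j
    have h1 := hH j
    simp only [hG, Finset.smul_sum, smul_smul] at h1
    rw [Finset.sum_comm] at h1
    simp only [← Finset.sum_smul] at h1
    have h2 := hbq.coord_eq le_rfl (a := fun i => ∑ k, H k j * G i k) (by simpa only [res_self] using h1)
    have h3 := hbq.coord_self le_rfl j
    rw [res_self] at h3
    rw [h3] at h2
    have h4 := congrFun h2 i
    rw [Matrix.mul_apply, Matrix.one_apply]
    simp only [mul_comm (G i _)]
    rw [← h4, Pi.single_apply]
  have hHG : H * G = 1 := by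
    ext i j
    have h1 := hG j
    simp only [hH, Finset.smul_sum, smul_smul] at h1
    rw [Finset.sum_comm] at h1
    simp only [← Finset.sum_smul] at h1
    have h2 := heN.coord_eq le_rfl (a := fun i => ∑ k, G k j * H i k) (by simpa only [res_self] using h1)
    have h3 := heN.coord_self le_rfl j
    rw [res_self] at h3
    rw [h3] at h2
    have h4 := congrFun h2 i
    rw [Matrix.mul_apply, Matrix.one_apply]
    simp only [mul_comm (H i _)]
    rw [← h4, Pi.single_apply]
  have hfr := hb'.combine (G.map σ.symm) (H.map σ.symm)
    (by rw [← Matrix.map_mul, hGH, Matrix.map_one _ (map_zero _) (map_one _)])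
    (by rw [← Matrix.map_mul, hHG, Matrix.map_one _ (map_zero _) (map_one _)])
  refine ⟨N, hNr, hUN, _, hyN, hfr, fun k => ?_⟩
  rw [hG, combine, pull_sum]
  refine Finset.sum_congr rfl fun i _ => ?_
  rw [pull_smul, Matrix.map_apply, hσ]

/-- Membership in a sub-bundle can be tested on an open cover. -/
theorem IsBaseChange.mem_of_pull_mem (u : T' ⟶ T) [IsOpenImmersion u] {w : u ≫ p = q}
    {V : Subbundle (bc p E) r} {V' : Subbundle (bc q E) r} (H : IsBaseChange u w V V')
    {U : T.Opens} {v : Γ(bc p E, U)} {A : T'.Opens} (hA : A ≤ u ⁻¹ᵁ U)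
    (hv : pull u w E hA v ∈ V'.carrier A) (y : T')
    (hy : y ∈ A) : ∃ (W : T.Opens) (hW : W ≤ U), u y ∈ W ∧ res _ hW v ∈ V.carrier W := by
  obtain ⟨U₀, hyU₀, n, e, he, hV⟩ := V.exists_adapted (u y)
  let W : T.Opens := u ''ᵁ (A ⊓ u ⁻¹ᵁ U₀)
  have hWU : W ≤ U := by
    rintro _ ⟨z, hz, rfl⟩
    exact hA hz.1
  have hWU₀ : W ≤ U₀ := by
    rintro _ ⟨z, hz, rfl⟩
    exact hz.2
  have huW : u ⁻¹ᵁ W = A ⊓ u ⁻¹ᵁ U₀ := u.preimage_image_eq _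
  refine ⟨W, hWU, ⟨y, ⟨hy, hyU₀⟩, rfl⟩, ?_⟩
  rw [hV.mem_iff he hWU₀]
  intro j
  have hbij := appLE_bijective u (N := W) (u.image_le_opensRange _) huW.symm
  apply hbij.1
  rw [map_zero, ← he.coord_pull w hWU₀ huW.symm.le, pull_res]
  have h1 := V'.res_mem (inf_le_left : A ⊓ u ⁻¹ᵁ U₀ ≤ A) _ hv
  rw [res_pull] at h1
  exact ((H.adapted he hV).mem_iff (he.pull w) inf_le_right _).mp h1 j

variable {I : Type*} {X : I → Scheme.{u}} {u : ∀ i, X i ⟶ T} [∀ i, IsOpenImmersion (u i)]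
  (hu : ∀ x : T, ∃ i y, u i y = x) {q : ∀ i, X i ⟶ S} {w : ∀ i, u i ≫ p = q i}

include hu in
theorem Subbundle.eq_of_cover {V V' : Subbundle (bc p E) r} {V₀ : ∀ i, Subbundle (bc (q i) E) r}
    (H : ∀ i, IsBaseChange (u i) (w i) V (V₀ i)) (H' : ∀ i, IsBaseChange (u i) (w i) V' (V₀ i)) :
    V = V' := by
  have key : ∀ {V V' : Subbundle (bc p E) r} (_ : ∀ i, IsBaseChange (u i) (w i) V (V₀ i))
      (_ : ∀ i, IsBaseChange (u i) (w i) V' (V₀ i)) U v, v ∈ V.carrier U → v ∈ V'.carrier U := by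
    intro V V' H H' U v hv
    refine V'.mem_of_local U v fun x hx => ?_
    obtain ⟨i, y, rfl⟩ := hu x
    exact (H' i).mem_of_pull_mem (u i) le_rfl ((H i).pull_mem le_rfl hv) y hx
  ext U v
  exact ⟨key H H' U v, key H' H U v⟩

-- The glued object consists of the sections whose inverse image on every member lies in the given
-- sub-bundle. Over an open set inside the image of one member that member alone decides, so there
-- the sections are spanned by part of a descended adapted frame.
include hu in
theorem exists_glue_subbundle (hE : IsVectorBundle E d) (V₀ : ∀ i, Subbundle (bc (q i) E) r)
    (H : ∀ i j (Z : Scheme.{u}) (g₁ : Z ⟶ X i) (g₂ : Z ⟶ X j), g₁ ≫ u i = g₂ ≫ u j →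
      ∀ (q' : Z ⟶ S) (w₁ : g₁ ≫ q i = q') (w₂ : g₂ ≫ q j = q'), ∃ V' : Subbundle (bc q' E) r,
        IsBaseChange g₁ w₁ (V₀ i) V' ∧ IsBaseChange g₂ w₂ (V₀ j) V') :
    ∃ V : Subbundle (bc p E) r, ∀ i, IsBaseChange (u i) (w i) V (V₀ i) := by
  -- A point of `X j` with the same image as a point of `X i` comes from the fiber product, where
  -- both sub-bundles have a common base change.
  have overlap : ∀ i (U : T.Opens) (v : Γ(bc p E, U)), U ≤ (u i).opensRange →
      pull (u i) (w i) E le_rfl v ∈ (V₀ i).carrier (u i ⁻¹ᵁ U) →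
      ∀ j, pull (u j) (w j) E le_rfl v ∈ (V₀ j).carrier (u j ⁻¹ᵁ U) := by
    intro i U v hU hv j
    refine (V₀ j).mem_of_local _ _ fun z hz => ?_
    obtain ⟨y, hy⟩ := hU hz
    obtain ⟨ζ, rfl, rfl⟩ := Scheme.Pullback.exists_preimage_pullback (f := u i) (g := u j) y z hy
    set g₁ := Limits.pullback.fst (u i) (u j)
    set g₂ := Limits.pullback.snd (u i) (u j)
    have hg : g₁ ≫ u i = g₂ ≫ u j := Limits.pullback.condition
    have w₂ : g₂ ≫ q j = g₁ ≫ q i := by rw [← w i, ← w j, reassoc_of% hg]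
    obtain ⟨V', h1, h2⟩ := H i j _ g₁ g₂ hg _ rfl w₂
    have hA : g₁ ⁻¹ᵁ u i ⁻¹ᵁ U = g₂ ⁻¹ᵁ u j ⁻¹ᵁ U := by
      rw [← Scheme.Hom.comp_preimage, hg, Scheme.Hom.comp_preimage]
    refine h2.mem_of_pull_mem g₂ (A := g₂ ⁻¹ᵁ u j ⁻¹ᵁ U) le_rfl ?_ ζ hz
    have h3 := h1.pull_mem hA.ge hv
    rw [hE.pull_pull (w i) rfl (by rw [← w₂, ← w j, Category.assoc]) hg] at h3
    rwa [hE.pull_pull (w j) w₂ (by rw [← w₂, ← w j, Category.assoc]) rfl]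
  let C : ∀ U : T.Opens, Submodule Γ(T, U) Γ(bc p E, U) := fun U =>
    { carrier := {v | ∀ i, pull (u i) (w i) E le_rfl v ∈ (V₀ i).carrier (u i ⁻¹ᵁ U)}
      add_mem' := by
        intro v v' hv hv' i
        rw [pull_add]
        exact add_mem (hv i) (hv' i)
      zero_mem' := by
        intro i
        rw [pull_zero]
        exact zero_mem _
      smul_mem' := by
        intro a v hv i
        rw [pull_smul]
        exact Submodule.smul_mem _ _ (hv i) }
  have hC : ∀ (U : T.Opens) (v : Γ(bc p E, U)), v ∈ C U ↔
    ∀ i, pull (u i) (w i) E le_rfl v ∈ (V₀ i).carrier (u i ⁻¹ᵁ U) := fun _ _ => Iff.rfl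
  have hframe : ∀ i (y : X i), ∃ (N : T.Opens) (n : ℕ) (e : Fin r ⊕ Fin n → Γ(bc p E, N)),
      u i y ∈ N ∧ IsFrame (bc p E) N e ∧
      (V₀ i).Adapted (U := u i ⁻¹ᵁ N) (fun k => pull (u i) (w i) E le_rfl (e k)) ∧
      ∀ (W : T.Opens) (h : W ≤ N),
        C W = Submodule.span Γ(T, W) (Set.range fun k => res _ h (e (Sum.inl k))) := by
    intro i y
    obtain ⟨U, hyU, n, e, he, hV⟩ := (V₀ i).exists_adapted y
    obtain ⟨N, hNr, hU, e', hyN, he', hee'⟩ := exists_descend_frame hE (u i) (w i) he y hyU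
    have hV' : (V₀ i).Adapted (U := u i ⁻¹ᵁ N) (fun k => pull (u i) (w i) E le_rfl (e' k)) := by
      simpa only [hee'] using hV.mono hU
    refine ⟨N, n, e', hyN, he', hV', fun W hW => ?_⟩
    ext v
    rw [he'.mem_span_iff hW, hC]
    have h1 : (∀ j, pull (u j) (w j) E le_rfl v ∈ (V₀ j).carrier (u j ⁻¹ᵁ W)) ↔
        pull (u i) (w i) E le_rfl v ∈ (V₀ i).carrier (u i ⁻¹ᵁ W) :=
      ⟨fun h => h i, fun h => overlap i W v (hW.trans hNr) h⟩
    rw [h1, hV'.mem_iff (he'.pull (w i)) ((u i).preimage_mono hW)]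
    refine forall_congr' fun k => ?_
    rw [he'.coord_pull (w i) hW le_rfl v]
    exact map_eq_zero_iff (u i |>.appLE W (u i ⁻¹ᵁ W) le_rfl).hom
      (appLE_bijective (u i) (hW.trans hNr) rfl).1
  let V : Subbundle (bc p E) r :=
    { carrier := C
      res_mem := by
        intro W U h v hv i
        rw [pull_res]
        have := (V₀ i).res_mem ((u i).preimage_mono h) _ (hv i)
        rwa [res_pull] at this
      mem_of_local := by
        intro U v hv i
        refine (V₀ i).mem_of_local _ _ fun y hy => ?_
        obtain ⟨W, hW, hyW, hvW⟩ := hv (u i y) hy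
        refine ⟨u i ⁻¹ᵁ W, (u i).preimage_mono hW, hyW, ?_⟩
        have := hvW i
        rw [pull_res] at this
        rwa [res_pull]
      exists_frame := by
        intro x
        obtain ⟨i, y, rfl⟩ := hu x
        obtain ⟨N, n, e, hyN, he, -, h⟩ := hframe i y
        exact ⟨N, hyN, n, e, he, h⟩ }
  refine ⟨V, fun i => isBaseChange_of_adapted fun y => ?_⟩
  obtain ⟨N, n, e, hyN, he, h1, h2⟩ := hframe i y
  exact ⟨N, n, e, u i ⁻¹ᵁ N, le_rfl, hyN, he, h2, h1⟩

end glue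

/-! ### The linked Grassmannian functor -/

section functor

variable {S T T' T'' : Scheme.{u}} {p : T ⟶ S} {q : T' ⟶ S} {q' : T'' ⟶ S} {E₁ E₂ : S.Modules}
  {f : E₁ ⟶ E₂} {g : E₂ ⟶ E₁} {r d : ℕ}

theorem LinkedPair.ext' {V W : LinkedPair p f g r} (h₁ : V.V₁ = W.V₁) (h₂ : V.V₂ = W.V₂) :
    V = W := by
  cases V
  cases W
  simp only at h₁ h₂
  subst h₁ h₂
  rfl

theorem exists_classifies (hE₁ : IsVectorBundle E₁ d) (hE₂ : IsVectorBundle E₂ d) (h : T' ⟶ T)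
    (w : h ≫ p = q) (V : LinkedPair p f g r) : ∃ W : LinkedPair q f g r, Classifies h V W := by
  obtain ⟨W₁, h₁⟩ := exists_isBaseChange w V.V₁
  obtain ⟨W₂, h₂⟩ := exists_isBaseChange w V.V₂
  exact ⟨⟨W₁, W₂, h₁.map_mem hE₁ h₂ V.map_f, h₂.map_mem hE₂ h₁ V.map_g⟩, w, h₁, h₂⟩

theorem Classifies.unique {h : T' ⟶ T} {V : LinkedPair p f g r} {W W' : LinkedPair q f g r}
    (H : Classifies h V W) (H' : Classifies h V W') : W = W' := by
  obtain ⟨w, h₁, h₂⟩ := H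
  obtain ⟨w', h₁', h₂'⟩ := H'
  exact LinkedPair.ext' (h₁.unique h₁') (h₂.unique h₂')

theorem Classifies.comp (hE₁ : IsVectorBundle E₁ d) (hE₂ : IsVectorBundle E₂ d) {h : T' ⟶ T}
    {h' : T'' ⟶ T'} {V : LinkedPair p f g r} {W : LinkedPair q f g r} {W' : LinkedPair q' f g r}
    (H : Classifies h V W) (H' : Classifies h' W W') : Classifies (h' ≫ h) V W' := by
  obtain ⟨w, h₁, h₂⟩ := H
  obtain ⟨w', h₁', h₂'⟩ := H'
  have w'' : (h' ≫ h) ≫ p = q' := by rw [← w', ← w, Category.assoc]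
  exact ⟨w'', h₁.comp hE₁ w'' rfl h₁', h₂.comp hE₂ w'' rfl h₂'⟩

theorem classifies_id (hE₁ : IsVectorBundle E₁ d) (hE₂ : IsVectorBundle E₂ d)
    (V : LinkedPair p f g r) : Classifies (𝟙 T) V V :=
  ⟨Category.id_comp p, isBaseChange_id hE₁ _ _, isBaseChange_id hE₂ _ _⟩

/-- The base change of a linked pair. -/
def LinkedPair.pull (hE₁ : IsVectorBundle E₁ d) (hE₂ : IsVectorBundle E₂ d) (h : T' ⟶ T)
    (w : h ≫ p = q) (V : LinkedPair p f g r) : LinkedPair q f g r :=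
  (exists_classifies hE₁ hE₂ h w V).choose

theorem LinkedPair.classifies_pull (hE₁ : IsVectorBundle E₁ d) (hE₂ : IsVectorBundle E₂ d)
    (h : T' ⟶ T) (w : h ≫ p = q) (V : LinkedPair p f g r) :
    Classifies h V (V.pull hE₁ hE₂ h w) :=
  (exists_classifies hE₁ hE₂ h w V).choose_spec

/-- The type of linked pairs over all structure morphisms of `T`. -/
abbrev SomeLinkedPair (f : E₁ ⟶ E₂) (g : E₂ ⟶ E₁) (r : ℕ) (T : Scheme.{u}) : Type u :=
  Σ p : T ⟶ S, LinkedPair p f g r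

/-- The base change of a linked pair, with its structure morphism. -/
def SomeLinkedPair.pull (hE₁ : IsVectorBundle E₁ d) (hE₂ : IsVectorBundle E₂ d) (h : T' ⟶ T)
    (x : SomeLinkedPair f g r T) : SomeLinkedPair f g r T' :=
  ⟨h ≫ x.1, x.2.pull hE₁ hE₂ h rfl⟩

/-- Replaces equality of pairs over possibly different structure morphisms by `Classifies`, so that
no transport along equalities of structure morphisms is needed in the functor arguments. -/
theorem SomeLinkedPair.pull_eq_iff (hE₁ : IsVectorBundle E₁ d) (hE₂ : IsVectorBundle E₂ d)
    (h : T' ⟶ T) (x : SomeLinkedPair f g r T) (y : SomeLinkedPair f g r T') :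
    x.pull hE₁ hE₂ h = y ↔ Classifies h x.2 y.2 := by
  constructor
  · rintro rfl
    exact x.2.classifies_pull hE₁ hE₂ h rfl
  · obtain ⟨q, W⟩ := y
    intro H
    obtain ⟨w, -⟩ := id H
    subst w
    exact congrArg (Sigma.mk (h ≫ x.1)) ((x.2.classifies_pull hE₁ hE₂ h rfl).unique H)

theorem SomeLinkedPair.classifies_pull (hE₁ : IsVectorBundle E₁ d) (hE₂ : IsVectorBundle E₂ d)
    (h : T' ⟶ T) (x : SomeLinkedPair f g r T) : Classifies h x.2 (x.pull hE₁ hE₂ h).2 :=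
  x.2.classifies_pull hE₁ hE₂ h rfl

theorem SomeLinkedPair.pull_id (hE₁ : IsVectorBundle E₁ d) (hE₂ : IsVectorBundle E₂ d)
    (x : SomeLinkedPair f g r T) : x.pull hE₁ hE₂ (𝟙 T) = x :=
  (pull_eq_iff hE₁ hE₂ _ _ _).mpr (classifies_id hE₁ hE₂ _)

theorem SomeLinkedPair.pull_comp (hE₁ : IsVectorBundle E₁ d) (hE₂ : IsVectorBundle E₂ d)
    (h : T' ⟶ T) (h' : T'' ⟶ T') (x : SomeLinkedPair f g r T) :
    x.pull hE₁ hE₂ (h' ≫ h) = (x.pull hE₁ hE₂ h).pull hE₁ hE₂ h' :=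
  (pull_eq_iff hE₁ hE₂ _ _ _).mpr
    ((x.classifies_pull hE₁ hE₂ h).comp hE₁ hE₂ (classifies_pull hE₁ hE₂ h' _))

/-- The functor of linked pairs. -/
def linkedFunctor (hE₁ : IsVectorBundle E₁ d) (hE₂ : IsVectorBundle E₂ d) (f : E₁ ⟶ E₂)
    (g : E₂ ⟶ E₁) (r : ℕ) : Scheme.{u}ᵒᵖ ⥤ Type u where
  obj T := SomeLinkedPair f g r T.unop
  map h := ↾fun x => x.pull hE₁ hE₂ h.unop
  map_id _ := ConcreteCategory.hom_ext _ _ fun x => SomeLinkedPair.pull_id hE₁ hE₂ x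
  map_comp h h' := ConcreteCategory.hom_ext _ _ fun x =>
    SomeLinkedPair.pull_comp hE₁ hE₂ h.unop h'.unop x

variable (hE₁ : IsVectorBundle E₁ d) (hE₂ : IsVectorBundle E₂ d)

theorem linkedFunctor_map_eq_iff (h : T' ⟶ T)
    (x : (linkedFunctor hE₁ hE₂ f g r).obj (.op T)) (y : (linkedFunctor hE₁ hE₂ f g r).obj (.op T')) :
    (linkedFunctor hE₁ hE₂ f g r).map h.op x = y ↔ Classifies h x.2 y.2 :=
  SomeLinkedPair.pull_eq_iff hE₁ hE₂ h x y

/-- The structure morphisms glue as morphisms of schemes, the two sub-bundles glue by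
`exists_glue_subbundle`, and the linking conditions hold because membership in a sub-bundle is
local. -/
theorem linkedFunctor_isSheaf :
    Presheaf.IsSheaf Scheme.zariskiTopology.{u} (linkedFunctor hE₁ hE₂ f g r) := by
  rw [isSheaf_iff_isSheaf_of_type]
  rw [Precoverage.isSheaf_toGrothendieck_iff_of_isStableUnderBaseChange]
  rintro T R hR x hx
  obtain ⟨(𝓤 : Scheme.OpenCover T), rfl⟩ := Scheme.exists_cover_of_mem_pretopology hR
  let y : ∀ i, Σ q : 𝓤.X i ⟶ S, LinkedPair q f g r := fun i => x (𝓤.f i) (.mk i)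
  have hy : ∀ i j (Z : Scheme.{u}) (g₁ : Z ⟶ 𝓤.X i) (g₂ : Z ⟶ 𝓤.X j),
      g₁ ≫ 𝓤.f i = g₂ ≫ 𝓤.f j → ∃ z : Σ q : Z ⟶ S, LinkedPair q f g r,
        Classifies g₁ (y i).2 z.2 ∧ Classifies g₂ (y j).2 z.2 := by
    intro i j Z g₁ g₂ hg
    have := hx g₁ g₂ (.mk i) (.mk j) hg
    refine ⟨(linkedFunctor hE₁ hE₂ f g r).map g₂.op (y j), ?_, ?_⟩
    · exact (linkedFunctor_map_eq_iff hE₁ hE₂ _ _ _).mp this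
    · exact (linkedFunctor_map_eq_iff hE₁ hE₂ _ _ _).mp rfl
  have hw : ∀ i j, Limits.pullback.fst (𝓤.f i) (𝓤.f j) ≫ (y i).1 =
      Limits.pullback.snd (𝓤.f i) (𝓤.f j) ≫ (y j).1 := by
    intro i j
    obtain ⟨z, ⟨h1, -⟩, ⟨h2, -⟩⟩ := hy i j _ _ _ (Limits.pullback.condition (f := 𝓤.f i) (g := 𝓤.f j))
    exact h1.trans h2.symm
  let p : T ⟶ S := Scheme.Cover.glueMorphisms 𝓤 (fun i => (y i).1) hw
  have hp : ∀ i, 𝓤.f i ≫ p = (y i).1 := fun i => Scheme.Cover.ι_glueMorphisms 𝓤 _ hw i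
  have hu : ∀ x : T, ∃ i y, 𝓤.f i y = x := 𝓤.exists_eq
  have hop : ∀ i, IsOpenImmersion (𝓤.f i) := fun i => inferInstance
  obtain ⟨V₁, hV₁⟩ := exists_glue_subbundle (w := hp) hu hE₁ (fun i => (y i).2.V₁) (by
    intro i j Z g₁ g₂ hg q' w₁ w₂
    obtain ⟨⟨q, z⟩, ⟨h1, h2, h3⟩, ⟨h4, h5, h6⟩⟩ := hy i j Z g₁ g₂ hg
    obtain rfl := w₁.symm.trans h1
    exact ⟨_, h2, h5⟩)
  obtain ⟨V₂, hV₂⟩ := exists_glue_subbundle (w := hp) hu hE₂ (fun i => (y i).2.V₂) (by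
    intro i j Z g₁ g₂ hg q' w₁ w₂
    obtain ⟨⟨q, z⟩, ⟨h1, h2, h3⟩, ⟨h4, h5, h6⟩⟩ := hy i j Z g₁ g₂ hg
    obtain rfl := w₁.symm.trans h1
    exact ⟨_, h3, h6⟩)
  have hmap : ∀ {F₁ F₂ : S.Modules} (f : F₁ ⟶ F₂) (_ : IsVectorBundle F₁ d)
      (V₁ : Subbundle (bc p F₁) r) (V₂ : Subbundle (bc p F₂) r)
      (W₁ : ∀ i, Subbundle (bc (y i).1 F₁) r) (W₂ : ∀ i, Subbundle (bc (y i).1 F₂) r)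
      (_ : ∀ i, IsBaseChange (𝓤.f i) (hp i) V₁ (W₁ i))
      (_ : ∀ i, IsBaseChange (𝓤.f i) (hp i) V₂ (W₂ i))
      (_ : ∀ i U, ∀ v ∈ (W₁ i).carrier U, (bcMap (y i).1 f).app U v ∈ (W₂ i).carrier U)
      (U : T.Opens), ∀ v ∈ V₁.carrier U, (bcMap p f).app U v ∈ V₂.carrier U := by
    intro F₁ F₂ f hF V₁ V₂ W₁ W₂ h₁ h₂ H U v hv
    refine V₂.mem_of_local _ _ fun x hx => ?_
    obtain ⟨i, z, rfl⟩ := hu x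
    refine (h₂ i).mem_of_pull_mem (𝓤.f i) (A := 𝓤.f i ⁻¹ᵁ U) le_rfl ?_ z hx
    rw [← hF.bcMap_pull]
    exact H i _ _ ((h₁ i).pull_mem _ hv)
  let V : LinkedPair p f g r := ⟨V₁, V₂,
    hmap f hE₁ V₁ V₂ _ _ hV₁ hV₂ (fun i => (y i).2.map_f),
    hmap g hE₂ V₂ V₁ _ _ hV₂ hV₁ (fun i => (y i).2.map_g)⟩
  refine ⟨⟨p, V⟩, ?_, ?_⟩
  · rintro _ _ ⟨i⟩
    exact (linkedFunctor_map_eq_iff hE₁ hE₂ _ _ _).mpr ⟨hp i, hV₁ i, hV₂ i⟩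
  · rintro ⟨p', V'⟩ hV'
    have h1 : ∀ i, Classifies (𝓤.f i) V' (y i).2 := fun i =>
      (linkedFunctor_map_eq_iff hE₁ hE₂ _ _ _).mp (hV' (𝓤.f i) (.mk i))
    have h2 : p' = p := by
      refine Scheme.Cover.hom_ext 𝓤 _ _ fun i => ?_
      rw [hp]
      exact (h1 i).1
    subst h2
    congr 1
    exact LinkedPair.ext' (Subbundle.eq_of_cover hu (fun i => (h1 i).2.1) hV₁)
      (Subbundle.eq_of_cover hu (fun i => (h1 i).2.2) hV₂)

end functor

/-! ### Gluing representing schemes from open charts -/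

section charts

variable {S : Scheme.{u}} {E₁ E₂ : S.Modules} {f : E₁ ⟶ E₂} {g : E₂ ⟶ E₁} {r d : ℕ}

/-- An open subfunctor of the functor of linked pairs, represented by a scheme. -/
structure OpenChart (f : E₁ ⟶ E₂) (g : E₂ ⟶ E₁) (r : ℕ) where
  /-- the representing scheme -/
  X : Scheme.{u}
  /-- its structure morphism -/
  π : X ⟶ S
  /-- the universal pair -/
  univ : LinkedPair π f g r
  /-- the open set over which a pair belongs to the subfunctor -/
  locus : ∀ {T : Scheme.{u}} {p : T ⟶ S}, LinkedPair p f g r → T.Opens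
  locus_univ : locus univ = ⊤
  locus_pull : ∀ {T T' : Scheme.{u}} {p : T ⟶ S} {q : T' ⟶ S} (h : T' ⟶ T)
    (V : LinkedPair p f g r) (W : LinkedPair q f g r), Classifies h V W → locus W = h ⁻¹ᵁ locus V
  existsUnique : ∀ {T : Scheme.{u}} {p : T ⟶ S} (V : LinkedPair p f g r), locus V = ⊤ →
    ∃! h : T ⟶ X, Classifies h univ V

namespace OpenChart

variable (hE₁ : IsVectorBundle E₁ d) (hE₂ : IsVectorBundle E₂ d) (C : OpenChart f g r)

/-- The morphism from the representing scheme of a chart to the functor of linked pairs. -/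
def toFunctor : yoneda.obj C.X ⟶ linkedFunctor hE₁ hE₂ f g r :=
  yonedaEquiv.symm (show SomeLinkedPair f g r C.X from ⟨C.π, C.univ⟩)

theorem toFunctor_app_eq_iff {T : Scheme.{u}} (h : T ⟶ C.X) (y : SomeLinkedPair f g r T) :
    (C.toFunctor hE₁ hE₂).app (.op T) h = y ↔ Classifies h C.univ y.2 :=
  SomeLinkedPair.pull_eq_iff hE₁ hE₂ h ⟨C.π, C.univ⟩ y

include hE₁ hE₂ in
theorem exists_hom_locus {T : Scheme.{u}} {p : T ⟶ S} (V : LinkedPair p f g r) :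
    ∃ (h : (C.locus V : Scheme.{u}) ⟶ C.X) (W : LinkedPair ((C.locus V).ι ≫ p) f g r),
      Classifies (C.locus V).ι V W ∧ Classifies h C.univ W := by
  obtain ⟨W, hW⟩ := exists_classifies hE₁ hE₂ (C.locus V).ι rfl V
  have := C.locus_pull _ _ _ hW
  obtain ⟨h, hh, -⟩ := C.existsUnique W (by rw [this]; simp)
  exact ⟨h, W, hW, hh⟩

/-- The pair `W` is also a base change of the universal pair, whose locus is everything; hence the
preimage of `locus V` under `b` is all of `T'`. -/
theorem exists_lift_locus {T T' : Scheme.{u}} {p : T ⟶ S} {q : T' ⟶ S} (V : LinkedPair p f g r)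
    (W : LinkedPair q f g r) (b : T' ⟶ T) (hb : Classifies b V W) (a : T' ⟶ C.X)
    (ha : Classifies a C.univ W) : ∃ c : T' ⟶ C.locus V, c ≫ (C.locus V).ι = b := by
  have h1 : C.locus W = ⊤ := by rw [C.locus_pull _ _ _ ha, C.locus_univ]; rfl
  have h2 := C.locus_pull _ _ _ hb
  refine ⟨IsOpenImmersion.lift (C.locus V).ι b ?_, IsOpenImmersion.lift_fac _ _ _⟩
  rintro _ ⟨x, rfl⟩
  have : x ∈ b ⁻¹ᵁ C.locus V := by rw [← h2, h1]; trivial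
  simpa using this

/-- For a pair `V` over `T`, the fiber product of `T` with the chart over the functor is the open
subscheme `locus V`. This is verified on `T'`-valued points. -/
theorem isOpenImmersion_toFunctor : IsOpenImmersion.presheaf (C.toFunctor hE₁ hE₂) := by
  refine MorphismProperty.relative.of_exists fun T y' => ?_
  let y : SomeLinkedPair f g r T := yonedaEquiv y'
  have hy' : ∀ (T' : Scheme.{u}) (b : T' ⟶ T) (z : SomeLinkedPair f g r T'),
      y'.app (.op T') b = z ↔ Classifies b y.2 z.2 := by
    intro T' b z
    have : y'.app (.op T') b = (linkedFunctor hE₁ hE₂ f g r).map b.op y := by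
      have h1 := congrArg (fun α => α.app (.op T') b) (yonedaEquiv.symm_apply_apply y')
      exact h1.symm
    rw [this]
    exact SomeLinkedPair.pull_eq_iff hE₁ hE₂ b y z
  obtain ⟨h, W, hW, hh⟩ := C.exists_hom_locus hE₁ hE₂ y.2
  refine ⟨_, yoneda.map h, (C.locus y.2).ι, ?_, inferInstance⟩
  refine IsPullback.of_forall_isPullback_app fun T' => ?_
  obtain ⟨T'⟩ := T'
  rw [Limits.Types.isPullback_iff]
  refine ⟨?_, ?_, ?_⟩
  · ext c
    obtain ⟨V', hV'⟩ := exists_classifies hE₁ hE₂ (c : T' ⟶ _) rfl W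
    have h1 := hh.comp hE₁ hE₂ hV'
    have h2 := hW.comp hE₁ hE₂ hV'
    exact ((C.toFunctor_app_eq_iff hE₁ hE₂ _ ⟨_, V'⟩).mpr h1).trans
      ((hy' _ _ ⟨_, V'⟩).mpr h2).symm
  · intro a b hab
    exact (cancel_mono (C.locus y.2).ι).mp hab.2
  · intro a b hab
    let z : SomeLinkedPair f g r T' := y'.app (.op T') b
    have hz := (C.toFunctor_app_eq_iff hE₁ hE₂ (T := T') a z).mp hab
    have hz' := (hy' T' b z).mp rfl
    obtain ⟨c, hc⟩ := C.exists_lift_locus y.2 z.2 b hz' a hz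
    refine ⟨c, ?_, hc⟩
    have h1 : C.locus z.2 = ⊤ := by rw [C.locus_pull _ _ _ hz, C.locus_univ]; rfl
    -- Both `c ≫ h` and `a` classify the pair `z`, one through `W` over the locus and the other by
    -- assumption, so they coincide.
    refine (C.existsUnique z.2 h1).unique ?_ hz
    obtain ⟨V', hV'⟩ := exists_classifies hE₁ hE₂ c rfl W
    have h3 := hW.comp hE₁ hE₂ hV'
    have h4 := hh.comp hE₁ hE₂ hV'
    rw [hc] at h3
    have h5 := (hy' T' b ⟨_, V'⟩).mpr h3
    exact (C.toFunctor_app_eq_iff hE₁ hE₂ (T := T') (c ≫ h) z).mp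
      (((C.toFunctor_app_eq_iff hE₁ hE₂ _ ⟨_, V'⟩).mpr h4).trans h5.symm)

include hE₁ hE₂ in
/-- If open charts cover the functor of linked pairs, it is represented by a scheme. -/
theorem exists_isLinkedGrassmannian {ι : Type u} (C : ι → OpenChart f g r)
    (hC : ∀ (T : Scheme.{u}) (p : T ⟶ S) (V : LinkedPair p f g r) (x : T),
      ∃ c, x ∈ (C c).locus V) :
    ∃ (LG : Scheme.{u}) (π : LG ⟶ S) (𝒱 : LinkedPair π f g r), IsLinkedGrassmannian π 𝒱 := by
  let F : Sheaf Scheme.zariskiTopology.{u} (Type u) :=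
    ⟨linkedFunctor hE₁ hE₂ f g r, linkedFunctor_isSheaf hE₁ hE₂⟩
  let φ : ∀ i, yoneda.obj (C i).X ⟶ F.1 := fun i => (C i).toFunctor hE₁ hE₂
  have hφ : ∀ i, IsOpenImmersion.presheaf (φ i) := fun i =>
    (C i).isOpenImmersion_toFunctor hE₁ hE₂
  have hι : ∀ (i : ι) (T : Scheme.{u}) (h : T ⟶ (C i).X), (Limits.Sigma.desc φ).app (.op T)
      ((Limits.Sigma.ι (fun i => yoneda.obj (C i).X) i).app (.op T) h) =
        (φ i).app (.op T) h := by
    intro i T h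
    have h1 := congrArg (fun α => α.app (.op T)) (Limits.Sigma.ι_desc φ i)
    exact ConcreteCategory.congr_hom h1 h
  -- That the loci cover is exactly local surjectivity: over `locus V` of a chart, `V` is a base
  -- change of the universal pair of that chart.
  have hs : Presheaf.IsLocallySurjective Scheme.zariskiTopology (Limits.Sigma.desc φ) := by
    constructor
    intro T y
    obtain ⟨p, V⟩ : SomeLinkedPair f g r T := y
    have hU : TopologicalSpace.IsOpenCover fun c => (C c).locus V := by
      rw [TopologicalSpace.IsOpenCover, eq_top_iff]
      intro x _
      obtain ⟨c, hc⟩ := hC T p V x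
      exact TopologicalSpace.Opens.mem_iSup.mpr ⟨c, hc⟩
    refine GrothendieckTopology.superset_covering _ ?_
      (Scheme.openCoverOfIsOpenCover T _ hU).mem_grothendieckTopology
    rintro T' _ ⟨_, a, _, ⟨i⟩, rfl⟩
    obtain ⟨h, W, hW, hh⟩ := (C i).exists_hom_locus hE₁ hE₂ V
    obtain ⟨V', hV'⟩ := exists_classifies hE₁ hE₂ (show T' ⟶ ((C i).locus V : Scheme.{u}) from a)
      rfl W
    refine ⟨(Limits.Sigma.ι (fun i => yoneda.obj (C i).X) i).app (.op T')
      ((show T' ⟶ ((C i).locus V : Scheme.{u}) from a) ≫ h), ?_⟩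
    have h1 := ((C i).toFunctor_app_eq_iff hE₁ hE₂ _ ⟨_, V'⟩).mpr (hh.comp hE₁ hE₂ hV')
    have h2 := (linkedFunctor_map_eq_iff hE₁ hE₂ (f := f) (g := g) (r := r) _ ⟨_, V⟩ ⟨_, V'⟩).mpr
      (hW.comp hE₁ hE₂ hV')
    exact (hι i T' _).trans (h1.trans h2.symm)
  have hrep : F.1.IsRepresentable := Scheme.LocalRepresentability.isRepresentable hφ
  obtain ⟨LG, ⟨R⟩⟩ := hrep
  let y : SomeLinkedPair f g r LG := R.homEquiv (𝟙 LG)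
  refine ⟨LG, y.1, y.2, fun T p W => ?_⟩
  have key : ∀ h : T ⟶ LG, R.homEquiv h = (⟨p, W⟩ : SomeLinkedPair f g r T) ↔
      Classifies h y.2 W := by
    intro h
    rw [R.homEquiv_eq]
    exact linkedFunctor_map_eq_iff hE₁ hE₂ h y ⟨p, W⟩
  obtain ⟨h, hh⟩ := R.homEquiv.surjective (⟨p, W⟩ : SomeLinkedPair f g r T)
  exact ⟨h, (key h).mp hh, fun h' hh' => R.homEquiv.injective (((key h').mpr hh').trans hh.symm)⟩

include hE₁ hE₂ in
/-- The part of the linked Grassmannian scheme that lies in a chart. -/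
theorem exists_iso {LG : Scheme.{u}} {π : LG ⟶ S} {𝒱 : LinkedPair π f g r}
    (h𝒱 : IsLinkedGrassmannian π 𝒱) :
    ∃ φ : (C.locus 𝒱 : Scheme.{u}) ≅ C.X, φ.hom ≫ C.π = (C.locus 𝒱).ι ≫ π ∧
      ∃ W : LinkedPair ((C.locus 𝒱).ι ≫ π) f g r,
        Classifies (C.locus 𝒱).ι 𝒱 W ∧ Classifies φ.hom C.univ W := by
  obtain ⟨h, W, hW, hh⟩ := C.exists_hom_locus hE₁ hE₂ 𝒱
  -- The inverse is the morphism `b` that classifies the universal pair of the chart; it factors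
  -- through the locus. One composite is the identity by uniqueness for `LG`, the other by
  -- uniqueness for the chart.
  obtain ⟨b, hb, -⟩ := h𝒱 C.X C.π C.univ
  obtain ⟨c, hc⟩ := C.exists_lift_locus 𝒱 C.univ b hb (𝟙 _) (classifies_id hE₁ hE₂ _)
  have h1 : h ≫ b = (C.locus 𝒱).ι := (h𝒱 _ _ W).unique (hb.comp hE₁ hE₂ hh) hW
  have h2 : h ≫ c = 𝟙 _ := by
    rw [← cancel_mono (C.locus 𝒱).ι, Category.assoc, hc, h1, Category.id_comp]
  have h3 : c ≫ h = 𝟙 _ := by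
    obtain ⟨V', hV'⟩ := exists_classifies hE₁ hE₂ c rfl W
    have h4 := hW.comp hE₁ hE₂ hV'
    rw [hc] at h4
    have h5 := hh.comp hE₁ hE₂ hV'
    have h6 : (⟨_, V'⟩ : SomeLinkedPair f g r C.X) = ⟨C.π, C.univ⟩ :=
      ((linkedFunctor_map_eq_iff hE₁ hE₂ b ⟨_, 𝒱⟩ ⟨_, V'⟩).mpr h4).symm.trans
        ((linkedFunctor_map_eq_iff hE₁ hE₂ b ⟨_, 𝒱⟩ ⟨_, C.univ⟩).mpr hb)
    have h7 := (linkedFunctor_map_eq_iff hE₁ hE₂ (c ≫ h) ⟨_, C.univ⟩ ⟨_, V'⟩).mpr h5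
    exact (C.existsUnique C.univ C.locus_univ).unique
      ((linkedFunctor_map_eq_iff hE₁ hE₂ (c ≫ h) ⟨_, C.univ⟩ ⟨_, C.univ⟩).mp (h7.trans h6))
      (classifies_id hE₁ hE₂ _)
  exact ⟨⟨h, c, h2, h3⟩, hh.1, W, hW, hh⟩

end OpenChart

end charts

/-! ### Sub-bundles that are graphs -/

section graphs

variable {X : Scheme.{u}} {E : X.Modules} {U A B : X.Opens} {ι κ n : Type} {r : ℕ}
  [Fintype ι] [Fintype κ] [Fintype n] {e : ι ⊕ κ → Γ(E, U)}

/-- In the coordinates of the frame `e`, the sub-bundle `V` is over `A` the graph of the linear map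
with matrix `a`. -/
def Subbundle.IsGraph (V : Subbundle E r) (he : IsFrame E U e) (hA : A ≤ U)
    (a : Matrix κ ι Γ(X, A)) : Prop :=
  ∀ (W : X.Opens) (hW : W ≤ A) (v : Γ(E, W)), v ∈ V.carrier W ↔
    ∀ j, he.coord (hW.trans hA) v (Sum.inr j) =
      ∑ i, fres hW (a j i) * he.coord (hW.trans hA) v (Sum.inl i)

variable {V V' : Subbundle E r} {he : IsFrame E U e} {hA : A ≤ U} {a a' : Matrix κ ι Γ(X, A)}

theorem Subbundle.IsGraph.mono (H : V.IsGraph he hA a) (hB : B ≤ A) :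
    V.IsGraph he (hB.trans hA) (fun j i => fres hB (a j i)) := by
  intro W hW v
  simp only [fres_fres]
  exact H W (hW.trans hB) v

theorem Subbundle.IsGraph.congr_open (H : V.IsGraph he hA a) (hAB : A = B) :
    ∃ b, V.IsGraph he (hAB ▸ hA) b := by
  subst hAB
  exact ⟨a, H⟩

/-- The section of a graph that projects to an element of the frame. -/
def graphSection (he : IsFrame E U e) (hA : A ≤ U) [DecidableEq ι] (a : Matrix κ ι Γ(X, A)) (i : ι) :
    Γ(E, A) :=
  (he.coord hA).symm (Sum.elim (Pi.single i 1) fun j => a j i)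

theorem coord_graphSection [DecidableEq ι] (he : IsFrame E U e) (hA : A ≤ U)
    (a : Matrix κ ι Γ(X, A)) (i : ι) :
    he.coord hA (graphSection he hA a i) = Sum.elim (Pi.single i 1) fun j => a j i :=
  LinearEquiv.apply_symm_apply _ _

theorem coord_res_graphSection [DecidableEq ι] (he : IsFrame E U e) (hA : A ≤ U)
    (a : Matrix κ ι Γ(X, A)) (i : ι) (hB : B ≤ A) :
    he.coord (hB.trans hA) (res E hB (graphSection he hA a i)) =
      Sum.elim (Pi.single i 1) fun j => fres hB (a j i) := by
  ext (k | k)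
  · rw [he.coord_res hA hB, coord_graphSection]
    by_cases h : k = i
    · subst h; simp
    · simp [h]
  · rw [he.coord_res hA hB, coord_graphSection]
    simp

theorem Subbundle.IsGraph.section_mem [DecidableEq ι] (H : V.IsGraph he hA a) (i : ι) :
    graphSection he hA a i ∈ V.carrier A := by
  rw [H A le_rfl]
  intro j
  rw [coord_graphSection]
  simp [Pi.single_apply]

theorem Subbundle.IsGraph.unique (H : V.IsGraph he hA a) (H' : V.IsGraph he hA a') : a = a' := by
  classical
  ext j i
  have h := (H' A le_rfl _).mp (H.section_mem i) j
  rw [coord_graphSection] at h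
  simpa [Pi.single_apply] using h

theorem eq_sum_graphSection [DecidableEq ι] (hB : B ≤ A) {v : Γ(E, B)}
    (hv : ∀ j, he.coord (hB.trans hA) v (Sum.inr j) =
      ∑ i, fres hB (a j i) * he.coord (hB.trans hA) v (Sum.inl i)) :
    v = ∑ i, he.coord (hB.trans hA) v (Sum.inl i) • res E hB (graphSection he hA a i) := by
  refine he.ext_coord (hB.trans hA) fun k => ?_
  simp only [map_sum, map_smul, coord_res_graphSection, Finset.sum_apply, Pi.smul_apply, smul_eq_mul]
  obtain k | k := k
  · simp only [Sum.elim_inl, Pi.single_apply, mul_ite, mul_one, mul_zero, Finset.sum_ite_eq,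
      Finset.mem_univ, if_true]
  · rw [hv k]
    exact Finset.sum_congr rfl fun i _ => mul_comm _ _

theorem Subbundle.IsGraph.sum_section [DecidableEq ι] (H : V.IsGraph he hA a) (hB : B ≤ A) {v : Γ(E, B)}
    (hv : v ∈ V.carrier B) :
    v = ∑ i, he.coord (hB.trans hA) v (Sum.inl i) • res E hB (graphSection he hA a i) :=
  eq_sum_graphSection hB ((H B hB v).mp hv)

theorem Subbundle.IsGraph.eq {hA : ⊤ ≤ U} {a : Matrix κ ι Γ(X, ⊤)} (H : V.IsGraph he hA a)
    (H' : V'.IsGraph he hA a) : V = V' := by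
  refine Subbundle.ext (funext fun W => Submodule.ext fun v => ?_)
  rw [H W le_top, H' W le_top]

/-- The frame adapted to a graph. -/
def graphFrame [DecidableEq ι] (he : IsFrame E U e) (hA : A ≤ U) (a : Matrix κ ι Γ(X, A)) :
    ι ⊕ κ → Γ(E, A) :=
  Sum.elim (graphSection he hA a) fun j => res E hA (e (Sum.inr j))

/-- The change of frame is block unitriangular with off-diagonal block `a`, and its inverse has
`-a`. -/
theorem isFrame_graphFrame [DecidableEq ι] [DecidableEq κ] (he : IsFrame E U e) (hA : A ≤ U)
    (a : Matrix κ ι Γ(X, A)) : IsFrame E A (graphFrame he hA a) := by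
  have h := (he.mono hA).combine (Matrix.fromBlocks 1 0 a 1) (Matrix.fromBlocks 1 0 (-a) 1)
    (by simp [Matrix.fromBlocks_multiply]) (by simp [Matrix.fromBlocks_multiply])
  convert h using 1
  ext1 k
  refine he.ext_coord hA fun l => ?_
  have h1 := (he.mono hA).coord_combine (Matrix.fromBlocks 1 0 a 1) le_rfl k l
  rw [res_self, fres_self, he.coord_mono] at h1
  rw [h1]
  obtain k | k := k
  · simp only [graphFrame, Sum.elim_inl, coord_graphSection]
    obtain l | l := l <;> simp [Matrix.one_apply, Pi.single_apply]
  · simp only [graphFrame, Sum.elim_inr, he.coord_self]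
    obtain l | l := l <;> simp [Matrix.one_apply, Pi.single_apply]

theorem Subbundle.IsGraph.adapted [DecidableEq ι] (H : V.IsGraph he hA a) :
    V.Adapted (graphFrame he hA a) := by
  intro W hW
  refine le_antisymm (fun v hv => ?_) (Submodule.span_le.mpr ?_)
  · rw [H.sum_section hW hv]
    exact Submodule.sum_mem _ fun i _ => Submodule.smul_mem _ _ (Submodule.subset_span ⟨i, rfl⟩)
  · rintro _ ⟨i, rfl⟩
    exact V.res_mem _ _ (H.section_mem i)

/-- The matrix of the components of sections in the first part of a frame. -/
def inlMatrix (he : IsFrame E U e) (hA : A ≤ U) (ε : n → Γ(E, A)) : Matrix ι n Γ(X, A) :=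
  fun i k => he.coord hA (ε k) (Sum.inl i)

/-- The matrix of the components of sections in the second part of a frame. -/
def inrMatrix (he : IsFrame E U e) (hA : A ≤ U) (ε : n → Γ(E, A)) : Matrix κ n Γ(X, A) :=
  fun i k => he.coord hA (ε k) (Sum.inr i)

/-- Expressing the graph sections, whose first components form the identity matrix, through the
spanning family `ε` produces a right inverse of the minor. -/
theorem Subbundle.IsGraph.isUnit_det [DecidableEq ι] (H : V.IsGraph he hA a) {ε : ι ⊕ n → Γ(E, A)}
    (hε : V.Adapted ε) : IsUnit (inlMatrix he hA (ε ∘ Sum.inl)).det := by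
  have h : ∀ i, ∃ b : ι → Γ(X, A), graphSection he hA a i = ∑ k, b k • ε (Sum.inl k) := by
    intro i
    have h1 := H.section_mem i
    rw [hε A le_rfl, Submodule.mem_span_range_iff_exists_fun] at h1
    obtain ⟨b, hb⟩ := h1
    exact ⟨b, by simpa only [res_self] using hb.symm⟩
  choose b hb using h
  refine Matrix.isUnit_det_of_right_inverse (B := Matrix.of fun k i => b i k) ?_
  ext i i'
  have h2 := congrArg (fun v => he.coord hA v (Sum.inl i)) (hb i')
  simp only [coord_graphSection, map_sum, map_smul, Finset.sum_apply, Pi.smul_apply] at h2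
  simp only [Sum.elim_inl, Pi.single_apply, smul_eq_mul] at h2
  rw [Matrix.one_apply, h2, Matrix.mul_apply]
  exact Finset.sum_congr rfl fun k _ => mul_comm _ _

/-- Column reduction: if the first block `G₁` of a spanning family is invertible, the span of the
columns of `(G₁, G₂)` is the graph of `G₂ G₁⁻¹`. -/
theorem Subbundle.Adapted.isGraph [DecidableEq ι] {ε : ι ⊕ n → Γ(E, A)} (hε : V.Adapted ε)
    (he : IsFrame E U e) (hA : A ≤ U) (B : Matrix ι ι Γ(X, A))
    (hB : inlMatrix he hA (ε ∘ Sum.inl) * B = 1) :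
    V.IsGraph he hA (inrMatrix he hA (ε ∘ Sum.inl) * B) := by
  intro W hW v
  have key : ∀ c : ι → Γ(X, W), ∀ k, he.coord (hW.trans hA) (∑ i, c i • res E hW (ε (Sum.inl i))) k =
      ∑ i, c i * fres hW (he.coord hA (ε (Sum.inl i)) k) := by
    intro c k
    simp only [map_sum, map_smul, Finset.sum_apply, Pi.smul_apply, smul_eq_mul]
    exact Finset.sum_congr rfl fun i _ => by rw [he.coord_res hA hW]
  have hf : ∀ {l m : Type} [Fintype l] [Fintype m] (M : Matrix l ι Γ(X, A)) (N : Matrix ι m Γ(X, A)),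
      (M * N).map (fres hW) = M.map (fres hW) * N.map (fres hW) := fun M N => Matrix.map_mul
  rw [hε W hW, Submodule.mem_span_range_iff_exists_fun]
  set G₁ := (inlMatrix he hA (ε ∘ Sum.inl)).map (fres hW) with hG₁
  set G₂ := (inrMatrix he hA (ε ∘ Sum.inl)).map (fres hW) with hG₂
  set B' := B.map (fres hW) with hB''
  have e₁ : G₁ * B' = 1 := by rw [hG₁, hB'', ← hf, hB]; simp
  have e₂ : B' * G₁ = 1 := mul_eq_one_comm.mp e₁
  have key₁ : ∀ c : ι → Γ(X, W), (fun i => he.coord (hW.trans hA)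
      (∑ i, c i • res E hW (ε (Sum.inl i))) (Sum.inl i)) = G₁.mulVec c := by
    intro c; ext i; rw [key]; exact Finset.sum_congr rfl fun k _ => mul_comm _ _
  have key₂ : ∀ c : ι → Γ(X, W), (fun i => he.coord (hW.trans hA)
      (∑ i, c i • res E hW (ε (Sum.inl i))) (Sum.inr i)) = G₂.mulVec c := by
    intro c; ext i; rw [key]; exact Finset.sum_congr rfl fun k _ => mul_comm _ _
  have goal : (∀ j, he.coord (hW.trans hA) v (Sum.inr j) =
      ∑ i, fres hW ((inrMatrix he hA (ε ∘ Sum.inl) * B) j i) *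
        he.coord (hW.trans hA) v (Sum.inl i)) ↔
      (fun j => he.coord (hW.trans hA) v (Sum.inr j)) =
        (G₂ * B').mulVec fun i => he.coord (hW.trans hA) v (Sum.inl i) := by
    rw [funext_iff, hG₂, hB'', ← hf]
    rfl
  rw [goal]
  constructor
  · rintro ⟨c, rfl⟩
    rw [key₁, key₂, Matrix.mulVec_mulVec, Matrix.mul_assoc, e₂, Matrix.mul_one]
  · intro h
    refine ⟨B'.mulVec fun i => he.coord (hW.trans hA) v (Sum.inl i),
      he.ext_coord (hW.trans hA) ?_⟩
    rintro (i | j)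
    · rw [congrFun (key₁ _) i, Matrix.mulVec_mulVec, e₁, Matrix.one_mulVec]
    · rw [congrFun (key₂ _) j, Matrix.mulVec_mulVec, ← h]

theorem Subbundle.exists_adapted_of_card (V : Subbundle E r) (hr : Fintype.card ι = r) (x : X) :
    ∃ U : X.Opens, x ∈ U ∧ ∃ (n : ℕ) (ε : ι ⊕ Fin n → Γ(E, U)), IsFrame E U ε ∧ V.Adapted ε := by
  obtain ⟨U, hx, n, ε, hε, hV⟩ := V.exists_adapted x
  let σ : ι ≃ Fin r := Fintype.equivFinOfCardEq hr
  refine ⟨U, hx, n, _, hε.reindex (Equiv.sumCongr σ (Equiv.refl (Fin n))), ?_⟩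
  intro W hW
  rw [hV W hW]
  congr 1
  exact (σ.surjective.range_comp fun i => res E hW (ε (Sum.inl i))).symm

/-- The largest open set over which a sub-bundle is a graph. -/
def Subbundle.graphLocus (V : Subbundle E r) (he : IsFrame E U e) : X.Opens :=
  ⨆ A : {A : X.Opens // ∃ (hA : A ≤ U) (a : Matrix κ ι Γ(X, A)), V.IsGraph he hA a}, A.1

theorem Subbundle.graphLocus_le (V : Subbundle E r) (he : IsFrame E U e) : V.graphLocus he ≤ U :=
  iSup_le fun A => A.2.1

theorem Subbundle.IsGraph.le_graphLocus (H : V.IsGraph he hA a) : A ≤ V.graphLocus he :=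
  le_iSup (fun A : {A : X.Opens // ∃ (hA : A ≤ U) (a : Matrix κ ι Γ(X, A)), V.IsGraph he hA a} =>
    A.1) ⟨A, hA, a, H⟩

theorem Subbundle.mem_graphLocus_iff {x : X} : x ∈ V.graphLocus he ↔
    ∃ (A : X.Opens) (hA : A ≤ U) (a : Matrix κ ι Γ(X, A)), x ∈ A ∧ V.IsGraph he hA a := by
  constructor
  · intro h
    obtain ⟨⟨A, hA, a, H⟩, hx⟩ := TopologicalSpace.Opens.mem_iSup.mp h
    exact ⟨A, hA, a, hx, H⟩
  · rintro ⟨A, hA, a, hx, H⟩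
    exact H.le_graphLocus hx

/-- Matrices on the various open sets agree on overlaps by `IsGraph.unique`, hence glue to a single
matrix over the largest open set; being its graph is then a local statement. -/
theorem Subbundle.exists_isGraph (V : Subbundle E r) (he : IsFrame E U e) :
    ∃ a, V.IsGraph he (V.graphLocus_le he) a := by
  choose hA a H using fun A : {A : X.Opens // ∃ (hA : A ≤ U) (a : Matrix κ ι Γ(X, A)),
    V.IsGraph he hA a} => A.2
  have h : ∀ j i, ∃ b : Γ(X, V.graphLocus he), ∀ A, fres (le_iSup (fun A : {A : X.Opens //
      ∃ (hA : A ≤ U) (a : Matrix κ ι Γ(X, A)), V.IsGraph he hA a} => A.1) A) b = a A j i := by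
    intro j i
    refine exists_glue _ (fun A => a A j i) fun A A' => ?_
    have h1 := ((H A).mono inf_le_left).unique ((H A').mono (inf_le_right : A.1 ⊓ A'.1 ≤ A'.1))
    exact congrFun (congrFun h1 j) i
  choose b hb' using h
  have hb : ∀ j i A, fres (H A).le_graphLocus (b j i) = a A j i := hb'
  refine ⟨b, fun W hW v => ⟨fun hv j => ?_, fun hv => ?_⟩⟩
  · refine function_ext _ _ fun x hx => ?_
    obtain ⟨A, hx'⟩ := TopologicalSpace.Opens.mem_iSup.mp (hW hx)
    refine ⟨W ⊓ A.1, inf_le_left, ⟨hx, hx'⟩, ?_⟩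
    have h1 := (H A _ (inf_le_right : W ⊓ A.1 ≤ A.1) _).mp (V.res_mem inf_le_left v hv) j
    simp only [map_sum, map_mul, ← he.coord_res, fres_fres]
    rw [h1]
    refine Finset.sum_congr rfl fun i _ => ?_
    rw [← hb, fres_fres]
  · refine V.mem_of_local _ _ fun x hx => ?_
    obtain ⟨A, hx'⟩ := TopologicalSpace.Opens.mem_iSup.mp (hW hx)
    refine ⟨W ⊓ A.1, inf_le_left, ⟨hx, hx'⟩, ?_⟩
    rw [H A _ (inf_le_right : W ⊓ A.1 ≤ A.1)]
    intro j
    rw [he.coord_res (hW.trans (V.graphLocus_le he)) inf_le_left, hv, map_sum]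
    refine Finset.sum_congr rfl fun i _ => ?_
    rw [he.coord_res (hW.trans (V.graphLocus_le he)) inf_le_left, map_mul, ← hb, fres_fres,
      fres_fres]

theorem Subbundle.exists_isGraph_top (h : V.graphLocus he = ⊤) :
    ∃ (hA : ⊤ ≤ U) (a : Matrix κ ι Γ(X, ⊤)), V.IsGraph he hA a := by
  obtain ⟨a, ha⟩ := V.exists_isGraph he
  exact ⟨h ▸ V.graphLocus_le he, ha.congr_open h⟩

/-- Together with `Subbundle.IsGraph.isUnit_det` this describes the graph locus, on the domain of an
adapted family, as the locus where a minor is invertible. -/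
theorem Subbundle.Adapted.mem_graphLocus [DecidableEq ι] {ε : ι ⊕ n → Γ(E, A)} (hε : V.Adapted ε)
    (he : IsFrame E U e) (hA : A ≤ U) {x : X}
    (hx : x ∈ X.basicOpen (inlMatrix he hA (ε ∘ Sum.inl)).det) : x ∈ V.graphLocus he := by
  set δ := (inlMatrix he hA (ε ∘ Sum.inl)).det
  have hle : X.basicOpen δ ≤ A := X.basicOpen_le δ
  have h1 : inlMatrix he (hle.trans hA) ((fun i => res E hle (ε i)) ∘ Sum.inl) =
      (inlMatrix he hA (ε ∘ Sum.inl)).map (fres hle) := by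
    ext i k
    exact he.coord_res hA hle _ _
  have h2 : IsUnit (inlMatrix he (hle.trans hA) ((fun i => res E hle (ε i)) ∘ Sum.inl)).det := by
    have h3 : (inlMatrix he (hle.trans hA) ((fun i => res E hle (ε i)) ∘ Sum.inl)).det =
        fres hle δ := by
      rw [h1]
      exact ((fres hle).map_det _).symm
    rw [h3]
    exact RingedSpace.isUnit_res_basicOpen _ δ
  exact ((hε.mono hle).isGraph he (hle.trans hA) _ (Matrix.mul_nonsing_inv _ h2)).le_graphLocus hx

/-- The graph of a linear map as a sub-bundle. -/
theorem exists_subbundle_isGraph (he : IsFrame E U e) (hA : ⊤ ≤ U) (a : Matrix κ ι Γ(X, ⊤))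
    (hr : Fintype.card ι = r) : ∃ V : Subbundle E r, V.IsGraph he hA a := by
  classical
  have hs : ∀ (W : X.Opens) (v : Γ(E, W)), (∀ j, he.coord (le_top.trans hA) v (Sum.inr j) =
        ∑ i, fres le_top (a j i) * he.coord (le_top.trans hA) v (Sum.inl i)) ↔
        ∀ j, he.coord (le_top.trans hA) v (Sum.inr j) -
        ∑ i, fres le_top (a j i) * he.coord (le_top.trans hA) v (Sum.inl i) = 0 := by
    intro W v
    simp only [sub_eq_zero]
  let car : ∀ W : X.Opens, Submodule Γ(X, W) Γ(E, W) := fun W =>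
    { carrier := {v | ∀ j, he.coord (le_top.trans hA) v (Sum.inr j) =
        ∑ i, fres le_top (a j i) * he.coord (le_top.trans hA) v (Sum.inl i)}
      zero_mem' := by intro j; simp
      add_mem' := by
        intro v w hv hw j
        simp only [map_add, Pi.add_apply, mul_add, Finset.sum_add_distrib]
        rw [hv j, hw j]
      smul_mem' := by
        intro c v hv j
        simp only [map_smul, Pi.smul_apply, smul_eq_mul, hv j, Finset.mul_sum]
        exact Finset.sum_congr rfl fun i _ => by ring }
  let σ : Fin r ≃ ι := (Fintype.equivFinOfCardEq hr).symm
  let τ : Fin (Fintype.card κ) ≃ κ := (Fintype.equivFin κ).symm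
  have hcar : ∀ W v, v ∈ car W ↔ ∀ j, he.coord (le_top.trans hA) v (Sum.inr j) =
        ∑ i, fres le_top (a j i) * he.coord (le_top.trans hA) v (Sum.inl i) := fun W v => Iff.rfl
  have hmem : ∀ W i, res E (le_top : W ≤ ⊤) (graphSection he hA a i) ∈ car W := by
    intro W i
    rw [hcar]
    intro j
    rw [coord_res_graphSection]
    simp [Pi.single_apply]
  refine ⟨⟨car, ?_, ?_, ?_⟩, fun W hW v => Iff.rfl⟩
  · intro W U' h v hv
    rw [hcar] at hv ⊢
    intro j
    rw [he.coord_res (le_top.trans hA) h, hv, map_sum]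
    refine Finset.sum_congr rfl fun i _ => ?_
    rw [he.coord_res (le_top.trans hA) h, map_mul, fres_fres]
  · intro U' v hv
    rw [hcar]
    intro j
    refine function_ext _ _ fun x hx => ?_
    obtain ⟨W, h, hxW, hW⟩ := hv x hx
    refine ⟨W, h, hxW, ?_⟩
    rw [hcar] at hW
    have := hW j
    rw [he.coord_res (le_top.trans hA) h] at this
    rw [this, map_sum]
    refine Finset.sum_congr rfl fun i _ => ?_
    rw [he.coord_res (le_top.trans hA) h, map_mul, fres_fres]
  · intro x
    refine ⟨⊤, trivial, _, _, (isFrame_graphFrame he hA a).reindex (Equiv.sumCongr σ τ), ?_⟩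
    intro W hW
    refine le_antisymm (fun v hv => ?_) (Submodule.span_le.mpr ?_)
    · rw [eq_sum_graphSection (he := he) (hA := hA) (a := a) le_top hv]
      refine Submodule.sum_mem _ fun i _ => Submodule.smul_mem _ _ (Submodule.subset_span
        ⟨σ.symm i, ?_⟩)
      simp [graphFrame]
    · rintro _ ⟨i, rfl⟩
      simpa [graphFrame] using hmem W (σ i)

end graphs

/-! ### Base change of graphs -/

section graphPull

variable {S T T' : Scheme.{u}} {p : T ⟶ S} {q : T' ⟶ S} {E : S.Modules} {h : T' ⟶ T}
  {w : h ≫ p = q} {U : S.Opens} {ι κ : Type} {r : ℕ} [Fintype ι] [Fintype κ]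
  [DecidableEq ι] [DecidableEq κ]

theorem IsFrame.coord_pull_basePull (w : h ≫ p = q) {e : ι → Γ(E, U)} (he : IsFrame E U e)
    {A : T.Opens} (hA : A ≤ p ⁻¹ᵁ U) {B : T'.Opens} (hB : B ≤ h ⁻¹ᵁ A) (v : Γ(bc p E, A)) (i : ι) :
    (he.basePull q).coord (le_preimage_comp w hA hB) (LinkedGr.pull h w E hB v) i =
      h.appLE A B hB ((he.basePull p).coord hA v i) := by
  refine congrFun ((he.basePull q).coord_eq (a := fun i =>
    h.appLE A B hB ((he.basePull p).coord hA v i)) (le_preimage_comp w hA hB) ?_) i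
  conv_lhs => rw [← (he.basePull p).sum_coord hA v, pull_sum]
  refine Finset.sum_congr rfl fun i _ => ?_
  rw [pull_smul, res_basePull, pull_basePull, res_basePull]

variable {e : ι ⊕ κ → Γ(E, U)} {he : IsFrame E U e}
  {V : Subbundle (bc p E) r} {V' : Subbundle (bc q E) r}
  {A : T.Opens} {hA : A ≤ p ⁻¹ᵁ U} {a : Matrix κ ι Γ(T, A)}

theorem IsBaseChange.isGraph (H : IsBaseChange h w V V') (hV : V.IsGraph (he.basePull p) hA a)
    {B : T'.Opens} (hB : B ≤ h ⁻¹ᵁ A) :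
    V'.IsGraph (he.basePull q) (le_preimage_comp w hA hB) (a.map (h.appLE A B hB)) := by
  have h1 := (H.adapted (isFrame_graphFrame (he.basePull p) hA a) hV.adapted).mono hB
  have h2 : ∀ i : ι, (he.basePull q).coord (le_preimage_comp w hA hB)
      (res _ hB (LinkedGr.pull h w E le_rfl (graphFrame (he.basePull p) hA a (Sum.inl i)))) =
      fun k => h.appLE A B hB ((Sum.elim (Pi.single i 1) fun j => a j i : ι ⊕ κ → Γ(T, A)) k) := by
    intro i
    ext k
    rw [res_pull, he.coord_pull_basePull w hA hB]
    simp only [graphFrame, Sum.elim_inl, coord_graphSection]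
  have h3 : inlMatrix (he.basePull q) (le_preimage_comp w hA hB) ((fun i => res _ hB
      (LinkedGr.pull h w E le_rfl (graphFrame (he.basePull p) hA a i))) ∘ Sum.inl) = 1 := by
    ext i k
    refine (congrFun (h2 k) (Sum.inl i)).trans ?_
    simp only [Sum.elim_inl, Pi.single_apply, Matrix.one_apply]
    split_ifs
    · exact map_one (h.appLE A B hB).hom
    · exact map_zero (h.appLE A B hB).hom
  have h4 : inrMatrix (he.basePull q) (le_preimage_comp w hA hB) ((fun i => res _ hB
      (LinkedGr.pull h w E le_rfl (graphFrame (he.basePull p) hA a i))) ∘ Sum.inl) =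
      a.map (h.appLE A B hB) := by
    ext i k
    exact congrFun (h2 k) (Sum.inr i)
  have h5 := h1.isGraph (he.basePull q) (le_preimage_comp w hA hB) 1 (by rw [h3, Matrix.mul_one])
  rwa [h4, Matrix.mul_one] at h5

/-- A global graph and its matrix determine each other, so base change of graphs is pull-back of
matrix entries. This turns statements about sub-bundles into statements about functions. -/
theorem isBaseChange_iff_of_isGraph {hA : ⊤ ≤ p ⁻¹ᵁ U} {hA' : ⊤ ≤ q ⁻¹ᵁ U} {a : Matrix κ ι Γ(T, ⊤)}
    {a' : Matrix κ ι Γ(T', ⊤)} (w : h ≫ p = q) (hV : V.IsGraph (he.basePull p) hA a)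
    (hV' : V'.IsGraph (he.basePull q) hA' a') :
    IsBaseChange h w V V' ↔ a' = a.map (h.appLE ⊤ ⊤ le_top) := by
  constructor
  · intro H
    exact hV'.unique (H.isGraph (he := he) hV le_top)
  · rintro rfl
    obtain ⟨V'', hV''⟩ := exists_isBaseChange w V
    rwa [hV'.eq (hV''.isGraph (he := he) hV le_top)]

/-- Locally the graph locus is where an `r × r` minor of an adapted frame is invertible, and the
formation of minors and of their nonvanishing loci commutes with pull-back. The hypothesis on `ι`
makes the minor square. -/
theorem IsBaseChange.graphLocus (H : IsBaseChange h w V V') (hr : Fintype.card ι = r) :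
    V'.graphLocus (he.basePull q) = h ⁻¹ᵁ V.graphLocus (he.basePull p) := by
  ext x
  constructor
  · intro hx
    obtain ⟨B, hB, b, hxB, hb⟩ := Subbundle.mem_graphLocus_iff.mp hx
    obtain ⟨A, hxA, n, ε, hε, hVε⟩ := V.exists_adapted_of_card hr (h x)
    have hxU : h x ∈ p ⁻¹ᵁ U := by
      have : x ∈ q ⁻¹ᵁ U := hB hxB
      rw [← w] at this
      exact this
    let A' : T.Opens := A ⊓ p ⁻¹ᵁ U
    have hA₁ : A' ≤ A := inf_le_left
    have hA₂ : A' ≤ p ⁻¹ᵁ U := inf_le_right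
    have hxA' : h x ∈ A' := ⟨hxA, hxU⟩
    let B' : T'.Opens := B ⊓ h ⁻¹ᵁ A'
    have hB₁ : B' ≤ B := inf_le_left
    have hB₂ : B' ≤ h ⁻¹ᵁ A' := inf_le_right
    have had := hVε.mono hA₁
    refine had.mem_graphLocus (he.basePull p) hA₂ ?_
    have h1 := (H.adapted (hε.mono hA₁) had).mono hB₂
    have h2 := (hb.mono hB₁).isUnit_det h1
    have h3 : inlMatrix (he.basePull q) (hB₁.trans hB) ((fun i => res _ hB₂
        (LinkedGr.pull h w E le_rfl (res _ hA₁ (ε i)))) ∘ Sum.inl) =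
        (inlMatrix (he.basePull p) hA₂ ((fun i => res _ hA₁ (ε i)) ∘ Sum.inl)).map
          (h.appLE A' B' hB₂) := by
      ext i k
      refine Eq.trans ?_ (he.coord_pull_basePull w hA₂ hB₂ _ _)
      simp only [inlMatrix, Function.comp_apply]
      rw [res_pull]
    rw [h3] at h2
    set G := inlMatrix (he.basePull p) hA₂ ((fun i => res _ hA₁ (ε i)) ∘ Sum.inl)
    have h4 : (G.map (h.appLE A' B' hB₂)).det = fres hB₂ (h.app A' G.det) := by
      refine ((h.appLE A' B' hB₂).hom.map_det G).symm.trans ?_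
      rw [fres_apply]
      rfl
    rw [h4] at h2
    have h5 : x ∈ T'.basicOpen (h.app A' G.det) := by
      have h6 : T'.basicOpen (fres hB₂ (h.app A' G.det)) ≤ T'.basicOpen (h.app A' G.det) := by
        rw [fres_apply, Scheme.basicOpen_res]
        exact inf_le_right
      refine h6 ?_
      rw [Scheme.basicOpen_of_isUnit _ h2]
      exact ⟨hxB, hxA'⟩
    rwa [← Scheme.preimage_basicOpen] at h5
  · intro hx
    obtain ⟨A, hA, a, hxA, ha⟩ := Subbundle.mem_graphLocus_iff.mp hx
    exact Subbundle.mem_graphLocus_iff.mpr ⟨_, _, _, hxA, H.isGraph (he := he) ha le_rfl⟩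

end graphPull

/-! ### The functor of points of the local model -/

namespace LocalModel

open Limits

variable {m l : ℕ} {Y T : Scheme.{u}} {s : Γ(Y, ⊤)}

theorem toAffine_appTop_eq_zero {a : Γ(𝔸(PairIdx.{u} l; Y), ⊤)} (ha : a ∈ pairIdeal l Y s) :
    (MatPairs.toAffine l Y s).appTop a = 0 := by
  refine function_ext _ _ fun x _ => ?_
  obtain ⟨U, hU, hxU, -⟩ := exists_isAffineOpen_mem_and_subset
    (x := MatPairs.toAffine l Y s x) (U := ⊤) trivial
  refine ⟨MatPairs.toAffine l Y s ⁻¹ᵁ U, le_top, hxU, ?_⟩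
  have h1 : (Scheme.IdealSheafData.ofIdealTop (pairIdeal l Y s)) ≤
      (MatPairs.toAffine l Y s).ker := (Scheme.IdealSheafData.ker_subschemeι _).ge
  have h2 := (h1 ⟨U, hU⟩).trans ((MatPairs.toAffine l Y s).ideal_ker_le ⟨U, hU⟩)
  have h3 : fres (le_top : U ≤ ⊤) a ∈
      (Scheme.IdealSheafData.ofIdealTop (pairIdeal l Y s)).ideal ⟨U, hU⟩ :=
    Ideal.mem_map_of_mem _ ha
  have h4 : (MatPairs.toAffine l Y s).app U (fres (le_top : U ≤ ⊤) a) = 0 := h2 h3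
  rw [map_zero, ← h4, fres_apply, fres_apply]
  exact (ConcreteCategory.congr_hom
    ((MatPairs.toAffine l Y s).naturality (homOfLE (le_top : U ≤ ⊤)).op) a).symm

/-- This is the condition for lifting a morphism through the closed immersion of the matrix
equations. -/
theorem ker_le {h : T ⟶ 𝔸(PairIdx.{u} l; Y)} (H : ∀ a ∈ pairIdeal l Y s, h.appTop a = 0) :
    (MatPairs.toAffine l Y s).ker ≤ h.ker := by
  have : (MatPairs.toAffine l Y s).ker = Scheme.IdealSheafData.ofIdealTop (pairIdeal l Y s) :=
    Scheme.IdealSheafData.ker_subschemeι _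
  rw [this]
  refine Scheme.IdealSheafData.le_ofIdeals_iff.mpr fun U => ?_
  refine Ideal.map_le_iff_le_comap.mpr fun a ha => ?_
  have h1 := ConcreteCategory.congr_hom (h.naturality (homOfLE (le_top : U.1 ≤ ⊤)).op) a
  refine h1.trans ?_
  have h2 : h.app ⊤ a = 0 := H a ha
  exact (congrArg _ h2).trans (map_zero
    (T.presheaf.map ((TopologicalSpace.Opens.map h.base).map (homOfLE _).op.unop).op).hom)

variable (m l Y s) in
/-- The affine coordinates on the local model. -/
def affineCoord (i : Fin m) : Γ(LocalModel m l Y s, ⊤) :=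
  (pullback.fst (𝔸(ULift.{u} (Fin m); Y) ↘ Y) (MatPairs.toBase l Y s)).appTop
    (AffineSpace.coord Y ⟨i⟩)

variable (m l Y s) in
/-- The projection of the local model to the affine space of pairs of matrices. -/
def toPairs : LocalModel m l Y s ⟶ 𝔸(PairIdx.{u} l; Y) :=
  pullback.snd (𝔸(ULift.{u} (Fin m); Y) ↘ Y) (MatPairs.toBase l Y s) ≫ MatPairs.toAffine l Y s

variable (m l Y s) in
/-- The first matrix on the local model. -/
def matM : Matrix (Fin l) (Fin l) Γ(LocalModel m l Y s, ⊤) :=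
  (univM l Y).map (toPairs m l Y s).appTop

variable (m l Y s) in
/-- The second matrix on the local model. -/
def matN : Matrix (Fin l) (Fin l) Γ(LocalModel m l Y s, ⊤) :=
  (univN l Y).map (toPairs m l Y s).appTop

theorem toPairs_over : toPairs m l Y s ≫ 𝔸(PairIdx.{u} l; Y) ↘ Y = toBase m l Y s :=
  Category.assoc _ _ _

theorem appTop_affineCoord (h : T ⟶ LocalModel m l Y s) (i : Fin m) :
    h.appTop (affineCoord m l Y s i) =
      (h ≫ pullback.fst _ _).appTop (AffineSpace.coord Y ⟨i⟩) := by
  rw [Scheme.Hom.comp_appTop]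
  rfl

theorem map_matM_apply (h : T ⟶ LocalModel m l Y s) (i j : Fin l) :
    (matM m l Y s).map h.appTop i j =
      (h ≫ pullback.snd _ _ ≫ MatPairs.toAffine l Y s).appTop
        (AffineSpace.coord Y ⟨Sum.inl (i, j)⟩) := by
  rw [Scheme.Hom.comp_appTop]
  rfl

theorem map_matN_apply (h : T ⟶ LocalModel m l Y s) (i j : Fin l) :
    (matN m l Y s).map h.appTop i j =
      (h ≫ pullback.snd _ _ ≫ MatPairs.toAffine l Y s).appTop
        (AffineSpace.coord Y ⟨Sum.inr (i, j)⟩) := by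
  rw [Scheme.Hom.comp_appTop]
  rfl

theorem toPairs_appTop_eq_zero {a : Γ(𝔸(PairIdx.{u} l; Y), ⊤)} (ha : a ∈ pairIdeal l Y s) :
    (toPairs m l Y s).appTop a = 0 := by
  rw [toPairs, Scheme.Hom.comp_appTop, CommRingCat.comp_apply, toAffine_appTop_eq_zero ha, map_zero]

theorem map_scalarMat (h : T ⟶ 𝔸(PairIdx.{u} l; Y)) : (scalarMat l Y s).map h.appTop =
    Matrix.scalar (Fin l) ((h ≫ 𝔸(PairIdx.{u} l; Y) ↘ Y).appTop s) := by
  ext i j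
  rw [Scheme.Hom.comp_appTop, CommRingCat.comp_apply, scalarMat]
  by_cases hij : i = j
  · subst hij; simp
  · simp [hij]

theorem matM_mul_matN :
    matM m l Y s * matN m l Y s = Matrix.scalar (Fin l) ((toBase m l Y s).appTop s) := by
  rw [← toPairs_over, ← map_scalarMat, matM, matN]
  have h1 := Matrix.map_mul (L := univM l Y) (M := univN l Y) (f := (toPairs m l Y s).appTop.hom)
  refine h1.symm.trans ?_
  ext i j
  refine sub_eq_zero.mp ((map_sub (toPairs m l Y s).appTop.hom _ _).symm.trans ?_)
  exact toPairs_appTop_eq_zero (Ideal.subset_span (Or.inl ⟨(i, j), rfl⟩))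

theorem matN_mul_matM :
    matN m l Y s * matM m l Y s = Matrix.scalar (Fin l) ((toBase m l Y s).appTop s) := by
  rw [← toPairs_over, ← map_scalarMat, matM, matN]
  have h1 := Matrix.map_mul (L := univN l Y) (M := univM l Y) (f := (toPairs m l Y s).appTop.hom)
  refine h1.symm.trans ?_
  ext i j
  refine sub_eq_zero.mp ((map_sub (toPairs m l Y s).appTop.hom _ _).symm.trans ?_)
  exact toPairs_appTop_eq_zero (Ideal.subset_span (Or.inr ⟨(i, j), rfl⟩))

theorem hom_ext {h h' : T ⟶ LocalModel m l Y s} (hb : h ≫ toBase m l Y s = h' ≫ toBase m l Y s)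
    (hc : ∀ i, h.appTop (affineCoord m l Y s i) = h'.appTop (affineCoord m l Y s i))
    (hM : (matM m l Y s).map h.appTop = (matM m l Y s).map h'.appTop)
    (hN : (matN m l Y s).map h.appTop = (matN m l Y s).map h'.appTop) : h = h' := by
  have h2 : h ≫ pullback.snd _ _ ≫ MatPairs.toAffine l Y s =
      h' ≫ pullback.snd _ _ ≫ MatPairs.toAffine l Y s := by
    refine AffineSpace.hom_ext ?_ ?_
    · rw [Category.assoc, Category.assoc, Category.assoc, Category.assoc]
      exact hb
    · rintro ⟨(⟨i, j⟩ | ⟨i, j⟩)⟩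
      · rw [← map_matM_apply, ← map_matM_apply, hM]
      · rw [← map_matN_apply, ← map_matN_apply, hN]
  have : IsClosedImmersion (MatPairs.toAffine l Y s) :=
    inferInstanceAs (IsClosedImmersion (Scheme.IdealSheafData.subschemeι _))
  refine pullback.hom_ext ?_ ?_
  · refine AffineSpace.hom_ext ?_ ?_
    · rw [Category.assoc, Category.assoc, pullback.condition]
      exact hb
    · rintro ⟨i⟩
      rw [← appTop_affineCoord, ← appTop_affineCoord, hc]
  · rw [← cancel_mono (MatPairs.toAffine l Y s), Category.assoc, Category.assoc, h2]

/-- With `hom_ext` this computes the `T`-valued points of the model: a morphism to the base, `m`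
functions, and two matrices whose products in both orders are `s`. -/
theorem exists_hom (q : T ⟶ Y) (c : Fin m → Γ(T, ⊤)) (M N : Matrix (Fin l) (Fin l) Γ(T, ⊤))
    (hMN : M * N = Matrix.scalar (Fin l) (q.appTop s))
    (hNM : N * M = Matrix.scalar (Fin l) (q.appTop s)) :
    ∃ h : T ⟶ LocalModel m l Y s, h ≫ toBase m l Y s = q ∧
      (∀ i, h.appTop (affineCoord m l Y s i) = c i) ∧
      (matM m l Y s).map h.appTop = M ∧ (matN m l Y s).map h.appTop = N := by
  have : IsClosedImmersion (MatPairs.toAffine l Y s) :=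
    inferInstanceAs (IsClosedImmersion (Scheme.IdealSheafData.subschemeι _))
  let h₁ : T ⟶ 𝔸(PairIdx.{u} l; Y) := AffineSpace.homOfVector q fun i =>
    Sum.elim (fun ij : Fin l × Fin l => M ij.1 ij.2) (fun ij => N ij.1 ij.2) i.down
  have hM : (univM l Y).map h₁.appTop = M := by
    ext i j
    exact AffineSpace.homOfVector_appTop_coord _ _ _
  have hN : (univN l Y).map h₁.appTop = N := by
    ext i j
    exact AffineSpace.homOfVector_appTop_coord _ _ _
  have hs : (scalarMat l Y s).map h₁.appTop = Matrix.scalar (Fin l) (q.appTop s) := by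
    rw [map_scalarMat]
    congr 4
    exact AffineSpace.homOfVector_over _ _
  have hker : pairIdeal l Y s ≤ RingHom.ker h₁.appTop.hom := by
    refine Ideal.span_le.mpr ?_
    rintro _ (⟨⟨i, j⟩, rfl⟩ | ⟨⟨i, j⟩, rfl⟩)
    · refine (map_sub h₁.appTop.hom _ _).trans (sub_eq_zero.mpr ?_)
      have h1 := Matrix.map_mul (L := univM l Y) (M := univN l Y) (f := h₁.appTop.hom)
      have h2 : ((univM l Y).map h₁.appTop.hom) * ((univN l Y).map h₁.appTop.hom) = _ :=
        (congrArg₂ (· * ·) hM hN).trans (hMN.trans hs.symm)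
      exact congrFun (congrFun (h1.trans h2) i) j
    · refine (map_sub h₁.appTop.hom _ _).trans (sub_eq_zero.mpr ?_)
      have h1 := Matrix.map_mul (L := univN l Y) (M := univM l Y) (f := h₁.appTop.hom)
      have h2 : ((univN l Y).map h₁.appTop.hom) * ((univM l Y).map h₁.appTop.hom) = _ :=
        (congrArg₂ (· * ·) hN hM).trans (hNM.trans hs.symm)
      exact congrFun (congrFun (h1.trans h2) i) j
  let h₂ : T ⟶ MatPairs l Y s :=
    IsClosedImmersion.lift (MatPairs.toAffine l Y s) h₁ (ker_le fun a ha => hker ha)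
  have hh : h₂ ≫ MatPairs.toAffine l Y s = h₁ := IsClosedImmersion.lift_fac _ _ _
  have hb : h₂ ≫ MatPairs.toBase l Y s = q := by
    rw [MatPairs.toBase, reassoc_of% hh]
    exact AffineSpace.homOfVector_over _ _
  let h₀ : T ⟶ 𝔸(ULift.{u} (Fin m); Y) := AffineSpace.homOfVector q fun i => c i.down
  have h₀b : h₀ ≫ 𝔸(ULift.{u} (Fin m); Y) ↘ Y = q := AffineSpace.homOfVector_over _ _
  let h : T ⟶ LocalModel m l Y s := pullback.lift h₀ h₂ (h₀b.trans hb.symm)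
  have hp : h ≫ toPairs m l Y s = h₁ := by
    rw [toPairs, pullback.lift_snd_assoc, hh]
  refine ⟨h, ?_, fun i => ?_, ?_, ?_⟩
  · rw [toBase, pullback.lift_snd_assoc, hb]
  · rw [affineCoord, ← CommRingCat.comp_apply, ← Scheme.Hom.comp_appTop, pullback.lift_fst]
    exact AffineSpace.homOfVector_appTop_coord _ _ _
  · rw [← hM, ← hp]
    ext i j
    simp only [matM, Matrix.map_apply, Scheme.Hom.comp_appTop, CommRingCat.comp_apply]
  · rw [← hN, ← hp]
    ext i j
    simp only [matN, Matrix.map_apply, Scheme.Hom.comp_appTop, CommRingCat.comp_apply]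

/-- The structure morphism has a section over any base, for instance with zero affine coordinates
and the pair `M = 1`, `N = s`. Hence the image of a chart is the whole open set over which its
frames are given. -/
theorem toBase_surjective : Function.Surjective (toBase m l Y s) := by
  obtain ⟨h, hh, -⟩ := exists_hom (m := m) (l := l) (s := s) (𝟙 Y) 0 1
    (Matrix.scalar (Fin l) ((𝟙 Y : Y ⟶ Y).appTop s)) (by simp) (by simp)
  intro y
  refine ⟨h y, ?_⟩
  rw [← Scheme.Hom.comp_apply, hh]
  rfl

theorem affineCoordsVanish_iff (y : T ⟶ LocalModel m l Y s) :
    AffineCoordsVanish y ↔ ∀ i, y.appTop (affineCoord m l Y s i) = 0 := by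
  simp only [appTop_affineCoord]
  exact ⟨fun h i => h ⟨i⟩, fun h i => h i.down⟩

theorem matrixCoordsVanish_iff (y : T ⟶ LocalModel m l Y s) :
    MatrixCoordsVanish y ↔
      (matM m l Y s).map y.appTop = 0 ∧ (matN m l Y s).map y.appTop = 0 := by
  simp only [← Matrix.ext_iff, map_matM_apply, map_matN_apply]
  constructor
  · intro h
    exact ⟨fun i j => h ⟨Sum.inl (i, j)⟩, fun i j => h ⟨Sum.inr (i, j)⟩⟩
  · rintro ⟨hM, hN⟩ ⟨(⟨i, j⟩ | ⟨i, j⟩)⟩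
    · exact hM i j
    · exact hN i j

end LocalModel

/-! ### Linked pairs of graphs over a ring -/

section algebra

set_option linter.unusedSectionVars false

open Matrix

variable {R R' : Type*} [CommRing R] [CommRing R'] {I J L K K' : Type}
  [Fintype I] [Fintype J] [Fintype L] [Fintype K] [Fintype K'] [DecidableEq L]

/-- A vector with three blocks. -/
def vec₃ {α : Type*} {A B C : Type*} (x : A → α) (y : B → α) (z : C → α) : A ⊕ B ⊕ C → α :=
  Sum.elim x (Sum.elim y z)

theorem exists_vec₃ {α : Type*} {A B C : Type*} (v : A ⊕ B ⊕ C → α) : ∃ x y z, v = vec₃ x y z :=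
  ⟨_, _, _, by rw [vec₃, Sum.elim_comp_inl_inr, Sum.elim_comp_inl_inr]⟩

theorem vec₃_inj {α : Type*} {A B C : Type*} {x x' : A → α} {y y' : B → α} {z z' : C → α} :
    vec₃ x y z = vec₃ x' y' z' ↔ x = x' ∧ y = y' ∧ z = z' := by
  constructor
  · intro h
    exact ⟨funext fun i => congrFun h (Sum.inl i), funext fun i => congrFun h (Sum.inr (Sum.inl i)),
      funext fun i => congrFun h (Sum.inr (Sum.inr i))⟩
  · rintro ⟨rfl, rfl, rfl⟩
    rfl

/-- A matrix with nine blocks. -/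
def block₃ {α : Type*} {A B C A' B' C' : Type*} (M₁₁ : Matrix A A' α) (M₁₂ : Matrix A B' α)
    (M₁₃ : Matrix A C' α) (M₂₁ : Matrix B A' α) (M₂₂ : Matrix B B' α) (M₂₃ : Matrix B C' α)
    (M₃₁ : Matrix C A' α) (M₃₂ : Matrix C B' α) (M₃₃ : Matrix C C' α) :
    Matrix (A ⊕ B ⊕ C) (A' ⊕ B' ⊕ C') α :=
  vec₃ (fun i => vec₃ (M₁₁ i) (M₁₂ i) (M₁₃ i)) (fun i => vec₃ (M₂₁ i) (M₂₂ i) (M₂₃ i))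
    (fun i => vec₃ (M₃₁ i) (M₃₂ i) (M₃₃ i))

theorem exists_block₃ {α : Type*} {A B C A' B' C' : Type*}
    (M : Matrix (A ⊕ B ⊕ C) (A' ⊕ B' ⊕ C') α) : ∃ M₁₁ M₁₂ M₁₃ M₂₁ M₂₂ M₂₃ M₃₁ M₃₂ M₃₃,
      M = block₃ M₁₁ M₁₂ M₁₃ M₂₁ M₂₂ M₂₃ M₃₁ M₃₂ M₃₃ := by
  refine ⟨fun i j => M (.inl i) (.inl j), fun i j => M (.inl i) (.inr (.inl j)),
    fun i j => M (.inl i) (.inr (.inr j)), fun i j => M (.inr (.inl i)) (.inl j),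
    fun i j => M (.inr (.inl i)) (.inr (.inl j)), fun i j => M (.inr (.inl i)) (.inr (.inr j)),
    fun i j => M (.inr (.inr i)) (.inl j), fun i j => M (.inr (.inr i)) (.inr (.inl j)),
    fun i j => M (.inr (.inr i)) (.inr (.inr j)), ?_⟩
  ext (i | i | i) (j | j | j) <;> rfl

theorem vec₃_dotProduct {A B C : Type*} [Fintype A] [Fintype B] [Fintype C] (x x' : A → R)
    (y y' : B → R) (z z' : C → R) :
    vec₃ x y z ⬝ᵥ vec₃ x' y' z' = x ⬝ᵥ x' + y ⬝ᵥ y' + z ⬝ᵥ z' := by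
  simp [vec₃, dotProduct, add_assoc]

theorem block₃_mulVec {A B C A' B' C' : Type*} [Fintype A'] [Fintype B'] [Fintype C']
    (M₁₁ : Matrix A A' R) (M₁₂ : Matrix A B' R)
    (M₁₃ : Matrix A C' R) (M₂₁ : Matrix B A' R) (M₂₂ : Matrix B B' R) (M₂₃ : Matrix B C' R)
    (M₃₁ : Matrix C A' R) (M₃₂ : Matrix C B' R) (M₃₃ : Matrix C C' R) (x : A' → R) (y : B' → R)
    (z : C' → R) : block₃ M₁₁ M₁₂ M₁₃ M₂₁ M₂₂ M₂₃ M₃₁ M₃₂ M₃₃ *ᵥ vec₃ x y z =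
      vec₃ (M₁₁ *ᵥ x + M₁₂ *ᵥ y + M₁₃ *ᵥ z) (M₂₁ *ᵥ x + M₂₂ *ᵥ y + M₂₃ *ᵥ z)
        (M₃₁ *ᵥ x + M₃₂ *ᵥ y + M₃₃ *ᵥ z) := by
  ext (i | i | i) <;> exact vec₃_dotProduct _ _ _ _ _ _

/-- The vector `x` lies in the graph of the linear map with matrix `a`. -/
def InGraph {ι κ : Type*} [Fintype ι] (a : Matrix κ ι R) (x : ι ⊕ κ → R) : Prop :=
  ∀ j, x (Sum.inr j) = ∑ i, a j i * x (Sum.inl i)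

theorem inGraph_iff {ι κ : Type*} [Fintype ι] (a : Matrix κ ι R) (x : ι → R) (y : κ → R) :
    InGraph a (Sum.elim x y) ↔ y = a *ᵥ x := by
  rw [funext_iff]
  rfl

/-- The linear map from the first to the second vector space, in coordinates. -/
def mapF (s : R) (x : (I ⊕ J ⊕ L) ⊕ (L ⊕ K ⊕ K') → R) : (I ⊕ L ⊕ J) ⊕ (L ⊕ K ⊕ K') → R :=
  Sum.elim (vec₃ (fun i => x (.inl (.inl i))) (fun i => x (.inr (.inl i)))
      (fun i => s * x (.inl (.inr (.inl i)))))
    (vec₃ (fun i => s * x (.inl (.inr (.inr i)))) (fun i => x (.inr (.inr (.inl i))))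
      (fun i => s * x (.inr (.inr (.inr i)))))

/-- The linear map from the second to the first vector space, in coordinates. -/
def mapG (s : R) (y : (I ⊕ L ⊕ J) ⊕ (L ⊕ K ⊕ K') → R) : (I ⊕ J ⊕ L) ⊕ (L ⊕ K ⊕ K') → R :=
  Sum.elim (vec₃ (fun i => s * y (.inl (.inl i))) (fun i => y (.inl (.inr (.inr i))))
      (fun i => y (.inr (.inl i))))
    (vec₃ (fun i => s * y (.inl (.inr (.inl i)))) (fun i => s * y (.inr (.inr (.inl i))))
      (fun i => y (.inr (.inr (.inr i)))))

/-- Here `I`, `K` and one copy of `L` form the part `A`, where `f` is `1` and `g` is `s`; `J`, `K'`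
and the other copy of `L` form `B`, where the roles are exchanged. Coordinates in `I`, `J` are free
and those in `K`, `K'` dependent for both graphs. The copy of `L` in `A` (`xL`) is dependent for the
first graph and free for the second, the copy in `B` (`xL'`) the opposite, so the two change places.
-/
theorem mapF_vec (s : R) (xI : I → R) (xJ : J → R) (xL xL' : L → R) (xK : K → R) (xK' : K' → R) :
    mapF s (Sum.elim (vec₃ xI xJ xL') (vec₃ xL xK xK')) =
      Sum.elim (vec₃ xI xL (s • xJ)) (vec₃ (s • xL') xK (s • xK')) := rfl

theorem mapG_vec (s : R) (xI : I → R) (xJ : J → R) (xL xL' : L → R) (xK : K → R) (xK' : K' → R) :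
    mapG s (Sum.elim (vec₃ xI xL xJ) (vec₃ xL' xK xK')) =
      Sum.elim (vec₃ (s • xI) xJ xL') (vec₃ (s • xL) (s • xK) xK') := rfl

/-- The index type of the free parameters of a linked pair of graphs. -/
abbrev ParamIdx (I J L K K' : Type) : Type :=
  ((L × I) ⊕ (L × J)) ⊕ (((K × I) ⊕ (K × L) ⊕ (K × J)) ⊕ ((K' × I) ⊕ (K' × J) ⊕ (K' × L)))

/-- The matrix of the first graph of a linked pair. -/
def graphA (s : R) (c : ParamIdx I J L K K' → R) (M : Matrix L L R) :
    Matrix (L ⊕ K ⊕ K') (I ⊕ J ⊕ L) R :=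
  let PI : Matrix L I R := .of fun i j => c (.inl (.inl (i, j)))
  let PJ : Matrix L J R := .of fun i j => c (.inl (.inr (i, j)))
  let QI : Matrix K I R := .of fun i j => c (.inr (.inl (.inl (i, j))))
  let QL : Matrix K L R := .of fun i j => c (.inr (.inl (.inr (.inl (i, j)))))
  let QJ : Matrix K J R := .of fun i j => c (.inr (.inl (.inr (.inr (i, j)))))
  block₃ PI (-(M * PJ)) M (QI + QL * PI) (s • QJ - QL * M * PJ) (QL * M)
    (.of fun i j => c (.inr (.inr (.inl (i, j))))) (.of fun i j => c (.inr (.inr (.inr (.inl (i, j))))))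
    (.of fun i j => c (.inr (.inr (.inr (.inr (i, j))))))

/-- The matrix of the second graph of a linked pair. -/
def graphB (s : R) (c : ParamIdx I J L K K' → R) (N : Matrix L L R) :
    Matrix (L ⊕ K ⊕ K') (I ⊕ L ⊕ J) R :=
  let PI : Matrix L I R := .of fun i j => c (.inl (.inl (i, j)))
  let PJ : Matrix L J R := .of fun i j => c (.inl (.inr (i, j)))
  let RI : Matrix K' I R := .of fun i j => c (.inr (.inr (.inl (i, j))))
  let RJ : Matrix K' J R := .of fun i j => c (.inr (.inr (.inr (.inl (i, j)))))
  let RL : Matrix K' L R := .of fun i j => c (.inr (.inr (.inr (.inr (i, j)))))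
  block₃ (-(N * PI)) N PJ
    (.of fun i j => c (.inr (.inl (.inl (i, j))))) (.of fun i j => c (.inr (.inl (.inr (.inl (i, j))))))
    (.of fun i j => c (.inr (.inl (.inr (.inr (i, j))))))
    (s • RI - RL * N * PI) (RL * N) (RJ + RL * PJ)

theorem block₃_map {α β : Type*} {A B C A' B' C' : Type*} (M₁₁ : Matrix A A' α) (M₁₂ : Matrix A B' α)
    (M₁₃ : Matrix A C' α) (M₂₁ : Matrix B A' α) (M₂₂ : Matrix B B' α) (M₂₃ : Matrix B C' α)
    (M₃₁ : Matrix C A' α) (M₃₂ : Matrix C B' α) (M₃₃ : Matrix C C' α) (φ : α → β) :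
    (block₃ M₁₁ M₁₂ M₁₃ M₂₁ M₂₂ M₂₃ M₃₁ M₃₂ M₃₃).map φ =
      block₃ (M₁₁.map φ) (M₁₂.map φ) (M₁₃.map φ) (M₂₁.map φ) (M₂₂.map φ) (M₂₃.map φ)
        (M₃₁.map φ) (M₃₂.map φ) (M₃₃.map φ) := by
  ext (i | i | i) (j | j | j) <;> rfl

theorem map_graphA (φ : R →+* R') (s : R) (c : ParamIdx I J L K K' → R) (M : Matrix L L R) :
    (graphA s c M).map φ = graphA (φ s) (fun i => φ (c i)) (M.map φ) := by
  rw [graphA, block₃_map, graphA]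
  congr 1 <;> ext i j <;> simp [Matrix.mul_apply, Finset.sum_mul]

theorem map_graphB (φ : R →+* R') (s : R) (c : ParamIdx I J L K K' → R) (N : Matrix L L R) :
    (graphB s c N).map φ = graphB (φ s) (fun i => φ (c i)) (N.map φ) := by
  rw [graphB, block₃_map, graphB]
  congr 1 <;> ext i j <;> simp [Matrix.mul_apply, Finset.sum_mul]

/-- The matrices `M`, `N` and all free parameters occur unmodified as entries of one of the two
graph matrices. -/
theorem graph_params_inj {s : R} {c c' : ParamIdx I J L K K' → R} {M M' N N' : Matrix L L R}
    (hA : graphA s c M = graphA s c' M') (hB : graphB s c N = graphB s c' N') :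
    c = c' ∧ M = M' ∧ N = N' := by
  refine ⟨?_, ?_, ?_⟩
  · ext ((⟨i, j⟩ | ⟨i, j⟩) | ((⟨i, j⟩ | ⟨i, j⟩ | ⟨i, j⟩) | (⟨i, j⟩ | ⟨i, j⟩ | ⟨i, j⟩)))
    · exact congrFun (congrFun hA (.inl i)) (.inl j)
    · exact congrFun (congrFun hB (.inl i)) (.inr (.inr j))
    · exact congrFun (congrFun hB (.inr (.inl i))) (.inl j)
    · exact congrFun (congrFun hB (.inr (.inl i))) (.inr (.inl j))
    · exact congrFun (congrFun hB (.inr (.inl i))) (.inr (.inr j))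
    · exact congrFun (congrFun hA (.inr (.inr i))) (.inl j)
    · exact congrFun (congrFun hA (.inr (.inr i))) (.inr (.inl j))
    · exact congrFun (congrFun hA (.inr (.inr i))) (.inr (.inr j))
  · ext i j
    exact congrFun (congrFun hA (.inl i)) (.inr (.inr j))
  · ext i j
    exact congrFun (congrFun hB (.inl i)) (.inr (.inl j))

theorem scalar_mulVec (s : R) (x : L → R) : Matrix.scalar L s *ᵥ x = s • x := by
  ext i
  simp [Matrix.mulVec_diagonal]

/-- Substituting the first block row of the graph equation into the remaining ones leaves only
products `N * M`, which are replaced by `s`; the other terms cancel. -/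
theorem inGraph_mapF {s : R} {c : ParamIdx I J L K K' → R} {M N : Matrix L L R}
    (hNM : N * M = Matrix.scalar L s) {x : (I ⊕ J ⊕ L) ⊕ (L ⊕ K ⊕ K') → R}
    (hx : InGraph (graphA s c M) x) : InGraph (graphB s c N) (mapF s x) := by
  obtain ⟨x₁, x₂, rfl⟩ : ∃ x₁ x₂, x = Sum.elim x₁ x₂ := ⟨_, _, (Sum.elim_comp_inl_inr x).symm⟩
  obtain ⟨xI, xJ, xL', rfl⟩ := exists_vec₃ x₁
  obtain ⟨xL, xK, xK', rfl⟩ := exists_vec₃ x₂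
  have hN : ∀ z : L → R, N *ᵥ M *ᵥ z = s • z := by
    intro z; rw [mulVec_mulVec, hNM, scalar_mulVec]
  rw [mapF_vec, inGraph_iff, graphB, block₃_mulVec, vec₃_inj]
  rw [inGraph_iff, graphA, block₃_mulVec, vec₃_inj] at hx
  obtain ⟨h1, h2, h3⟩ := hx
  simp only [add_mulVec, sub_mulVec, neg_mulVec, ← mulVec_mulVec, smul_mulVec, mulVec_add,
    mulVec_smul, mulVec_neg] at h1 h2 h3 ⊢
  refine ⟨?_, ?_, ?_⟩
  · rw [h1]
    simp only [mulVec_add, mulVec_neg, hN]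
    module
  · rw [h2, h1]
    simp only [mulVec_add, mulVec_neg, hN]
    module
  · rw [h3, h1]
    simp only [mulVec_add, mulVec_neg, hN, mulVec_smul]
    module

theorem inGraph_mapG {s : R} {c : ParamIdx I J L K K' → R} {M N : Matrix L L R}
    (hMN : M * N = Matrix.scalar L s) {y : (I ⊕ L ⊕ J) ⊕ (L ⊕ K ⊕ K') → R}
    (hy : InGraph (graphB s c N) y) : InGraph (graphA s c M) (mapG s y) := by
  obtain ⟨x₁, x₂, rfl⟩ : ∃ x₁ x₂, y = Sum.elim x₁ x₂ := ⟨_, _, (Sum.elim_comp_inl_inr y).symm⟩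
  obtain ⟨xI, xL, xJ, rfl⟩ := exists_vec₃ x₁
  obtain ⟨xL', xK, xK', rfl⟩ := exists_vec₃ x₂
  have hM : ∀ z : L → R, M *ᵥ N *ᵥ z = s • z := by
    intro z; rw [mulVec_mulVec, hMN, scalar_mulVec]
  rw [mapG_vec, inGraph_iff, graphA, block₃_mulVec, vec₃_inj]
  rw [inGraph_iff, graphB, block₃_mulVec, vec₃_inj] at hy
  obtain ⟨h1, h2, h3⟩ := hy
  simp only [add_mulVec, sub_mulVec, neg_mulVec, ← mulVec_mulVec, smul_mulVec, mulVec_add,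
    mulVec_smul, mulVec_neg] at h1 h2 h3 ⊢
  refine ⟨?_, ?_, ?_⟩
  · rw [h1]
    simp only [mulVec_add, mulVec_neg, hM]
    module
  · rw [h2, h1]
    simp only [mulVec_add, mulVec_neg, hM, mulVec_smul]
    module
  · rw [h3, h1]
    simp only [mulVec_add, mulVec_neg, hM]
    module

/-- Evaluating the linking conditions on vectors supported in a single free block gives one matrix
identity each. The rows in `L` give `NM = MN = s` and two dependent blocks; the rows in `K` for `f`
and in `K'` for `g` express the remaining dependent blocks. The other conditions are not needed
here, since `inGraph_mapF` and `inGraph_mapG` show that they follow. -/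
theorem exists_params {s : R} {a : Matrix (L ⊕ K ⊕ K') (I ⊕ J ⊕ L) R}
    {b : Matrix (L ⊕ K ⊕ K') (I ⊕ L ⊕ J) R} (hF : ∀ x, InGraph a x → InGraph b (mapF s x))
    (hG : ∀ y, InGraph b y → InGraph a (mapG s y)) :
    ∃ (c : ParamIdx I J L K K' → R) (M N : Matrix L L R), M * N = Matrix.scalar L s ∧
      N * M = Matrix.scalar L s ∧ a = graphA s c M ∧ b = graphB s c N := by
  obtain ⟨PI, PJ, M, A₁, A₂, A₃, RI, RJ, RL, rfl⟩ := exists_block₃ a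
  obtain ⟨PI', N, PJ', QI, QL, QJ, B₁, B₂, B₃, rfl⟩ := exists_block₃ b
  have hF' : ∀ xI xJ xL', _ := fun xI xJ xL' => hF (Sum.elim (vec₃ xI xJ xL') _)
    ((inGraph_iff _ _ _).mpr (block₃_mulVec ..).symm)
  have hG' : ∀ xI xL xJ, _ := fun xI xL xJ => hG (Sum.elim (vec₃ xI xL xJ) _)
    ((inGraph_iff _ _ _).mpr (block₃_mulVec ..).symm)
  simp only [mapF_vec, mapG_vec, inGraph_iff, block₃_mulVec, vec₃_inj] at hF' hG'
  have ext : ∀ {A B : Type} [Fintype A] [Fintype B] {P Q : Matrix A B R},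
      (∀ x, P *ᵥ x = Q *ᵥ x) → P = Q := fun h => Matrix.mulVec_injective (funext h)
  have hNM : N * M = Matrix.scalar L s := ext fun x => by
    have := (hF' 0 0 x).1
    simp only [mulVec_zero, zero_add, smul_zero, add_zero] at this
    rw [← mulVec_mulVec, ← this, scalar_mulVec]
  have hMN : M * N = Matrix.scalar L s := ext fun x => by
    have := (hG' 0 x 0).1
    simp only [mulVec_zero, zero_add, smul_zero, add_zero] at this
    rw [← mulVec_mulVec, ← this, scalar_mulVec]
  have hPI' : PI' = -(N * PI) := ext fun x => by
    have := (hF' x 0 0).1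
    simp only [mulVec_zero, smul_zero, add_zero] at this
    rw [neg_mulVec, ← mulVec_mulVec]
    exact eq_neg_of_add_eq_zero_left this.symm
  have hPJ : PJ = -(M * PJ') := ext fun x => by
    have := (hG' 0 0 x).1
    simp only [mulVec_zero, smul_zero, add_zero, zero_add] at this
    rw [neg_mulVec, ← mulVec_mulVec]
    exact eq_neg_of_add_eq_zero_left this.symm
  have hA₁ : A₁ = QI + QL * PI := ext fun x => by
    have := (hF' x 0 0).2.1
    simp only [mulVec_zero, smul_zero, add_zero, zero_add] at this
    rw [this, add_mulVec, ← mulVec_mulVec]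
  have hA₂ : A₂ = s • QJ - QL * M * PJ' := ext fun x => by
    have := (hF' 0 x 0).2.1
    simp only [mulVec_zero, smul_zero, add_zero, zero_add] at this
    rw [this, hPJ, sub_mulVec, ← mulVec_mulVec, ← mulVec_mulVec, neg_mulVec, mulVec_neg,
      mulVec_smul, smul_mulVec, ← mulVec_mulVec]
    module
  have hA₃ : A₃ = QL * M := ext fun x => by
    have := (hF' 0 0 x).2.1
    simp only [mulVec_zero, smul_zero, add_zero, zero_add] at this
    rw [this, ← mulVec_mulVec]
  have hB₁ : B₁ = s • RI - RL * N * PI := ext fun x => by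
    have := (hG' x 0 0).2.2
    simp only [mulVec_zero, smul_zero, add_zero, zero_add] at this
    rw [this, hPI', sub_mulVec, ← mulVec_mulVec, ← mulVec_mulVec, neg_mulVec, mulVec_neg,
      mulVec_smul, smul_mulVec, ← mulVec_mulVec]
    module
  have hB₂ : B₂ = RL * N := ext fun x => by
    have := (hG' 0 x 0).2.2
    simp only [mulVec_zero, smul_zero, add_zero, zero_add] at this
    rw [this, ← mulVec_mulVec]
  have hB₃ : B₃ = RJ + RL * PJ' := ext fun x => by
    have := (hG' 0 0 x).2.2
    simp only [mulVec_zero, smul_zero, add_zero, zero_add] at this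
    rw [this, add_mulVec, ← mulVec_mulVec]
  refine ⟨Sum.elim (Sum.elim (fun i => PI i.1 i.2) (fun i => PJ' i.1 i.2))
    (Sum.elim (vec₃ (fun i => QI i.1 i.2) (fun i => QL i.1 i.2) (fun i => QJ i.1 i.2))
      (vec₃ (fun i => RI i.1 i.2) (fun i => RJ i.1 i.2) (fun i => RL i.1 i.2))),
    M, N, hMN, hNM, ?_, ?_⟩
  · rw [hPJ, hA₁, hA₂, hA₃]
    rfl
  · rw [hPI', hB₁, hB₂, hB₃]
    rfl

end algebra

/-! ### The charts of the linked Grassmannian -/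

section mapFG

variable {R R' : Type*} [CommRing R] [CommRing R'] {I J L K K' : Type}

theorem mapF_sum {κ : Type*} (t : Finset κ) (s : R) (a : κ → R)
    (x : κ → (I ⊕ J ⊕ L) ⊕ (L ⊕ K ⊕ K') → R) :
    mapF s (∑ i ∈ t, a i • x i) = ∑ i ∈ t, a i • mapF s (x i) := by
  ext ((i | i | i) | (i | i | i)) <;>
    simp [mapF, vec₃, Finset.sum_apply, Finset.mul_sum, mul_left_comm]

theorem mapG_sum {κ : Type*} (t : Finset κ) (s : R) (a : κ → R)
    (x : κ → (I ⊕ L ⊕ J) ⊕ (L ⊕ K ⊕ K') → R) :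
    mapG s (∑ i ∈ t, a i • x i) = ∑ i ∈ t, a i • mapG s (x i) := by
  ext ((i | i | i) | (i | i | i)) <;>
    simp [mapG, vec₃, Finset.sum_apply, Finset.mul_sum, mul_left_comm]

theorem map_mapF (φ : R →+* R') (s : R) (x : (I ⊕ J ⊕ L) ⊕ (L ⊕ K ⊕ K') → R) (i) :
    φ (mapF s x i) = mapF (φ s) (fun j => φ (x j)) i := by
  obtain ((i | i | i) | (i | i | i)) := i <;> simp [mapF, vec₃]

theorem map_mapG (φ : R →+* R') (s : R) (x : (I ⊕ L ⊕ J) ⊕ (L ⊕ K ⊕ K') → R) (i) :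
    φ (mapG s x i) = mapG (φ s) (fun j => φ (x j)) i := by
  obtain ((i | i | i) | (i | i | i)) := i <;> simp [mapG, vec₃]

end mapFG

theorem appLE_top {X Y : Scheme.{u}} (h : X ⟶ Y) (a : Γ(Y, ⊤)) :
    h.appLE ⊤ ⊤ le_top a = h.appTop a := by
  have : h.appLE ⊤ ⊤ le_top = h.appTop := by
    simp only [Scheme.Hom.appLE, Scheme.Hom.appTop]
    exact (congrArg _ (X.presheaf.map_id _)).trans (Category.comp_id _)
  rw [this]

section coord

variable {S T : Scheme.{u}} {E F : S.Modules} {U : S.Opens} {ι κ : Type}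
  [Fintype ι] [Fintype κ] [DecidableEq ι] [DecidableEq κ] {e : ι → Γ(E, U)} {e' : κ → Γ(F, U)}

theorem IsFrame.coord_bcMap (he : IsFrame E U e) (he' : IsFrame F U e') (p : T ⟶ S) (f : E ⟶ F)
    {W : T.Opens} (hW : W ≤ p ⁻¹ᵁ U) (v : Γ(bc p E, W)) :
    (he'.basePull p).coord hW ((bcMap p f).app W v) =
      ∑ i, (he.basePull p).coord hW v i •
        fun j => p.appLE U W hW (he'.coord le_rfl (f.app U (e i)) j) := by
  conv_lhs => rw [← (he.basePull p).sum_coord hW v, app_sum, map_sum]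
  refine Finset.sum_congr rfl fun i _ => ?_
  rw [app_smul, map_smul, res_basePull, bcMap_basePull]
  congr 1
  ext j
  exact he'.coord_basePull le_rfl hW (f.app U (e i)) j

end coord

/-- Adapted frames of the two bundles over an open set that define a chart of the linked
Grassmannian. -/
structure ChartData {S : Scheme.{u}} {E₁ E₂ : S.Modules} (f : E₁ ⟶ E₂) (g : E₂ ⟶ E₁)
    (s : Γ(S, ⊤)) (r : ℕ) where
  /-- the open set of the base -/
  U : S.Opens
  /-- the size of the matrices -/
  l : ℕ
  (nI nJ nK nK' : ℕ)
  /-- the frame of the first bundle -/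
  e₁ : (Fin nI ⊕ Fin nJ ⊕ Fin l) ⊕ (Fin l ⊕ Fin nK ⊕ Fin nK') → Γ(E₁, U)
  /-- the frame of the second bundle -/
  e₂ : (Fin nI ⊕ Fin l ⊕ Fin nJ) ⊕ (Fin l ⊕ Fin nK ⊕ Fin nK') → Γ(E₂, U)
  frame₁ : IsFrame E₁ U e₁
  frame₂ : IsFrame E₂ U e₂
  f_e₁ : ∀ i, frame₂.coord le_rfl (f.app U (e₁ i)) = mapF (fres le_top s) (Pi.single i 1)
  g_e₂ : ∀ i, frame₁.coord le_rfl (g.app U (e₂ i)) = mapG (fres le_top s) (Pi.single i 1)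
  card : nI + nJ + l = r
  /-- the translation of the parameters -/
  t : ParamIdx (Fin nI) (Fin nJ) (Fin l) (Fin nK) (Fin nK') → Γ(S, U)

namespace ChartData

variable {S T T' : Scheme.{u}} {p : T ⟶ S} {q : T' ⟶ S} {E₁ E₂ : S.Modules} {f : E₁ ⟶ E₂}
  {g : E₂ ⟶ E₁} {s : Γ(S, ⊤)} {r d : ℕ} (C : ChartData f g s r)

/-- The index type of the free parameters. -/
abbrev Idx : Type := ParamIdx (Fin C.nI) (Fin C.nJ) (Fin C.l) (Fin C.nK) (Fin C.nK')

/-- The number of free parameters. -/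
def m : ℕ := Fintype.card C.Idx

/-- An enumeration of the free parameters. -/
def enum : C.Idx ≃ Fin C.m := Fintype.equivFin _

theorem card₁ : Fintype.card (Fin C.nI ⊕ Fin C.nJ ⊕ Fin C.l) = r := by
  simp only [Fintype.card_sum, Fintype.card_fin, ← C.card, add_assoc]

theorem card₂ : Fintype.card (Fin C.nI ⊕ Fin C.l ⊕ Fin C.nJ) = r := by
  simp only [Fintype.card_sum, Fintype.card_fin, ← C.card]
  ring

theorem coord_f {W : T.Opens} (hW : W ≤ p ⁻¹ᵁ C.U) (v : Γ(bc p E₁, W)) :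
    (C.frame₂.basePull p).coord hW ((bcMap p f).app W v) =
      mapF (p.appLE ⊤ W le_top s) ((C.frame₁.basePull p).coord hW v) := by
  rw [C.frame₁.coord_bcMap C.frame₂]
  conv_rhs => rw [← Finset.univ_sum_single ((C.frame₁.basePull p).coord hW v)]
  have h : ∀ i, Pi.single i ((C.frame₁.basePull p).coord hW v i) =
      (C.frame₁.basePull p).coord hW v i • (Pi.single i 1 : _ → Γ(T, W)) := by
    intro i
    rw [← Pi.single_smul, smul_eq_mul, mul_one]
  simp only [h, mapF_sum]
  refine Finset.sum_congr rfl fun i _ => ?_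
  congr 1
  ext j
  rw [C.f_e₁]
  refine (map_mapF (p.appLE C.U W hW).hom _ _ j).trans ?_
  congr 1
  · exact appLE_fres p le_top hW s
  · ext k
    by_cases hk : k = i
    · subst hk
      simpa only [Pi.single_eq_same] using map_one (p.appLE C.U W hW).hom
    · simpa only [Pi.single_eq_of_ne hk] using map_zero (p.appLE C.U W hW).hom

theorem coord_g {W : T.Opens} (hW : W ≤ p ⁻¹ᵁ C.U) (v : Γ(bc p E₂, W)) :
    (C.frame₁.basePull p).coord hW ((bcMap p g).app W v) =
      mapG (p.appLE ⊤ W le_top s) ((C.frame₂.basePull p).coord hW v) := by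
  rw [C.frame₂.coord_bcMap C.frame₁]
  conv_rhs => rw [← Finset.univ_sum_single ((C.frame₂.basePull p).coord hW v)]
  have h : ∀ i, Pi.single i ((C.frame₂.basePull p).coord hW v i) =
      (C.frame₂.basePull p).coord hW v i • (Pi.single i 1 : _ → Γ(T, W)) := by
    intro i
    rw [← Pi.single_smul, smul_eq_mul, mul_one]
  simp only [h, mapG_sum]
  refine Finset.sum_congr rfl fun i _ => ?_
  congr 1
  ext j
  rw [C.g_e₂]
  refine (map_mapG (p.appLE C.U W hW).hom _ _ j).trans ?_
  congr 1
  · exact appLE_fres p le_top hW s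
  · ext k
    by_cases hk : k = i
    · subst hk
      simpa only [Pi.single_eq_same] using map_one (p.appLE C.U W hW).hom
    · simpa only [Pi.single_eq_of_ne hk] using map_zero (p.appLE C.U W hW).hom

/-- A linked pair is in the chart, with the given parameters. -/
def HasParams (V : LinkedPair p f g r) (hA : ⊤ ≤ p ⁻¹ᵁ C.U) (c : C.Idx → Γ(T, ⊤))
    (M N : Matrix (Fin C.l) (Fin C.l) Γ(T, ⊤)) : Prop :=
  V.V₁.IsGraph (C.frame₁.basePull p) hA (graphA (p.appTop s) c M) ∧
    V.V₂.IsGraph (C.frame₂.basePull p) hA (graphB (p.appTop s) c N)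

theorem exists_pair (hA : ⊤ ≤ p ⁻¹ᵁ C.U) (c : C.Idx → Γ(T, ⊤))
    {M N : Matrix (Fin C.l) (Fin C.l) Γ(T, ⊤)} (hMN : M * N = Matrix.scalar _ (p.appTop s))
    (hNM : N * M = Matrix.scalar _ (p.appTop s)) :
    ∃ V : LinkedPair p f g r, C.HasParams V hA c M N := by
  obtain ⟨V₁, h₁⟩ := exists_subbundle_isGraph (C.frame₁.basePull p) hA
    (graphA (p.appTop s) c M) C.card₁
  obtain ⟨V₂, h₂⟩ := exists_subbundle_isGraph (C.frame₂.basePull p) hA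
    (graphB (p.appTop s) c N) C.card₂
  have hs : ∀ W : T.Opens, fres (le_top : W ≤ ⊤) (p.appTop s) = p.appLE ⊤ W le_top s := fun W => by
    rw [← appLE_top]
    exact fres_appLE p le_top le_top s
  have hsc : ∀ (W : T.Opens), (Matrix.scalar (Fin C.l) (p.appTop s)).map (fres (le_top : W ≤ ⊤)) =
      Matrix.scalar (Fin C.l) (p.appLE ⊤ W le_top s) := by
    intro W
    rw [← hs]
    ext i j
    by_cases h : i = j
    · subst h; simp
    · simp [h]
  have hV₁ : ∀ (W : T.Opens) v, v ∈ V₁.carrier W ↔ InGraph (graphA (p.appLE ⊤ W le_top s)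
      (fun i => fres le_top (c i)) (M.map (fres le_top)))
        ((C.frame₁.basePull p).coord (le_top.trans hA) v) := by
    intro W v
    rw [← hs, ← map_graphA]
    exact h₁ W le_top v
  have hV₂ : ∀ (W : T.Opens) v, v ∈ V₂.carrier W ↔ InGraph (graphB (p.appLE ⊤ W le_top s)
      (fun i => fres le_top (c i)) (N.map (fres le_top)))
        ((C.frame₂.basePull p).coord (le_top.trans hA) v) := by
    intro W v
    rw [← hs, ← map_graphB]
    exact h₂ W le_top v
  refine ⟨⟨V₁, V₂, fun W v hv => ?_, fun W v hv => ?_⟩, h₁, h₂⟩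
  · rw [hV₂, C.coord_f]
    refine inGraph_mapF ?_ ((hV₁ W v).mp hv)
    rw [← hsc, ← hNM]
    exact Matrix.map_mul.symm
  · rw [hV₁, C.coord_g]
    refine inGraph_mapG ?_ ((hV₂ W v).mp hv)
    rw [← hsc, ← hMN]
    exact Matrix.map_mul.symm

/-- The matrices are global and every coordinate vector comes from a global section, so the linking
conditions on global sections are already the hypotheses of `exists_params`. -/
theorem exists_hasParams (V : LinkedPair p f g r)
    (h₁ : V.V₁.graphLocus (C.frame₁.basePull p) = ⊤)
    (h₂ : V.V₂.graphLocus (C.frame₂.basePull p) = ⊤) :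
    ∃ hA c M N, C.HasParams V hA c M N ∧ M * N = Matrix.scalar _ (p.appTop s) ∧
      N * M = Matrix.scalar _ (p.appTop s) := by
  obtain ⟨hA, a, ha⟩ := Subbundle.exists_isGraph_top h₁
  obtain ⟨hA', b, hb⟩ := Subbundle.exists_isGraph_top h₂
  have ha' : ∀ v, v ∈ V.V₁.carrier ⊤ ↔ InGraph a ((C.frame₁.basePull p).coord hA v) := by
    intro v
    rw [ha ⊤ le_rfl]
    simp only [fres_self]
    rfl
  have hb' : ∀ v, v ∈ V.V₂.carrier ⊤ ↔ InGraph b ((C.frame₂.basePull p).coord hA v) := by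
    intro v
    rw [hb ⊤ le_rfl]
    simp only [fres_self]
    rfl
  obtain ⟨c, M, N, hMN, hNM, rfl, rfl⟩ := exists_params (s := p.appTop s) (a := a) (b := b)
    (fun x hx => by
      obtain ⟨v, rfl⟩ := ((C.frame₁.basePull p).coord hA).surjective x
      have := V.map_f ⊤ v ((ha' v).mpr hx)
      rw [hb', C.coord_f, appLE_top] at this
      exact this)
    (fun x hx => by
      obtain ⟨v, rfl⟩ := ((C.frame₂.basePull p).coord hA).surjective x
      have := V.map_g ⊤ v ((hb' v).mpr hx)
      rw [ha', C.coord_g, appLE_top] at this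
      exact this)
  exact ⟨hA, c, M, N, ⟨ha, hb⟩, hMN, hNM⟩

/-- Base change pulls back the graph matrices, these are polynomial expressions in the parameters,
and the parameters can be read off from them; so base change of pairs is pull-back of parameters. -/
theorem classifies_iff {V : LinkedPair p f g r} {V' : LinkedPair q f g r} {hA : ⊤ ≤ p ⁻¹ᵁ C.U}
    {hA' : ⊤ ≤ q ⁻¹ᵁ C.U} {c : C.Idx → Γ(T, ⊤)} {M N : Matrix (Fin C.l) (Fin C.l) Γ(T, ⊤)}
    {c' : C.Idx → Γ(T', ⊤)} {M' N' : Matrix (Fin C.l) (Fin C.l) Γ(T', ⊤)}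
    (hV : C.HasParams V hA c M N) (hV' : C.HasParams V' hA' c' M' N') (h : T' ⟶ T) :
    Classifies h V V' ↔ h ≫ p = q ∧ (∀ i, h.appTop (c i) = c' i) ∧ M.map h.appTop = M' ∧
      N.map h.appTop = N' := by
  have key : ∀ w : h ≫ p = q, (IsBaseChange h w V.V₁ V'.V₁ ∧ IsBaseChange h w V.V₂ V'.V₂) ↔
      (graphA (q.appTop s) c' M' = graphA (q.appTop s) (fun i => h.appTop (c i)) (M.map h.appTop) ∧
      graphB (q.appTop s) c' N' =
        graphB (q.appTop s) (fun i => h.appTop (c i)) (N.map h.appTop)) := by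
    intro w
    have hs : h.appTop (p.appTop s) = q.appTop s := by
      rw [← w, Scheme.Hom.comp_appTop, CommRingCat.comp_apply]
    have hl : ∀ {A B : Type} (a : Matrix A B Γ(T, ⊤)),
        a.map (h.appLE ⊤ ⊤ le_top) = a.map h.appTop.hom := by
      intro A B a
      ext i j
      exact appLE_top h _
    rw [isBaseChange_iff_of_isGraph (he := C.frame₁) w hV.1 hV'.1,
      isBaseChange_iff_of_isGraph (he := C.frame₂) w hV.2 hV'.2,
      hl, hl, map_graphA, map_graphB]
    rw [← hs]
  constructor
  · rintro ⟨w, H⟩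
    obtain ⟨hA, hB⟩ := (key w).mp H
    obtain ⟨h1, h2, h3⟩ := graph_params_inj hA hB
    exact ⟨w, fun i => (congrFun h1 i).symm, h2.symm, h3.symm⟩
  · rintro ⟨w, h1, h2, h3⟩
    refine ⟨w, (key w).mpr ?_⟩
    rw [funext h1, h2, h3]
    exact ⟨rfl, rfl⟩

/-- The representing scheme of the chart. -/
abbrev X : Scheme.{u} := LocalModel C.m C.l (C.U : Scheme.{u}) (C.U.ι.appTop s)

/-- The structure morphism of the representing scheme of the chart. -/
abbrev π : C.X ⟶ S := LocalModel.toBase C.m C.l (C.U : Scheme.{u}) (C.U.ι.appTop s) ≫ C.U.ι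

theorem top_le : (⊤ : C.X.Opens) ≤ C.π ⁻¹ᵁ C.U := by
  intro x _
  have := (LocalModel.toBase C.m C.l (C.U : Scheme.{u}) (C.U.ι.appTop s) x).2
  exact this

theorem appTop_π : C.π.appTop s = (LocalModel.toBase C.m C.l (C.U : Scheme.{u})
    (C.U.ι.appTop s)).appTop (C.U.ι.appTop s) := by
  rw [Scheme.Hom.comp_appTop, CommRingCat.comp_apply]

/-- The universal parameters of the chart. -/
def univParam (i : C.Idx) : Γ(C.X, ⊤) :=
  -- The affine coordinates are the parameters minus `t`, so the origin corresponds to the parameter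
  -- values `t` with vanishing matrices.
  LocalModel.affineCoord C.m C.l (C.U : Scheme.{u}) (C.U.ι.appTop s) (C.enum i) +
    C.π.appLE C.U ⊤ C.top_le (C.t i)

theorem exists_univ : ∃ V : LinkedPair C.π f g r, C.HasParams V C.top_le C.univParam
    (LocalModel.matM C.m C.l (C.U : Scheme.{u}) (C.U.ι.appTop s))
    (LocalModel.matN C.m C.l (C.U : Scheme.{u}) (C.U.ι.appTop s)) :=
  C.exists_pair _ _ (LocalModel.matM_mul_matN.trans (congrArg (Matrix.scalar _) C.appTop_π.symm))
    (LocalModel.matN_mul_matM.trans (congrArg (Matrix.scalar _) C.appTop_π.symm))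

/-- The universal pair of the chart. -/
def univ : LinkedPair C.π f g r := C.exists_univ.choose

theorem hasParams_univ : C.HasParams C.univ C.top_le C.univParam
    (LocalModel.matM C.m C.l (C.U : Scheme.{u}) (C.U.ι.appTop s))
    (LocalModel.matN C.m C.l (C.U : Scheme.{u}) (C.U.ι.appTop s)) := C.exists_univ.choose_spec

theorem classifies_univ_iff {V : LinkedPair p f g r} {hA : ⊤ ≤ p ⁻¹ᵁ C.U} {c : C.Idx → Γ(T, ⊤)}
    {M N : Matrix (Fin C.l) (Fin C.l) Γ(T, ⊤)} (hV : C.HasParams V hA c M N) (h : T ⟶ C.X) :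
    Classifies h C.univ V ↔ h ≫ C.π = p ∧ (∀ i, h.appTop (LocalModel.affineCoord C.m C.l
      (C.U : Scheme.{u}) (C.U.ι.appTop s) (C.enum i)) = c i - p.appLE C.U ⊤ hA (C.t i)) ∧
      (LocalModel.matM C.m C.l (C.U : Scheme.{u}) (C.U.ι.appTop s)).map h.appTop = M ∧
      (LocalModel.matN C.m C.l (C.U : Scheme.{u}) (C.U.ι.appTop s)).map h.appTop = N := by
  rw [C.classifies_iff C.hasParams_univ hV h]
  refine and_congr_right fun w => ?_
  have : ∀ i, h.appTop (C.univParam i) = h.appTop (LocalModel.affineCoord C.m C.l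
      (C.U : Scheme.{u}) (C.U.ι.appTop s) (C.enum i)) + p.appLE C.U ⊤ hA (C.t i) := by
    intro i
    rw [univParam, map_add]
    congr 1
    rw [← appLE_top]
    exact appLE_appLE h C.π p w C.top_le le_top hA (C.t i)
  simp only [this, eq_sub_iff_add_eq]

/-- The open chart of the linked Grassmannian given by adapted frames. -/
def openChart : OpenChart f g r where
  X := C.X
  π := C.π
  univ := C.univ
  locus V := V.V₁.graphLocus (C.frame₁.basePull _) ⊓ V.V₂.graphLocus (C.frame₂.basePull _)
  locus_univ := by
    rw [eq_top_iff]
    exact le_inf C.hasParams_univ.1.le_graphLocus C.hasParams_univ.2.le_graphLocus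
  locus_pull := by
    rintro T T' p q h V W ⟨w, h₁, h₂⟩
    rw [h₁.graphLocus (he := C.frame₁) C.card₁, h₂.graphLocus (he := C.frame₂) C.card₂]
    rfl
  existsUnique := by
    intro T p V hV
    obtain ⟨hA, c, M, N, hp, hMN, hNM⟩ := C.exists_hasParams V
      (eq_top_iff.mpr (hV.ge.trans inf_le_left)) (eq_top_iff.mpr (hV.ge.trans inf_le_right))
    have hr : Set.range p ⊆ Set.range C.U.ι := by
      rintro _ ⟨x, rfl⟩
      rw [Scheme.Opens.range_ι]
      exact hA (trivial : x ∈ (⊤ : T.Opens))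
    let q : T ⟶ C.U := IsOpenImmersion.lift C.U.ι p hr
    have hq : q ≫ C.U.ι = p := IsOpenImmersion.lift_fac _ _ _
    have hs : q.appTop (C.U.ι.appTop s) = p.appTop s := by
      rw [← hq, Scheme.Hom.comp_appTop, CommRingCat.comp_apply]
    -- The shift by `t` is undone here; `p` factors through `C.U` because the frames are only given
    -- there.
    obtain ⟨h, hb, hc, hM, hN⟩ := LocalModel.exists_hom (s := C.U.ι.appTop s) q
      (fun i => c (C.enum.symm i) - p.appLE C.U ⊤ hA (C.t (C.enum.symm i))) M N
      (by rw [hs, hMN]) (by rw [hs, hNM])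
    refine ⟨h, (C.classifies_univ_iff hp h).mpr ⟨?_, fun i => ?_, hM, hN⟩, fun h' hh' => ?_⟩
    · rw [π, reassoc_of% hb, hq]
    · rw [hc, Equiv.symm_apply_apply]
    · obtain ⟨hb', hc', hM', hN'⟩ := (C.classifies_univ_iff hp h').mp hh'
      refine LocalModel.hom_ext ?_ (fun i => ?_) (hM'.trans hM.symm) (hN'.trans hN.symm)
      · rw [← cancel_mono C.U.ι, Category.assoc, hb', hb, hq]
      · obtain ⟨i, rfl⟩ := C.enum.surjective i
        rw [hc, hc', Equiv.symm_apply_apply]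

end ChartData

/-! ### Linear algebra over a field -/

section linearAlgebra

open Module

variable {K : Type*} [Field K]

/-- A vector in both spans is killed by `f`, but `f` is injective on the span of `u`. -/
theorem linearIndependent_sumElim {V W ι κ : Type*} [AddCommGroup V] [Module K V] [AddCommGroup W]
    [Module K W] (f : V →ₗ[K] W) {u : ι → V} {v : κ → V} (hu : LinearIndependent K (f ∘ u))
    (hv : LinearIndependent K v) (hfv : ∀ j, f (v j) = 0) :
    LinearIndependent K (Sum.elim u v) := by
  refine (hu.of_comp f).sum_type hv ?_
  rw [Submodule.disjoint_def]
  intro x hx hx'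
  have h1 : f x = 0 := by
    have : Submodule.span K (Set.range v) ≤ LinearMap.ker f := by
      rw [Submodule.span_le]
      rintro _ ⟨j, rfl⟩
      exact hfv j
    exact this hx'
  rw [Finsupp.mem_span_range_iff_exists_finsupp] at hx
  obtain ⟨c, rfl⟩ := hx
  have h2 : c = 0 := by
    refine (linearIndependent_iff.mp hu) c ?_
    rw [Finsupp.linearCombination_apply]
    simpa [Finsupp.sum, map_sum] using h1
  simp [h2]

/-- A basis of the image is taken among the images of the given basis vectors, so that over a scheme
it lifts to images of elements of a frame. -/
theorem exists_basis_range {V W : Type*} [AddCommGroup V] [Module K V] [AddCommGroup W]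
    [Module K W] {d : ℕ} (e : Basis (Fin d) K V) (f : V →ₗ[K] W) :
    ∃ a : Fin (finrank K (LinearMap.range f)) → Fin d,
      LinearIndependent K (fun i => f (e (a i))) := by
  obtain ⟨κ, a, ha, hs, hi⟩ := exists_linearIndependent' K (fun i => f (e i))
  have : Finite κ := Finite.of_injective a ha
  have : Fintype κ := Fintype.ofFinite κ
  have hc : Fintype.card κ = finrank K (LinearMap.range f) := by
    rw [← finrank_span_eq_card hi, hs]
    have : Set.range (fun i => f (e i)) = f '' Set.range e := by
      rw [← Set.range_comp]; rfl
    rw [this, Submodule.span_image, e.span_eq, Submodule.map_top]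
  let τ := (Fintype.equivFinOfCardEq hc).symm
  exact ⟨a ∘ τ, hi.comp τ τ.injective⟩

/-- Two maps whose composites are a scalar and whose ranks add up to at least the dimension have
adapted bases that can be chosen from given bases. -/
theorem exists_adapted_bases {V W : Type*} [AddCommGroup V] [Module K V] [AddCommGroup W]
    [Module K W] {d : ℕ} (e : Basis (Fin d) K V) (e' : Basis (Fin d) K W) (f : V →ₗ[K] W)
    (g : W →ₗ[K] V) (σ : K) (hgf : ∀ v, g (f v) = σ • v) (hfg : ∀ w, f (g w) = σ • w)
    (hr : d ≤ finrank K (LinearMap.range f) + finrank K (LinearMap.range g)) :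
    ∃ (nA nB : ℕ) (a : Fin nA → Fin d) (b : Fin nB → Fin d), nA + nB = d ∧
      (σ = 0 ∨ nB = 0) ∧
      LinearIndependent K (Sum.elim (fun i => e (a i)) fun i => g (e' (b i))) ∧
      LinearIndependent K (Sum.elim (fun i => f (e (a i))) fun i => e' (b i)) := by
  have : FiniteDimensional K V := .of_basis e
  have : FiniteDimensional K W := .of_basis e'
  by_cases hσ : σ = 0
  · subst hσ
    obtain ⟨a, ha⟩ := exists_basis_range e f
    obtain ⟨b, hb⟩ := exists_basis_range e' g
    have h1 : finrank K (LinearMap.range f) + finrank K (LinearMap.ker f) = d := by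
      rw [LinearMap.finrank_range_add_finrank_ker, finrank_eq_card_basis e, Fintype.card_fin]
    -- From `f ∘ g = 0`; combined with `hr` this makes the two ranks add up to exactly `d`.
    have h2 : finrank K (LinearMap.range g) ≤ finrank K (LinearMap.ker f) := by
      refine Submodule.finrank_mono ?_
      rintro _ ⟨w, rfl⟩
      rw [LinearMap.mem_ker, hfg, zero_smul]
    refine ⟨_, _, a, b, by omega, Or.inl rfl, ?_, ?_⟩
    · exact linearIndependent_sumElim f ha hb fun j => by rw [hfg, zero_smul]
    · have h3 := linearIndependent_sumElim g (u := fun i => e' (b i)) (v := fun i => f (e (a i)))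
        hb ha fun j => by rw [hgf, zero_smul]
      have h4 := h3.comp (Equiv.sumComm _ _) (Equiv.sumComm _ _).injective
      convert h4 using 1
      ext (i | i) <;> rfl
  -- For `σ ≠ 0` the map `f` is injective and the second part of the bases is empty.
  · refine ⟨d, 0, id, Fin.elim0, rfl, Or.inr rfl, ?_, ?_⟩
    · rw [linearIndependent_sum]
      refine ⟨e.linearIndependent, linearIndependent_empty_type, ?_⟩
      simp [Set.range_eq_empty]
    · rw [linearIndependent_sum]
      refine ⟨?_, linearIndependent_empty_type, ?_⟩
      · refine e.linearIndependent.map' f (LinearMap.ker_eq_bot'.mpr fun v hv => ?_)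
        have := hgf v
        rw [hv, map_zero] at this
        exact (smul_eq_zero.mp this.symm).resolve_left hσ
      · simp [Set.range_eq_empty]

variable {A B : Type} [Fintype A] [Fintype B]

/-- The coordinate functionals on a subspace of `A → K`. -/
def coordFunctional (W : Submodule K (A → K)) (a : A) : Dual K W :=
  (LinearMap.proj a).comp W.subtype

/-- Take a maximal independent family of coordinate functionals on `W` containing `s`. The others
are combinations of it, so a vector of `W` vanishing on `t` is zero; this bounds `dim W` by the
number of pivots, and independence in the dual gives the reverse bound. -/
theorem exists_pivots (W : Submodule K (A → K)) {s : Set A}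
    (hs : LinearIndepOn K (coordFunctional W) s) :
    ∃ t : Set A, s ⊆ t ∧ LinearIndepOn K (coordFunctional W) t ∧ Nat.card t = finrank K W ∧
      ∀ x ∈ W, (∀ a ∈ t, x a = 0) → x = 0 := by
  obtain ⟨t, -, hst, hspan, ht⟩ := exists_linearIndepOn_extension hs (Set.subset_univ s)
  have hz : ∀ x ∈ W, (∀ a ∈ t, x a = 0) → x = 0 := by
    intro x hx h
    ext a
    have h1 : coordFunctional W a ∈ Submodule.span K (coordFunctional W '' t) :=
      hspan ⟨a, trivial, rfl⟩
    have h2 : Submodule.span K (coordFunctional W '' t) ≤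
        LinearMap.ker (Dual.eval K W ⟨x, hx⟩) := by
      rw [Submodule.span_le]
      rintro _ ⟨b, hb, rfl⟩
      exact h b hb
    exact h2 h1
  refine ⟨t, hst, ht, le_antisymm ?_ ?_, hz⟩
  · have := Fintype.ofFinite t
    rw [Nat.card_eq_fintype_card, ← Subspace.dual_finrank_eq (K := K) (V := W)]
    exact ht.fintype_card_le_finrank
  · let φ : W →ₗ[K] (t → K) := LinearMap.pi fun a => coordFunctional W a.1
    have hφ : Function.Injective φ := by
      refine (injective_iff_map_eq_zero φ).mpr fun x hx => Subtype.ext (hz x x.2 fun a ha => ?_)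
      exact congrFun hx ⟨a, ha⟩
    have := Fintype.ofFinite t
    have h := LinearMap.finrank_le_finrank_of_injective hφ
    rwa [finrank_fintype_fun_eq_card, ← Nat.card_eq_fintype_card] at h

/-- Functionals on `W₂` whose restrictions to `W₁` are independent are themselves independent, so
pivots of `W₁` extend to pivots of `W₂`. -/
theorem exists_pivots_pair {W₁ W₂ : Submodule K (A → K)} (h : W₁ ≤ W₂) {n l : ℕ}
    (h₁ : finrank K W₁ = n) (h₂ : finrank K W₂ = n + l) :
    ∃ (nK : ℕ) (σ : (Fin n ⊕ Fin l ⊕ Fin nK) ≃ A),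
      (∀ x ∈ W₁, (∀ i, x (σ (.inl i)) = 0) → x = 0) ∧
      ∀ x ∈ W₂, (∀ i, x (σ (.inl i)) = 0) → (∀ i, x (σ (.inr (.inl i))) = 0) → x = 0 := by
  classical
  obtain ⟨t₁, -, hi₁, hc₁, hz₁⟩ := exists_pivots W₁ (linearIndepOn_empty K (coordFunctional W₁))
  have hi : LinearIndepOn K (coordFunctional W₂) t₁ := by
    refine LinearIndependent.of_comp (Dual.transpose (R := K) (Submodule.inclusion h)) ?_
    exact hi₁
  obtain ⟨t₂, ht, -, hc₂, hz₂⟩ := exists_pivots W₂ hi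
  rw [h₁] at hc₁
  rw [h₂] at hc₂
  have hc₃ : Nat.card ↥(t₂ \ t₁) = l := by
    have := Set.ncard_sdiff_add_ncard_of_subset ht
    simp only [← Nat.card_coe_set_eq] at this
    omega
  let τ₁ : t₁ ≃ Fin n := Finite.equivFinOfCardEq hc₁
  let τ₃ : ↥(t₂ \ t₁) ≃ Fin l := Finite.equivFinOfCardEq hc₃
  let τ₄ : ↥(t₂ᶜ) ≃ Fin (Nat.card ↥(t₂ᶜ)) := Finite.equivFin _
  let σ : (Fin n ⊕ Fin l ⊕ Fin (Nat.card ↥(t₂ᶜ))) ≃ A :=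
    (Equiv.sumCongr τ₁.symm (Equiv.sumCongr τ₃.symm τ₄.symm)).trans
      ((Equiv.sumAssoc _ _ _).symm.trans
        ((Equiv.sumCongr (Equiv.Set.sumDiffSubset ht) (Equiv.refl _)).trans (Equiv.Set.sumCompl t₂)))
  have hσ₁ : ∀ i, σ (.inl i) = (τ₁.symm i).1 := fun i => rfl
  have hσ₂ : ∀ i, σ (.inr (.inl i)) = (τ₃.symm i).1 := fun i => rfl
  refine ⟨_, σ, fun x hx h1 => hz₁ x hx fun a ha => ?_, fun x hx h1 h2 => hz₂ x hx fun a ha => ?_⟩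
  · have := h1 (τ₁ ⟨a, ha⟩)
    rwa [hσ₁, Equiv.symm_apply_apply] at this
  · by_cases ha' : a ∈ t₁
    · have := h1 (τ₁ ⟨a, ha'⟩)
      rwa [hσ₁, Equiv.symm_apply_apply] at this
    · have := h2 (τ₃ ⟨a, ha, ha'⟩)
      rwa [hσ₂, Equiv.symm_apply_apply] at this

/-- The projection of `(A ⊕ B) → K` to the part with index in `A`. -/
def projA (K : Type*) [CommRing K] (A B : Type) : ((A ⊕ B) → K) →ₗ[K] (A → K) :=
  LinearMap.funLeft K K Sum.inl

/-- The projection of `(A ⊕ B) → K` to the part with index in `B`. -/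
def projB (K : Type*) [CommRing K] (A B : Type) : ((A ⊕ B) → K) →ₗ[K] (B → K) :=
  LinearMap.funLeft K K Sum.inr

/-- The inclusion of the part with index in `A`. -/
def inclA (K : Type*) [CommRing K] (A B : Type) : (A → K) →ₗ[K] ((A ⊕ B) → K) where
  toFun x := Sum.elim x 0
  map_add' x y := by ext (i | i) <;> simp
  map_smul' c x := by ext (i | i) <;> simp

/-- The inclusion of the part with index in `B`. -/
def inclB (K : Type*) [CommRing K] (A B : Type) : (B → K) →ₗ[K] ((A ⊕ B) → K) where
  toFun x := Sum.elim 0 x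
  map_add' x y := by ext (i | i) <;> simp
  map_smul' c x := by ext (i | i) <;> simp

/-- Rank-nullity: the kernel of the projection to the `A`-part, restricted to `V`, is `V ∩ K^B`. -/
theorem finrank_proj_add (V : Submodule K ((A ⊕ B) → K)) :
    finrank K (V.map (projA K A B)) + finrank K (V.comap (inclB K A B)) = finrank K V := by
  rw [← LinearMap.finrank_range_add_finrank_ker ((projA K A B).comp V.subtype),
    LinearMap.range_comp, Submodule.range_subtype]
  congr 1
  have hinj : Function.Injective (inclB K A B) := fun x y h => funext fun i => congrFun h (.inr i)
  have h1 : (V.comap (inclB K A B)).map (inclB K A B) =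
      (LinearMap.ker ((projA K A B).comp V.subtype)).map V.subtype := by
    ext x
    constructor
    · rintro ⟨y, hy, rfl⟩
      exact ⟨⟨_, hy⟩, rfl, rfl⟩
    · rintro ⟨⟨y, hy⟩, h0, rfl⟩
      have h2 : inclB K A B (fun i => y (.inr i)) = y := by
        ext (i | i)
        · exact (congrFun h0 i).symm
        · rfl
      exact ⟨fun i => y (.inr i), by simpa [h2] using hy, h2⟩
  rw [(Submodule.equivMapOfInjective _ hinj _).finrank_eq, h1,
    ← (Submodule.equivMapOfInjective _ V.subtype_injective _).finrank_eq]

theorem finrank_proj_add' (V : Submodule K ((A ⊕ B) → K)) :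
    finrank K (V.map (projB K A B)) + finrank K (V.comap (inclA K A B)) = finrank K V := by
  rw [← LinearMap.finrank_range_add_finrank_ker ((projB K A B).comp V.subtype),
    LinearMap.range_comp, Submodule.range_subtype]
  congr 1
  have hinj : Function.Injective (inclA K A B) := fun x y h => funext fun i => congrFun h (.inl i)
  have h1 : (V.comap (inclA K A B)).map (inclA K A B) =
      (LinearMap.ker ((projB K A B).comp V.subtype)).map V.subtype := by
    ext x
    constructor
    · rintro ⟨y, hy, rfl⟩
      exact ⟨⟨_, hy⟩, rfl, rfl⟩
    · rintro ⟨⟨y, hy⟩, h0, rfl⟩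
      have h2 : inclA K A B (fun i => y (.inl i)) = y := by
        ext (i | i)
        · rfl
        · exact (congrFun h0 i).symm
      exact ⟨fun i => y (.inl i), by simpa [h2] using hy, h2⟩
  rw [(Submodule.equivMapOfInjective _ hinj _).finrank_eq, h1,
    ← (Submodule.equivMapOfInjective _ V.subtype_injective _).finrank_eq]

/-- Pivots for a pair of subspaces of the same dimension that contain each other's projections. -/
theorem exists_linked_pivots {r : ℕ} {V₁ V₂ : Submodule K ((A ⊕ B) → K)} (h₁ : finrank K V₁ = r)
    (h₂ : finrank K V₂ = r) (hA : ∀ x ∈ V₁, inclA K A B (projA K A B x) ∈ V₂)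
    (hB : ∀ x ∈ V₂, inclB K A B (projB K A B x) ∈ V₁) :
    ∃ (nI nJ l nK nK' : ℕ) (σ : (Fin nI ⊕ Fin l ⊕ Fin nK) ≃ A)
      (τ : (Fin nJ ⊕ Fin l ⊕ Fin nK') ≃ B), nI + nJ + l = r ∧
      finrank K (V₁.map (projA K A B)) = nI ∧ finrank K (V₂.map (projB K A B)) = nJ ∧
      (∀ x ∈ V₁, (∀ i, x (.inl (σ (.inl i))) = 0) → x ∘ Sum.inl = 0) ∧
      (∀ x ∈ V₁, x ∘ Sum.inl = 0 → (∀ i, x (.inr (τ (.inl i))) = 0) →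
        (∀ i, x (.inr (τ (.inr (.inl i)))) = 0) → x = 0) ∧
      (∀ x ∈ V₂, (∀ i, x (.inr (τ (.inl i))) = 0) → x ∘ Sum.inr = 0) ∧
      (∀ x ∈ V₂, x ∘ Sum.inr = 0 → (∀ i, x (.inl (σ (.inl i))) = 0) →
        (∀ i, x (.inl (σ (.inr (.inl i)))) = 0) → x = 0) := by
  have hle₁ : V₁.map (projA K A B) ≤ V₂.comap (inclA K A B) := by
    rintro _ ⟨x, hx, rfl⟩
    exact hA x hx
  have hle₂ : V₂.map (projB K A B) ≤ V₁.comap (inclB K A B) := by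
    rintro _ ⟨x, hx, rfl⟩
    exact hB x hx
  have e₁ := finrank_proj_add V₁
  have e₂ := finrank_proj_add' V₂
  have hm₁ := Submodule.finrank_mono hle₁
  have hm₂ := Submodule.finrank_mono hle₂
  rw [h₁] at e₁
  rw [h₂] at e₂
  -- By rank-nullity `dim (V₂ ∩ K^A) = r - dim pr_B V₂`, so `l` is the codimension of `pr_A V₁` in
  -- it. The value is symmetric in the two subspaces, which is why the same `l` serves for `B`.
  obtain ⟨nK, σ, hσ₁, hσ₂⟩ := exists_pivots_pair hle₁ rfl (l := r -
    finrank K (V₁.map (projA K A B)) - finrank K (V₂.map (projB K A B))) (by omega)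
  obtain ⟨nK', τ, hτ₁, hτ₂⟩ := exists_pivots_pair hle₂ rfl (l := r -
    finrank K (V₁.map (projA K A B)) - finrank K (V₂.map (projB K A B))) (by omega)
  refine ⟨_, _, _, nK, nK', σ, τ, by omega, rfl, rfl, ?_, ?_, ?_, ?_⟩
  · intro x hx h
    exact hσ₁ (projA K A B x) ⟨x, hx, rfl⟩ h
  · intro x hx h h' h''
    have h3 : inclB K A B (projB K A B x) = x := by
      ext (i | i)
      · exact (congrFun h i).symm
      · rfl
    have h4 := hτ₂ (projB K A B x) (by rw [Submodule.mem_comap, h3]; exact hx) h' h''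
    rw [← h3, h4, map_zero]
  · intro x hx h
    exact hτ₁ (projB K A B x) ⟨x, hx, rfl⟩ h
  · intro x hx h h' h''
    have h3 : inclA K A B (projA K A B x) = x := by
      ext (i | i)
      · rfl
      · exact (congrFun h i).symm
    have h4 := hσ₂ (projA K A B x) (by rw [Submodule.mem_comap, h3]; exact hx) h' h''
    rw [← h3, h4, map_zero]

end linearAlgebra

/-! ### Frames near a point and sub-bundles over a field -/

section point

variable {S T : Scheme.{u}} {p : T ⟶ S} {E F : S.Modules}

/-- Sections over `Spec k` form modules over its ring of global functions, which comes only as a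
commutative ring; linear algebra over a field is applied to it through `IsField.toField`. -/
theorem isField_spec (k : Type u) [Field k] : IsField Γ(Spec (CommRingCat.of k), ⊤) :=
  MulEquiv.isField (Field.toIsField k)
    (Scheme.ΓSpecIso (CommRingCat.of k)).commRingCatIsoToRingEquiv.toMulEquiv

instance (k : Type u) [Field k] : Subsingleton (Spec (CommRingCat.of k)) :=
  inferInstanceAs (Subsingleton (PrimeSpectrum k))

theorem top_le_preimage [Subsingleton T] {U : S.Opens} {x : T} (hx : p x ∈ U) : ⊤ ≤ p ⁻¹ᵁ U := by
  intro y _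
  rwa [Subsingleton.elim y x]

theorem eq_top_of_mem [Subsingleton T] {U : T.Opens} {x : T} (hx : x ∈ U) : U = ⊤ := by
  rw [eq_top_iff]
  intro y _
  rwa [Subsingleton.elim y x]

theorem basicOpen_appLE {X Y : Scheme.{u}} (h : X ⟶ Y) {U : Y.Opens} {A : X.Opens}
    (hA : A ≤ h ⁻¹ᵁ U) (a : Γ(Y, U)) :
    X.basicOpen (h.appLE U A hA a) = A ⊓ h ⁻¹ᵁ Y.basicOpen a := by
  have : h.appLE U A hA a = fres hA (h.app U a) := by
    rw [fres_apply]
    rfl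
  rw [this, fres_apply, Scheme.basicOpen_res, Scheme.preimage_basicOpen]

theorem appLE_eq_zero_iff (hK : IsField Γ(T, ⊤)) [Subsingleton T] {U : S.Opens}
    (hU : ⊤ ≤ p ⁻¹ᵁ U) (a : Γ(S, U)) (x : T) :
    p.appLE U ⊤ hU a = 0 ↔ p x ∉ S.basicOpen a := by
  have hb := basicOpen_appLE p hU a
  rw [top_inf_eq] at hb
  constructor
  · intro h hx
    rw [h] at hb
    have h1 : x ∈ p ⁻¹ᵁ S.basicOpen a := hx
    rw [← hb, Scheme.basicOpen_zero] at h1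
    exact h1
  · intro h
    by_contra h0
    obtain ⟨b, hb'⟩ := hK.mul_inv_cancel h0
    have h1 : T.basicOpen (p.appLE U ⊤ hU a) = ⊤ :=
      Scheme.basicOpen_of_isUnit _ (IsUnit.of_mul_eq_one b hb')
    rw [hb] at h1
    exact h (h1.ge (trivial : x ∈ (⊤ : T.Opens)))

variable {U : S.Opens} {ι κ : Type} [Fintype ι] [DecidableEq ι] [Fintype κ] [DecidableEq κ]

/-- The determinant of the transition matrix from a frame is invertible at the point, hence on its
basic open set, over which the sections form a frame. -/
theorem exists_frame_of_linearIndependent (hK : IsField Γ(T, ⊤)) {e ε : ι → Γ(E, U)}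
    (he : IsFrame E U e) (hU : ⊤ ≤ p ⁻¹ᵁ U)
    (hi : LinearIndependent Γ(T, ⊤) fun i => basePull p E hU (ε i)) :
    ∃ (U' : S.Opens) (h : U' ≤ U), ⊤ ≤ p ⁻¹ᵁ U' ∧ IsFrame E U' fun i => res E h (ε i) := by
  let G : Matrix ι ι Γ(S, U) := fun i k => he.coord le_rfl (ε k) i
  have hG : IsUnit (G.map (p.appLE U ⊤ hU).hom) := by
    have h1 := hi.map' ((he.basePull p).coord hU).toLinearMap (LinearEquiv.ker _)
    have h2 : (G.map (p.appLE U ⊤ hU).hom).col =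
        ((he.basePull p).coord hU).toLinearMap ∘ fun i => basePull p E hU (ε i) := by
      ext k i
      exact (he.coord_basePull le_rfl hU (ε k) i).symm
    let := hK.toField
    refine Matrix.linearIndependent_cols_iff_isUnit.mp ?_
    rw [h2]
    exact h1
  rw [Matrix.isUnit_iff_isUnit_det] at hG
  have hdet : (G.map (p.appLE U ⊤ hU).hom).det = p.appLE U ⊤ hU G.det :=
    ((p.appLE U ⊤ hU).hom.map_det G).symm
  rw [hdet] at hG
  have hle : S.basicOpen G.det ≤ U := S.basicOpen_le _
  refine ⟨S.basicOpen G.det, hle, ?_, ?_⟩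
  · have hb := basicOpen_appLE p hU G.det
    rw [Scheme.basicOpen_of_isUnit _ hG] at hb
    exact hb.le.trans inf_le_right
  · have hG' : IsUnit (G.map (fres hle)).det := by
      have h1 : (G.map (fres hle)).det = fres hle G.det := ((fres hle).map_det G).symm
      rw [h1]
      exact RingedSpace.isUnit_res_basicOpen _ G.det
    have h := (he.mono hle).combine (G.map (fres hle)) (G.map (fres hle))⁻¹
      (Matrix.mul_nonsing_inv _ hG') (Matrix.nonsing_inv_mul _ hG')
    convert h using 1
    ext1 k
    refine he.ext_coord hle fun i => ?_
    have h1 := (he.mono hle).coord_combine (G.map (fres hle)) le_rfl k i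
    rw [res_self, fres_self, he.coord_mono] at h1
    rw [h1]
    exact he.coord_res le_rfl hle _ _

end point

/-! ### Sub-bundles over one-point schemes whose functions form a field. -/

section fieldSubbundle

variable {T : Scheme.{u}} {E : T.Modules} {U : T.Opens} {r : ℕ} {ι κ : Type} [Fintype ι]
  [Fintype κ]

theorem Subbundle.exists_adapted_top [Subsingleton T] (V : Subbundle E r) (x : T)
    (hr : Fintype.card ι = r) :
    ∃ (n : ℕ) (ε : ι ⊕ Fin n → Γ(E, ⊤)), IsFrame E ⊤ ε ∧ V.Adapted ε := by
  obtain ⟨U, hx, n, ε, hε, hV⟩ := V.exists_adapted_of_card hr x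
  obtain rfl := eq_top_of_mem hx
  exact ⟨n, ε, hε, hV⟩

theorem Subbundle.finrank_top (hK : IsField Γ(T, ⊤)) [Subsingleton T] (V : Subbundle E r) (x : T) :
    Module.finrank Γ(T, ⊤) (V.carrier ⊤) = r := by
  obtain ⟨n, ε, hε, hV⟩ := V.exists_adapted_top (ι := Fin r) x (Fintype.card_fin r)
  rw [hV ⊤ le_rfl]
  let := hK.toField
  have h := (hε ⊤ le_rfl).1.comp Sum.inl Sum.inl_injective
  exact (finrank_span_eq_card h).trans (Fintype.card_fin r)

/-- The hypothesis says that projection of `V` to the first `r` coordinates is injective; the square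
matrix of this projection in an adapted frame is then invertible. -/
theorem Subbundle.graphLocus_eq_top [DecidableEq ι] (hK : IsField Γ(T, ⊤)) [Subsingleton T] (V : Subbundle E r)
    (x : T) {e : ι ⊕ κ → Γ(E, U)} (he : IsFrame E U e) (hU : ⊤ ≤ U) (hr : Fintype.card ι = r)
    (H : ∀ v ∈ V.carrier ⊤, (∀ i, he.coord hU v (Sum.inl i) = 0) → v = 0) :
    V.graphLocus he = ⊤ := by
  obtain ⟨n, ε, hε, hV⟩ := V.exists_adapted_top x hr
  have hG : IsUnit (inlMatrix he hU (ε ∘ Sum.inl)) := by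
    let := hK.toField
    refine Matrix.mulVec_injective_iff_isUnit.mp ?_
    refine (injective_iff_map_eq_zero (inlMatrix he hU (ε ∘ Sum.inl)).mulVecLin).mpr fun c hc => ?_
    have h1 : ∑ i, c i • ε (Sum.inl i) = 0 := by
      refine H _ (Submodule.sum_mem _ fun i _ => Submodule.smul_mem _ _ ?_) fun i => ?_
      · have := hV.mem (le_rfl : (⊤ : T.Opens) ≤ ⊤) i
        rwa [res_self] at this
      · refine Eq.trans ?_ (congrFun hc i)
        simp only [map_sum, map_smul, Finset.sum_apply, Pi.smul_apply, smul_eq_mul]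
        exact Finset.sum_congr rfl fun k _ => mul_comm _ _
    have h2 := (hε ⊤ le_rfl).1.comp Sum.inl Sum.inl_injective
    have h3 := Fintype.linearIndependent_iff.mp h2 c (by
      refine Eq.trans (Finset.sum_congr rfl fun i _ => ?_) h1
      rw [Function.comp_apply, res_self])
    exact funext h3
  rw [Matrix.isUnit_iff_isUnit_det] at hG
  exact top_le_iff.mp (hV.isGraph he hU _ (Matrix.mul_nonsing_inv _ hG)).le_graphLocus

end fieldSubbundle

/-! ### Frames in which both maps are diagonal. -/

section localFrames

variable {S : Scheme.{u}} {E₁ E₂ : S.Modules} {f : E₁ ⟶ E₂} {g : E₂ ⟶ E₁} {s : Γ(S, ⊤)} {d : ℕ}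

theorem IsVectorBundle.exists_common_frames (h₁ : IsVectorBundle E₁ d) (h₂ : IsVectorBundle E₂ d)
    (t : S) : ∃ U : S.Opens, t ∈ U ∧ ∃ (e : Fin d → Γ(E₁, U)) (e' : Fin d → Γ(E₂, U)),
      IsFrame E₁ U e ∧ IsFrame E₂ U e' := by
  obtain ⟨U₁, ht₁, e, he⟩ := h₁ t
  obtain ⟨U₂, ht₂, e', he'⟩ := h₂ t
  exact ⟨U₁ ⊓ U₂, ⟨ht₁, ht₂⟩, _, _, he.mono inf_le_left, he'.mono inf_le_right⟩

theorem IsLinked.bcMap_g_f (H : IsLinked d f g s) {T : Scheme.{u}} (p : T ⟶ S) {U : S.Opens}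
    {e : Fin d → Γ(E₁, U)} (he : IsFrame E₁ U e) (hU : ⊤ ≤ p ⁻¹ᵁ U) (v : Γ(bc p E₁, ⊤)) :
    (bcMap p g).app ⊤ ((bcMap p f).app ⊤ v) = p.appTop s • v := by
  conv_lhs => rw [← (he.basePull p).sum_coord hU v, app_sum, app_sum]
  conv_rhs => rw [← (he.basePull p).sum_coord hU v, Finset.smul_sum]
  refine Finset.sum_congr rfl fun i _ => ?_
  rw [app_smul, app_smul, res_basePull, bcMap_basePull, bcMap_basePull, H.g_f, basePull_smul,
    smul_comm]
  congr 1
  rw [← appLE_top]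
  exact appLE_fres p le_top hU s

theorem IsLinked.bcMap_f_g (H : IsLinked d f g s) {T : Scheme.{u}} (p : T ⟶ S) {U : S.Opens}
    {e : Fin d → Γ(E₂, U)} (he : IsFrame E₂ U e) (hU : ⊤ ≤ p ⁻¹ᵁ U) (v : Γ(bc p E₂, ⊤)) :
    (bcMap p f).app ⊤ ((bcMap p g).app ⊤ v) = p.appTop s • v := by
  conv_lhs => rw [← (he.basePull p).sum_coord hU v, app_sum, app_sum]
  conv_rhs => rw [← (he.basePull p).sum_coord hU v, Finset.smul_sum]
  refine Finset.sum_congr rfl fun i _ => ?_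
  rw [app_smul, app_smul, res_basePull, bcMap_basePull, bcMap_basePull, H.f_g, basePull_smul,
    smul_comm]
  congr 1
  rw [← appLE_top]
  exact appLE_fres p le_top hU s

/-- Near every point there are frames in which the two maps are diagonal. -/
theorem IsLinked.exists_local_frames (H : IsLinked d f g s) (t : S) :
    ∃ (U : S.Opens) (nA nB : ℕ) (ε₁ : Fin nA ⊕ Fin nB → Γ(E₁, U))
      (ε₂ : Fin nA ⊕ Fin nB → Γ(E₂, U)), t ∈ U ∧ nA + nB = d ∧
      (nB = 0 ∨ t ∉ S.basicOpen s) ∧ IsFrame E₁ U ε₁ ∧ IsFrame E₂ U ε₂ ∧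
      (∀ i, f.app U (ε₁ (Sum.inl i)) = ε₂ (Sum.inl i)) ∧
      ∀ i, g.app U (ε₂ (Sum.inr i)) = ε₁ (Sum.inr i) := by
  obtain ⟨U, ht, e, e', he, he'⟩ := H.bundle₁.exists_common_frames H.bundle₂ t
  let T : Scheme.{u} := Spec (CommRingCat.of (S.residueField t))
  let p : T ⟶ S := S.fromSpecResidueField t
  have hK : IsField Γ(T, ⊤) := isField_spec _
  let x : T := IsLocalRing.closedPoint (S.residueField t)
  have hx : p x = t := S.fromSpecResidueField_apply t x
  have hU : ⊤ ≤ p ⁻¹ᵁ U := top_le_preimage (x := x) (by rwa [hx])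
  have hrank := H.rank (rankAt f t) (rankAt g t)
  have hrank' : d ≤ rankAt f t + rankAt g t := by
    by_contra h
    exact hrank (by omega) t ⟨le_rfl, le_rfl⟩
  obtain ⟨nA, nB, a, b, hn, hs, hi₁, hi₂⟩ : ∃ (nA nB : ℕ) (a : Fin nA → Fin d) (b : Fin nB → Fin d),
      nA + nB = d ∧ (p.appTop s = 0 ∨ nB = 0) ∧
      LinearIndependent Γ(T, ⊤) (Sum.elim (fun i => basePull p E₁ hU (e (a i)))
        fun i => (bcMap p g).app ⊤ (basePull p E₂ hU (e' (b i)))) ∧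
      LinearIndependent Γ(T, ⊤) (Sum.elim
        (fun i => (bcMap p f).app ⊤ (basePull p E₁ hU (e (a i)))) fun i =>
          basePull p E₂ hU (e' (b i))) := by
    let := hK.toField
    obtain ⟨nA, nB, a, b, hn, hs, h1, h2⟩ := exists_adapted_bases ((he.basePull p).basis hU)
      ((he'.basePull p).basis hU) (sectionMap (bcMap p f) ⊤) (sectionMap (bcMap p g) ⊤)
      (p.appTop s) (H.bcMap_g_f p he hU) (H.bcMap_f_g p he' hU) hrank'
    simp only [IsFrame.basis_apply, res_basePull] at h1 h2
    exact ⟨nA, nB, a, b, hn, hs, h1, h2⟩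
  let σ : Fin d ≃ Fin nA ⊕ Fin nB := (finCongr hn.symm).trans finSumFinEquiv.symm
  -- Half of each new frame consists of images of sections of the other bundle, so `f` and `g` are
  -- diagonal on the whole open set and not only at `t`. Independence at `t` is what the field
  -- argument provides.
  let ε₁ : Fin nA ⊕ Fin nB → Γ(E₁, U) := Sum.elim (fun i => e (a i)) fun i => g.app U (e' (b i))
  let ε₂ : Fin nA ⊕ Fin nB → Γ(E₂, U) := Sum.elim (fun i => f.app U (e (a i))) fun i => e' (b i)
  have hi₁' : LinearIndependent Γ(T, ⊤) fun i => basePull p E₁ hU (ε₁ i) := by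
    convert hi₁ using 1
    ext1 (i | i)
    · rfl
    · exact (bcMap_basePull p hU g (e' (b i))).symm
  have hi₂' : LinearIndependent Γ(T, ⊤) fun i => basePull p E₂ hU (ε₂ i) := by
    convert hi₂ using 1
    ext1 (i | i)
    · exact (bcMap_basePull p hU f (e (a i))).symm
    · rfl
  obtain ⟨U₁, hU₁, htU₁, hF₁⟩ := exists_frame_of_linearIndependent hK (he.reindex σ.symm) hU hi₁'
  obtain ⟨U₂, hU₂, htU₂, hF₂⟩ := exists_frame_of_linearIndependent hK (he'.reindex σ.symm) hU hi₂'
  have hle : U₁ ⊓ U₂ ≤ U := inf_le_left.trans hU₁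
  refine ⟨U₁ ⊓ U₂, nA, nB, fun i => res E₁ hle (ε₁ i), fun i => res E₂ hle (ε₂ i), ?_, hn, ?_, ?_,
    ?_, ?_, ?_⟩
  · have h1 : p x ∈ U₁ := htU₁ (trivial : x ∈ (⊤ : T.Opens))
    have h2 : p x ∈ U₂ := htU₂ (trivial : x ∈ (⊤ : T.Opens))
    rw [hx] at h1 h2
    exact ⟨h1, h2⟩
  · refine hs.symm.imp_right fun h => ?_
    rw [← appLE_top] at h
    have := (appLE_eq_zero_iff hK (p := p) (U := ⊤) le_top s x).mp h
    rwa [hx] at this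
  · have := hF₁.mono (inf_le_left : U₁ ⊓ U₂ ≤ U₁)
    simpa only [res_res] using this
  · have := hF₂.mono (inf_le_right : U₁ ⊓ U₂ ≤ U₂)
    simpa only [res_res] using this
  · intro i
    rw [app_res]
    rfl
  · intro i
    rw [app_res]
    rfl

end localFrames

/-! ### Charts around a field-valued point -/

section linear

/-- The rearrangement of the index set of the first frame of a chart. -/
def shuffle₁ (I J L K K' : Type) : (I ⊕ J ⊕ L) ⊕ (L ⊕ K ⊕ K') ≃ (I ⊕ L ⊕ K) ⊕ (J ⊕ L ⊕ K') where
  toFun := Sum.elim (vec₃ (fun i => .inl (.inl i)) (fun i => .inr (.inl i))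
      fun i => .inr (.inr (.inl i)))
    (vec₃ (fun i => .inl (.inr (.inl i))) (fun i => .inl (.inr (.inr i)))
      fun i => .inr (.inr (.inr i)))
  invFun := Sum.elim (vec₃ (fun i => .inl (.inl i)) (fun i => .inr (.inl i))
      fun i => .inr (.inr (.inl i)))
    (vec₃ (fun i => .inl (.inr (.inl i))) (fun i => .inl (.inr (.inr i)))
      fun i => .inr (.inr (.inr i)))
  left_inv := by rintro ((i | i | i) | (i | i | i)) <;> rfl
  right_inv := by rintro ((i | i | i) | (i | i | i)) <;> rfl

/-- The rearrangement of the index set of the second frame of a chart. -/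
def shuffle₂ (I J L K K' : Type) : (I ⊕ L ⊕ J) ⊕ (L ⊕ K ⊕ K') ≃ (I ⊕ L ⊕ K) ⊕ (J ⊕ L ⊕ K') where
  toFun := Sum.elim (vec₃ (fun i => .inl (.inl i)) (fun i => .inl (.inr (.inl i)))
      fun i => .inr (.inl i))
    (vec₃ (fun i => .inr (.inr (.inl i))) (fun i => .inl (.inr (.inr i)))
      fun i => .inr (.inr (.inr i)))
  invFun := Sum.elim (vec₃ (fun i => .inl (.inl i)) (fun i => .inl (.inr (.inl i)))
      fun i => .inr (.inr (.inl i)))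
    (vec₃ (fun i => .inl (.inr (.inr i))) (fun i => .inr (.inl i))
      fun i => .inr (.inr (.inr i)))
  left_inv := by rintro ((i | i | i) | (i | i | i)) <;> rfl
  right_inv := by rintro ((i | i | i) | (i | i | i)) <;> rfl

variable {R : Type*} [CommRing R] {I J L K K' A B : Type}

/-- Once the indices are regrouped by the parts `A` and `B`, the map is multiplication by `1` on `A`
and by `s` on `B`. -/
theorem mapF_shuffle (s : R) (σ : I ⊕ L ⊕ K ≃ A) (τ : J ⊕ L ⊕ K' ≃ B) (y : A ⊕ B → R) (j) :
    mapF s (y ∘ (shuffle₁ I J L K K').trans (Equiv.sumCongr σ τ)) j =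
      Sum.elim (fun _ => 1) (fun _ => s) ((shuffle₂ I J L K K').trans (Equiv.sumCongr σ τ) j) *
        y ((shuffle₂ I J L K K').trans (Equiv.sumCongr σ τ) j) := by
  obtain ((j | j | j) | (j | j | j)) := j <;> simp [mapF, vec₃, shuffle₁, shuffle₂]

theorem mapG_shuffle (s : R) (σ : I ⊕ L ⊕ K ≃ A) (τ : J ⊕ L ⊕ K' ≃ B) (y : A ⊕ B → R) (j) :
    mapG s (y ∘ (shuffle₂ I J L K K').trans (Equiv.sumCongr σ τ)) j =
      Sum.elim (fun _ => s) (fun _ => 1) ((shuffle₁ I J L K K').trans (Equiv.sumCongr σ τ) j) *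
        y ((shuffle₁ I J L K K').trans (Equiv.sumCongr σ τ) j) := by
  obtain ((j | j | j) | (j | j | j)) := j <;> simp [mapG, vec₃, shuffle₁, shuffle₂]

theorem inclA_injective : Function.Injective (inclA R A B) := fun _ _ h =>
  funext fun i => congrFun h (Sum.inl i)

theorem inclB_injective : Function.Injective (inclB R A B) := fun _ _ h =>
  funext fun i => congrFun h (Sum.inr i)

open Module in
theorem exists_linked_pivots_of_isField (hR : IsField R) [Fintype A] [Fintype B] {r : ℕ}
    {V₁ V₂ : Submodule R ((A ⊕ B) → R)} (h₁ : finrank R V₁ = r) (h₂ : finrank R V₂ = r)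
    (hA : ∀ x ∈ V₁, inclA R A B (projA R A B x) ∈ V₂)
    (hB : ∀ x ∈ V₂, inclB R A B (projB R A B x) ∈ V₁) :
    ∃ (nI nJ l nK nK' : ℕ) (σ : (Fin nI ⊕ Fin l ⊕ Fin nK) ≃ A)
      (τ : (Fin nJ ⊕ Fin l ⊕ Fin nK') ≃ B), nI + nJ + l = r ∧
      finrank R (V₁.map (projA R A B)) = nI ∧
      finrank R (V₂.map (projB R A B)) = nJ ∧
      (∀ x ∈ V₁, (∀ i, x (.inl (σ (.inl i))) = 0) → x ∘ Sum.inl = 0) ∧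
      (∀ x ∈ V₁, x ∘ Sum.inl = 0 → (∀ i, x (.inr (τ (.inl i))) = 0) →
        (∀ i, x (.inr (τ (.inr (.inl i)))) = 0) → x = 0) ∧
      (∀ x ∈ V₂, (∀ i, x (.inr (τ (.inl i))) = 0) → x ∘ Sum.inr = 0) ∧
      (∀ x ∈ V₂, x ∘ Sum.inr = 0 → (∀ i, x (.inl (σ (.inl i))) = 0) →
        (∀ i, x (.inl (σ (.inr (.inl i)))) = 0) → x = 0) := by
  let := hR.toField
  exact exists_linked_pivots h₁ h₂ hA hB

end linear

/-! ### Diagonal morphisms in coordinates. -/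

section diag

variable {S T : Scheme.{u}} {E F : S.Modules} {U : S.Opens} {ι : Type} [Fintype ι] [DecidableEq ι]
  {e : ι → Γ(E, U)} {e' : ι → Γ(F, U)}

theorem IsFrame.coord_bcMap_diag (he : IsFrame E U e) (he' : IsFrame F U e') (p : T ⟶ S)
    {f : E ⟶ F} {D : ι → Γ(S, U)} (hD : ∀ i, f.app U (e i) = D i • e' i) {W : T.Opens}
    (hW : W ≤ p ⁻¹ᵁ U) (v : Γ(bc p E, W)) (i : ι) :
    (he'.basePull p).coord hW ((bcMap p f).app W v) i =
      p.appLE U W hW (D i) * (he.basePull p).coord hW v i := by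
  have h : ∀ i, (bcMap p f).app W (LinkedGr.basePull p E hW (e i)) =
      p.appLE U W hW (D i) • LinkedGr.basePull p F hW (e' i) := fun i => by
    rw [bcMap_basePull, hD, basePull_smul]
  refine congrFun ((he'.basePull p).coord_eq (a := fun i =>
    p.appLE U W hW (D i) * (he.basePull p).coord hW v i) hW ?_) i
  conv_lhs => rw [← (he.basePull p).sum_coord hW v, app_sum]
  refine Finset.sum_congr rfl fun i _ => ?_
  rw [app_smul, res_basePull, h, res_basePull, smul_smul, mul_comm]

theorem IsFrame.coord_smul_self (he : IsFrame E U e) (a : Γ(S, U)) (i : ι) :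
    he.coord le_rfl (a • e i) = a • Pi.single i 1 := by
  rw [map_smul, ← he.coord_self le_rfl i, res_self]

end diag

section chart

variable {S : Scheme.{u}} {E₁ E₂ : S.Modules} {f : E₁ ⟶ E₂} {g : E₂ ⟶ E₁} {s : Γ(S, ⊤)}
  {d r : ℕ}

/-- The chart given by frames in which the two maps are diagonal. -/
def ChartData.ofDiag {U : S.Opens} {nI nJ l nK nK' : ℕ} {A B : Type} [Fintype A] [Fintype B]
    [DecidableEq A] [DecidableEq B] {ε₁ : A ⊕ B → Γ(E₁, U)} {ε₂ : A ⊕ B → Γ(E₂, U)}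
    (h₁ : IsFrame E₁ U ε₁) (h₂ : IsFrame E₂ U ε₂)
    (hf : ∀ i, f.app U (ε₁ i) = (Sum.elim (fun _ => 1) (fun _ => fres le_top s) i : Γ(S, U)) • ε₂ i)
    (hg : ∀ i, g.app U (ε₂ i) = (Sum.elim (fun _ => fres le_top s) (fun _ => 1) i : Γ(S, U)) • ε₁ i)
    (σ : (Fin nI ⊕ Fin l ⊕ Fin nK) ≃ A) (τ : (Fin nJ ⊕ Fin l ⊕ Fin nK') ≃ B)
    (hr : nI + nJ + l = r) : ChartData f g s r where
  U := U
  l := l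
  nI := nI
  nJ := nJ
  nK := nK
  nK' := nK'
  e₁ := ε₁ ∘ (shuffle₁ _ _ _ _ _).trans (Equiv.sumCongr σ τ)
  e₂ := ε₂ ∘ (shuffle₂ _ _ _ _ _).trans (Equiv.sumCongr σ τ)
  frame₁ := h₁.reindex _
  frame₂ := h₂.reindex _
  f_e₁ i := by
    ext j
    set ρ := (shuffle₁ (Fin nI) (Fin nJ) (Fin l) (Fin nK) (Fin nK')).trans (Equiv.sumCongr σ τ)
    have h : (Pi.single i 1 : _ → Γ(S, U)) = Pi.single (ρ i) 1 ∘ ρ := by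
      ext k
      simp [Pi.single_apply]
    rw [h, mapF_shuffle, h₂.coord_reindex, Function.comp_apply, hf, h₂.coord_smul_self,
      Pi.smul_apply, smul_eq_mul]
    simp only [Pi.single_apply]
    split_ifs with hk
    · rw [hk]
    · rw [mul_zero, mul_zero]
  g_e₂ i := by
    ext j
    set ρ := (shuffle₂ (Fin nI) (Fin nJ) (Fin l) (Fin nK) (Fin nK')).trans (Equiv.sumCongr σ τ)
    have h : (Pi.single i 1 : _ → Γ(S, U)) = Pi.single (ρ i) 1 ∘ ρ := by
      ext k
      simp [Pi.single_apply]
    rw [h, mapG_shuffle, h₁.coord_reindex, Function.comp_apply, hg, h₁.coord_smul_self,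
      Pi.smul_apply, smul_eq_mul]
    simp only [Pi.single_apply]
    split_ifs with hk
    · rw [hk]
    · rw [mul_zero, mul_zero]
  card := hr
  t := 0

end chart

section chart

variable {S : Scheme.{u}} {E₁ E₂ : S.Modules} {f : E₁ ⟶ E₂} {g : E₂ ⟶ E₁} {s : Γ(S, ⊤)}
  {d r : ℕ}

/-- The free blocks have `l (nI + nJ)` entries in the rows `L` and `(nK + nK') r` in the rows `K`
and `K'`, where `r = nI + nJ + l`; the missing `l × l` block accounts for `l ^ 2`. -/
theorem ChartData.cast_m (C : ChartData f g s r) :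
    (C.m : ℤ) = (C.nI + C.nJ + C.l) * (C.l + C.nK + C.nK') - C.l ^ 2 := by
  simp only [ChartData.m, Fintype.card_sum, Fintype.card_prod, Fintype.card_fin]
  push_cast
  ring

/-- Every linked pair over a field lies in a chart in which its matrices vanish. -/
theorem IsLinked.exists_chartData (H : IsLinked d f g s) {k : Type u} [Field k]
    {p : Spec (CommRingCat.of k) ⟶ S} (V : LinkedPair p f g r) :
    ∃ (C : ChartData f g s r) (hA : ⊤ ≤ p ⁻¹ᵁ C.U) (c : C.Idx → Γ(Spec (CommRingCat.of k), ⊤)),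
      C.HasParams V hA c 0 0 ∧
      (p.appTop s = 0 → (C.l : ℤ) = (r : ℤ) - dimG V - dimF V) ∧ (p.appTop s ≠ 0 → C.l = 0) ∧
      (C.m : ℤ) = (r : ℤ) * ((d : ℤ) - r) - (C.l : ℤ) ^ 2 := by
  let x : Spec (CommRingCat.of k) := IsLocalRing.closedPoint k
  have hK := isField_spec k
  obtain ⟨U, nA, nB, ε₁, ε₂, hxU, hd, hB0, h₁, h₂, hf₁, hg₂⟩ := H.exists_local_frames (p x)
  have hU : ⊤ ≤ p ⁻¹ᵁ U := top_le_preimage hxU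
  have hs0 : nB = 0 ∨ p.appTop s = 0 := by
    refine hB0.imp_right fun h => ?_
    have := (appLE_eq_zero_iff hK (p := p) (U := ⊤) le_top s x).mpr h
    rwa [appLE_top] at this
  have hsU : p.appLE U ⊤ hU (fres le_top s) = p.appTop s := by
    rw [← appLE_top]
    exact appLE_fres p le_top hU s
  have hf : ∀ i, f.app U (ε₁ i) =
      (Sum.elim (fun _ => 1) (fun _ => fres le_top s) i : Γ(S, U)) • ε₂ i := by
    rintro (i | i)
    · rw [hf₁, Sum.elim_inl, one_smul]
    · rw [← hg₂, H.f_g]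
      rfl
  have hg : ∀ i, g.app U (ε₂ i) =
      (Sum.elim (fun _ => fres le_top s) (fun _ => 1) i : Γ(S, U)) • ε₁ i := by
    rintro (i | i)
    · rw [← hf₁, H.g_f]
      rfl
    · rw [hg₂, Sum.elim_inr, one_smul]
  let K := Γ(Spec (CommRingCat.of k), ⊤)
  let γ₁ := (h₁.basePull p).coord hU
  let γ₂ := (h₂.basePull p).coord hU
  have cf : ∀ v, γ₂ ((bcMap p f).app ⊤ v) =
      fun i => Sum.elim (fun _ => 1) (fun _ => p.appTop s) i * γ₁ v i := by
    intro v
    ext i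
    refine (h₁.coord_bcMap_diag h₂ p hf hU v i).trans (congrArg (· * γ₁ v i) ?_)
    obtain (i | i) := i
    · exact map_one _
    · exact hsU
  have cg : ∀ v, γ₁ ((bcMap p g).app ⊤ v) =
      fun i => Sum.elim (fun _ => p.appTop s) (fun _ => 1) i * γ₂ v i := by
    intro v
    ext i
    refine (h₂.coord_bcMap_diag h₁ p hg hU v i).trans (congrArg (· * γ₂ v i) ?_)
    obtain (i | i) := i
    · exact hsU
    · exact map_one _
  let W₁ := (V.V₁.carrier ⊤).map γ₁.toLinearMap
  let W₂ := (V.V₂.carrier ⊤).map γ₂.toLinearMap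
  have hW₁ : ∀ v, v ∈ V.V₁.carrier ⊤ ↔ γ₁ v ∈ W₁ := fun v =>
    by
    rw [Submodule.mem_map_equiv, LinearEquiv.symm_apply_apply]
  have hW₂ : ∀ v, v ∈ V.V₂.carrier ⊤ ↔ γ₂ v ∈ W₂ := fun v =>
    by
    rw [Submodule.mem_map_equiv, LinearEquiv.symm_apply_apply]
  have cf0 : p.appTop s = 0 → ∀ v, γ₂ ((bcMap p f).app ⊤ v) = inclA K _ _ (projA K _ _ (γ₁ v)) := by
    intro h v
    rw [cf, h]
    ext (i | i)
    · exact one_mul _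
    · exact zero_mul _
  have cg0 : p.appTop s = 0 → ∀ v, γ₁ ((bcMap p g).app ⊤ v) = inclB K _ _ (projB K _ _ (γ₂ v)) := by
    intro h v
    rw [cg, h]
    ext (i | i)
    · exact zero_mul _
    · exact one_mul _
  -- If `s` vanishes, `f` and `g` are the two projections. Otherwise `B` is empty, so `f` is still
  -- the projection to `A`, while the condition on `B` concerns only the zero vector.
  obtain ⟨nI, nJ, l, nK, nK', σ, τ, hr, hI, hJ, v₁, v₁', v₂, v₂'⟩ :=
    exists_linked_pivots_of_isField hK (A := Fin nA) (B := Fin nB) (V₁ := W₁) (V₂ := W₂) (r := r)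
    ((γ₁.finrank_map_eq _).trans (V.V₁.finrank_top hK x))
    ((γ₂.finrank_map_eq _).trans (V.V₂.finrank_top hK x))
    (by
      rintro _ ⟨v, hv, rfl⟩
      have := (hW₂ _).mp (V.map_f ⊤ v hv)
      convert this using 1
      rw [cf]
      ext (i | i)
      · exact (one_mul _).symm
      · obtain rfl | h := hs0
        · exact i.elim0
        · exact Eq.symm (mul_eq_zero_of_left h _))
    (by
      rintro _ ⟨v, hv, rfl⟩
      obtain rfl | h := hs0
      · convert W₁.zero_mem
        ext (i | i)
        · rfl
        · exact i.elim0
      · exact cg0 h v ▸ (hW₁ _).mp (V.map_g ⊤ v hv))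
  let C : ChartData f g s r := .ofDiag h₁ h₂ hf hg σ τ hr
  have c₁ : ∀ v i, (C.frame₁.basePull p).coord hU v i =
      γ₁ v ((shuffle₁ _ _ _ _ _).trans (Equiv.sumCongr σ τ) i) :=
    fun v i => (h₁.basePull p).coord_reindex _ hU v i
  have c₂ : ∀ v i, (C.frame₂.basePull p).coord hU v i =
      γ₂ v ((shuffle₂ _ _ _ _ _).trans (Equiv.sumCongr σ τ) i) :=
    fun v i => (h₂.basePull p).coord_reindex _ hU v i
  obtain ⟨hA, c, M, N, hp, -, -⟩ := C.exists_hasParams V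
    (V.V₁.graphLocus_eq_top hK x _ hU C.card₁ fun v hv h => by
      have hi := v₁ _ ((hW₁ v).mp hv) fun i => (c₁ v _).symm.trans (h (.inl i))
      exact γ₁.map_eq_zero_iff.mp (v₁' _ ((hW₁ v).mp hv) hi
        (fun i => (c₁ v _).symm.trans (h (.inr (.inl i))))
        fun i => (c₁ v _).symm.trans (h (.inr (.inr i)))))
    (V.V₂.graphLocus_eq_top hK x _ hU C.card₂ fun v hv h => by
      have hi := v₂ _ ((hW₂ v).mp hv) fun i => (c₂ v _).symm.trans (h (.inr (.inr i)))
      exact γ₂.map_eq_zero_iff.mp (v₂' _ ((hW₂ v).mp hv) hi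
        (fun i => (c₂ v _).symm.trans (h (.inl i)))
        fun i => (c₂ v _).symm.trans (h (.inr (.inl i)))))
  -- A column of `M` is the component in `L ⊆ A` of a section of `V₁` whose `I`- and `J`-coordinates
  -- are zero. By `v₁` vanishing `I`-coordinates force the whole `A`-part to vanish. The argument
  -- for `N` is symmetric, with `J` and `B`.
  have hM : M = 0 := by
    ext i j
    have hv := hp.1.section_mem (.inr (.inr j))
    have hco := coord_graphSection (C.frame₁.basePull p) hA (graphA (p.appTop s) c M)
      (.inr (.inr j))
    have hi := v₁ _ ((hW₁ _).mp hv) fun i => (c₁ _ _).symm.trans (congrFun hco (.inl (.inl i)))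
    exact ((c₁ _ _).symm.trans (congrFun hco (.inr (.inl i)))).symm.trans
      (congrFun hi (σ (.inr (.inl i))))
  have hN : N = 0 := by
    ext i j
    have hv := hp.2.section_mem (.inr (.inl j))
    have hco := coord_graphSection (C.frame₂.basePull p) hA (graphB (p.appTop s) c N)
      (.inr (.inl j))
    have hi := v₂ _ ((hW₂ _).mp hv) fun i =>
      (c₂ _ _).symm.trans (congrFun hco (.inl (.inr (.inr i))))
    exact ((c₂ _ _).symm.trans (congrFun hco (.inr (.inl i)))).symm.trans
      (congrFun hi (τ (.inr (.inl i))))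
  subst hM hN
  have hσ := Fintype.card_congr σ
  have hτ := Fintype.card_congr τ
  simp only [Fintype.card_sum, Fintype.card_fin] at hσ hτ
  refine ⟨C, hA, c, hp, fun h => ?_, fun h => ?_, ?_⟩
  · have hF : dimF V = nI := by
      rw [← hI, (Submodule.equivMapOfInjective (inclA K (Fin nA) (Fin nB)) inclA_injective _).finrank_eq]
      refine (γ₂.finrank_map_eq _).symm.trans ?_
      rw [← Submodule.map_comp, ← Submodule.map_comp, ← Submodule.map_comp]
      have : γ₂.toLinearMap ∘ₗ sectionMap (bcMap p f) ⊤ =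
        (inclA K (Fin nA) (Fin nB) ∘ₗ projA K _ _) ∘ₗ γ₁.toLinearMap := LinearMap.ext (cf0 h)
      exact congrArg (fun m => Module.finrank K ((V.V₁.carrier ⊤).map m)) this
    have hG : dimG V = nJ := by
      rw [← hJ, (Submodule.equivMapOfInjective (inclB K (Fin nA) (Fin nB)) inclB_injective _).finrank_eq]
      refine (γ₁.finrank_map_eq _).symm.trans ?_
      rw [← Submodule.map_comp, ← Submodule.map_comp, ← Submodule.map_comp]
      have : γ₁.toLinearMap ∘ₗ sectionMap (bcMap p g) ⊤ =
        (inclB K (Fin nA) (Fin nB) ∘ₗ projB K _ _) ∘ₗ γ₂.toLinearMap := LinearMap.ext (cg0 h)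
      exact congrArg (fun m => Module.finrank K ((V.V₂.carrier ⊤).map m)) this
    rw [hF, hG]
    change (l : ℤ) = _
    omega
  -- The pivots `J`, `L`, `K'` enumerate `B`, which is empty, so `l = 0`.
  · have : nB = 0 := hs0.resolve_right h
    change l = 0
    omega
  · rw [C.cast_m]
    change ((nI : ℤ) + nJ + l) * (l + nK + nK') - l ^ 2 = r * (d - r) - l ^ 2
    have e₁ : (r : ℤ) = nI + nJ + l := by omega
    have e₂ : (d : ℤ) - r = l + nK + nK' := by omega
    rw [e₂, e₁]

end chart

/-! ### The local structure of the linked Grassmannian -/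

section lift

variable {S X : Scheme.{u}}

/-- If the residue field extension at a field-valued point is trivial, values of functions at the
point come from functions on the base. -/
theorem exists_section_eq {π : X ⟶ S} {k : Type u} [Field k] (x : Spec (CommRingCat.of k) ⟶ X)
    (hs : Function.Surjective (π.residueFieldMap (underlyingPoint x))) (a : Γ(X, ⊤)) :
    ∃ (W : S.Opens) (hW : ⊤ ≤ (x ≫ π) ⁻¹ᵁ W) (b : Γ(S, W)),
      (x ≫ π).appLE W ⊤ hW b = x.appTop a := by
  -- The value of `a` comes from the residue field of `S`; it is lifted to the local ring and then
  -- to a function on a neighborhood.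
  obtain ⟨c, hc⟩ := hs (X.evaluation ⊤ (underlyingPoint x) trivial a)
  obtain ⟨γ, rfl⟩ := S.residue_surjective _ c
  obtain ⟨W, hyW, b, rfl⟩ := S.presheaf.exists_germ_eq γ
  have hW : ⊤ ≤ (x ≫ π) ⁻¹ᵁ W :=
    top_le_preimage (p := x ≫ π) (x := IsLocalRing.closedPoint k) hyW
  have hW' : ⊤ ≤ x ⁻¹ᵁ π ⁻¹ᵁ W := hW
  refine ⟨W, hW, b, ?_⟩
  have h1 : X.evaluation (π ⁻¹ᵁ W) (underlyingPoint x) hyW (π.app W b) =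
      X.evaluation (π ⁻¹ᵁ W) (underlyingPoint x) hyW (fres le_top a) := by
    rw [← Scheme.evaluation_naturality_apply]
    refine hc.trans ?_
    exact congrArg (X.residue _) (X.presheaf.germ_res_apply (homOfLE le_top) _ hyW a).symm
  have h2 : X.evaluation (π ⁻¹ᵁ W) (underlyingPoint x) hyW (π.app W b - fres le_top a) = 0 := by
    rw [map_sub, h1, sub_self]
  have h3 := (appLE_eq_zero_iff (isField_spec k) hW' _ (IsLocalRing.closedPoint k)).mpr
    ((X.evaluation_eq_zero_iff_notMem_basicOpen _ hyW _).mp h2)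
  rw [map_sub, sub_eq_zero, appLE_fres, appLE_top, Scheme.Hom.app_eq_appLE] at h3
  rw [← h3]
  exact (appLE_appLE x π _ rfl le_rfl hW' hW b).symm

end lift

/-! ### Shrinking and translating charts. -/

section restrict

variable {S T : Scheme.{u}} {E : S.Modules} {U : S.Opens} {ι κ : Type} [Fintype ι] [DecidableEq ι]

theorem IsFrame.coord_mono_basePull {e : ι → Γ(E, U)} (he : IsFrame E U e) (p : T ⟶ S)
    {W : S.Opens} (hW : W ≤ U) {A : T.Opens} (hA : A ≤ p ⁻¹ᵁ W) (v : Γ(bc p E, A)) :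
    ((he.mono hW).basePull p).coord hA v =
      (he.basePull p).coord (hA.trans (p.preimage_mono hW)) v := by
  refine ((he.mono hW).basePull p).coord_eq hA ?_
  conv_lhs => rw [← (he.basePull p).sum_coord (hA.trans (p.preimage_mono hW)) v]
  refine Finset.sum_congr rfl fun i _ => ?_
  rw [res_basePull, res_basePull, basePull_res]

namespace ChartData

variable {E₁ E₂ : S.Modules} {f : E₁ ⟶ E₂} {g : E₂ ⟶ E₁} {s : Γ(S, ⊤)} {r d : ℕ}
  (C : ChartData f g s r)

theorem map_single {R R' : Type*} [CommRing R] [CommRing R'] {ι : Type*} [DecidableEq ι]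
    (φ : R →+* R') (i : ι) : (fun j => φ ((Pi.single i 1 : ι → R) j)) = Pi.single i 1 := by
  ext j
  simp only [Pi.single_apply]
  split_ifs <;> simp

/-- The restriction of a chart to a smaller open set of the base, with a new translation. -/
def restrict {W : S.Opens} (hW : W ≤ C.U) (t : C.Idx → Γ(S, W)) : ChartData f g s r where
  U := W
  l := C.l
  nI := C.nI
  nJ := C.nJ
  nK := C.nK
  nK' := C.nK'
  e₁ i := res E₁ hW (C.e₁ i)
  e₂ i := res E₂ hW (C.e₂ i)
  frame₁ := C.frame₁.mono hW
  frame₂ := C.frame₂.mono hW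
  f_e₁ i := by
    ext j
    rw [C.frame₂.coord_mono, app_res]
    refine (C.frame₂.coord_res le_rfl hW _ j).trans ?_
    rw [C.f_e₁, map_mapF, map_single, fres_fres]
  g_e₂ i := by
    ext j
    rw [C.frame₁.coord_mono, app_res]
    refine (C.frame₁.coord_res le_rfl hW _ j).trans ?_
    rw [C.g_e₂, map_mapG, map_single, fres_fres]
  card := C.card
  t := t

theorem HasParams.restrict {C : ChartData f g s r} {p : T ⟶ S} {V : LinkedPair p f g r}
    {hA : ⊤ ≤ p ⁻¹ᵁ C.U} {c : C.Idx → Γ(T, ⊤)} {M N : Matrix (Fin C.l) (Fin C.l) Γ(T, ⊤)}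
    (h : C.HasParams V hA c M N) {W : S.Opens} (hW : W ≤ C.U) (t : C.Idx → Γ(S, W))
    (hA' : ⊤ ≤ p ⁻¹ᵁ W) : (C.restrict hW t).HasParams V hA' c M N := by
  refine ⟨fun B hB v => ?_, fun B hB v => ?_⟩
  · refine (h.1 B hB v).trans ?_
    rw [← C.frame₁.coord_mono_basePull p hW (hB.trans hA') v]
    rfl
  · refine (h.2 B hB v).trans ?_
    rw [← C.frame₂.coord_mono_basePull p hW (hB.trans hA') v]
    rfl

/-- A pair with parameters lies entirely in the locus of the chart, so its classifying morphism
factors through that locus; composing with the isomorphism to the model gives the morphism whose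
coordinates are the parameters of the pair. -/
theorem exists_iso_of_hasParams (hE₁ : IsVectorBundle E₁ d) (hE₂ : IsVectorBundle E₂ d)
    {LG : Scheme.{u}} {π : LG ⟶ S} {𝒱 : LinkedPair π f g r} (h𝒱 : IsLinkedGrassmannian π 𝒱)
    {p : T ⟶ S} {V : LinkedPair p f g r} {x : T ⟶ LG} (hx : Classifies x 𝒱 V)
    {hA : ⊤ ≤ p ⁻¹ᵁ C.U} {c : C.Idx → Γ(T, ⊤)} {M N : Matrix (Fin C.l) (Fin C.l) Γ(T, ⊤)}
    (h : C.HasParams V hA c M N) :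
    ∃ (φ : (C.openChart.locus 𝒱 : Scheme.{u}) ≅ C.X)
      (x' : T ⟶ (C.openChart.locus 𝒱 : Scheme.{u})),
      φ.hom ≫ C.π = (C.openChart.locus 𝒱).ι ≫ π ∧ x' ≫ (C.openChart.locus 𝒱).ι = x ∧
        Classifies (x' ≫ φ.hom) C.univ V := by
  obtain ⟨φ, hφ, W, hW, hφW⟩ := C.openChart.exists_iso hE₁ hE₂ h𝒱
  have hV : C.openChart.locus V = ⊤ :=
    top_le_iff.mp (le_inf h.1.le_graphLocus h.2.le_graphLocus)
  obtain ⟨y, hy, -⟩ := C.openChart.existsUnique V hV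
  obtain ⟨x', hx'⟩ := C.openChart.exists_lift_locus 𝒱 V x hx y hy
  obtain ⟨V', hV'⟩ := exists_classifies hE₁ hE₂ x'
    (by rw [← Category.assoc, hx']; exact hx.1 : x' ≫ (C.openChart.locus 𝒱).ι ≫ π = p) W
  have h1 := hW.comp hE₁ hE₂ hV'
  rw [hx'] at h1
  obtain rfl := h1.unique hx
  exact ⟨φ, x', hφ, hx', hφW.comp hE₁ hE₂ hV'⟩

/-- At a point with trivial residue field extension, the translation of a chart can be chosen such
that the parameters of the point vanish. -/
theorem exists_translate (hE₁ : IsVectorBundle E₁ d) (hE₂ : IsVectorBundle E₂ d)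
    {LG : Scheme.{u}} {π : LG ⟶ S} {𝒱 : LinkedPair π f g r} (h𝒱 : IsLinkedGrassmannian π 𝒱)
    {k : Type u} [Field k] {p : Spec (CommRingCat.of k) ⟶ S} {V : LinkedPair p f g r}
    {x : Spec (CommRingCat.of k) ⟶ LG} (hx : Classifies x 𝒱 V)
    (hs : Function.Surjective (π.residueFieldMap (underlyingPoint x)))
    {hA : ⊤ ≤ p ⁻¹ᵁ C.U} {c : C.Idx → Γ(Spec (CommRingCat.of k), ⊤)}
    {M N : Matrix (Fin C.l) (Fin C.l) Γ(Spec (CommRingCat.of k), ⊤)}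
    (h : C.HasParams V hA c M N) :
    ∃ (W : S.Opens) (_ : W ≤ C.U) (t : C.Idx → Γ(S, W)) (hA' : ⊤ ≤ p ⁻¹ᵁ W),
      ∀ i, p.appLE W ⊤ hA' (t i) = c i := by
  -- The parameters of the point are values at `x'` of the universal parameters, which are functions
  -- on an open part of `LG`. Hence the hypothesis on residue fields applies to them.
  obtain ⟨φ, x', hφ, rfl, hV⟩ := C.exists_iso_of_hasParams hE₁ hE₂ h𝒱 hx h
  obtain ⟨w, hc, -, -⟩ := (C.classifies_iff C.hasParams_univ h _).mp hV
  rw [Category.assoc, hφ] at w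
  subst w
  -- Passing to an open subscheme of `LG` does not change the residue field.
  have hs' : Function.Surjective
      (((C.openChart.locus 𝒱).ι ≫ π).residueFieldMap (underlyingPoint x')) := by
    rw [Scheme.residueFieldMap_comp]
    exact (ConcreteCategory.bijective_of_isIso
      ((C.openChart.locus 𝒱).ι.residueFieldMap (underlyingPoint x'))).surjective.comp hs
  choose W hW b hb using fun i => exists_section_eq x' hs' (φ.hom.appTop (C.univParam i))
  -- There are finitely many parameters, so all lifts restrict to a common open set.
  let W' : S.Opens := C.U ⊓ Finset.univ.inf W
  have hW' : ∀ i, W' ≤ W i := fun i => inf_le_right.trans (Finset.inf_le (Finset.mem_univ i))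
  refine ⟨W', inf_le_left, fun i => fres (hW' i) (b i), ?_, fun i => ?_⟩
  · refine top_le_preimage (x := IsLocalRing.closedPoint k) ⟨hA trivial, ?_⟩
    have : (x' ≫ (C.openChart.locus 𝒱).ι ≫ π) (IsLocalRing.closedPoint k) ∈
        ((Finset.univ.inf W : S.Opens) : Set S) := by
      rw [TopologicalSpace.Opens.coe_finset_inf, Finset.inf_set_eq_iInter]
      exact Set.mem_iInter₂.mpr fun i _ => hW i trivial
    exact this
  · rw [appLE_fres, hb, ← hc, Scheme.Hom.comp_appTop, CommRingCat.comp_apply]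

end ChartData

end restrict

end

end LinkedGr

/-! ### Representability and the local structure theorem. -/

open LinkedGr in
theorem theorem3p2 {S : Scheme.{u}} (d r : ℕ) (hr : 0 < r) (hrd : r < d)
    {E₁ E₂ : S.Modules} (f : E₁ ⟶ E₂) (g : E₂ ⟶ E₁) (s : Γ(S, ⊤)) (hfg : IsLinked d f g s) :
    -- the linked Grassmannian scheme exists
    (∃ (LG : Scheme.{u}) (π : LG ⟶ S) (𝒱 : LinkedPair π f g r), IsLinkedGrassmannian π 𝒱) ∧
    -- and it has the stated local structure
    ∀ (LG : Scheme.{u}) (π : LG ⟶ S) (𝒱 : LinkedPair π f g r), IsLinkedGrassmannian π 𝒱 →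
    -- at every field-valued point `x = (V₁, V₂)`
    ∀ (k : Type u) [Field k] (p : Spec (CommRingCat.of k) ⟶ S) (V : LinkedPair p f g r)
      (x : Spec (CommRingCat.of k) ⟶ LG), Classifies x 𝒱 V →
    ∃ l m : ℕ,
      (p.appTop s = 0 → (l : ℤ) = (r : ℤ) - dimG V - dimF V) ∧
      (p.appTop s ≠ 0 → l = 0) ∧
      (m : ℤ) = (r : ℤ) * ((d : ℤ) - r) - (l : ℤ) ^ 2 ∧
      ∃ (U : LG.Opens) (S' : S.Opens)
        (φ : (U : Scheme.{u}) ≅ LocalModel m l (S' : Scheme.{u}) (S'.ι.appTop s))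
        (x' : Spec (CommRingCat.of k) ⟶ (U : Scheme.{u})),
        (S' : Set S) = π '' (U : Set LG) ∧
        φ.hom ≫ LocalModel.toBase m l (S' : Scheme.{u}) (S'.ι.appTop s) ≫ S'.ι = U.ι ≫ π ∧
        x' ≫ U.ι = x ∧
        MatrixCoordsVanish (x' ≫ φ.hom) ∧
        (Function.Bijective (π.residueFieldMap (underlyingPoint x)) →
          AffineCoordsVanish (x' ≫ φ.hom)) := by
  refine ⟨?_, ?_⟩
  · refine OpenChart.exists_isLinkedGrassmannian hfg.bundle₁ hfg.bundle₂
      (fun C : ChartData f g s r => C.openChart) fun T p V x => ?_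
    -- To see that the charts cover, restrict to the residue field of `x`: the restricted pair lies
    -- in some chart, and the loci are compatible with base change.
    obtain ⟨W, hW⟩ := exists_classifies hfg.bundle₁ hfg.bundle₂ (T.fromSpecResidueField x) rfl V
    obtain ⟨C, hA, c, hp, -⟩ := hfg.exists_chartData W
    refine ⟨C, ?_⟩
    have h1 : C.openChart.locus W = ⊤ :=
      top_le_iff.mp (le_inf hp.1.le_graphLocus hp.2.le_graphLocus)
    rw [C.openChart.locus_pull _ _ _ hW] at h1
    have h2 : T.fromSpecResidueField x (IsLocalRing.closedPoint (T.residueField x)) ∈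
        C.openChart.locus V := h1.ge trivial
    have h3 : T.fromSpecResidueField x (IsLocalRing.closedPoint (T.residueField x)) = x :=
      T.fromSpecResidueField_apply x _
    exact h3 ▸ h2
  · intro LG π 𝒱 h𝒱 k _ p V x hx
    obtain ⟨C, hA, c, hp, hl, hl', hm, ht⟩ : ∃ (C : ChartData f g s r) (hA : ⊤ ≤ p ⁻¹ᵁ C.U)
        (c : C.Idx → Γ(Spec (CommRingCat.of k), ⊤)), C.HasParams V hA c 0 0 ∧
        (p.appTop s = 0 → (C.l : ℤ) = (r : ℤ) - dimG V - dimF V) ∧ (p.appTop s ≠ 0 → C.l = 0) ∧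
        (C.m : ℤ) = (r : ℤ) * ((d : ℤ) - r) - (C.l : ℤ) ^ 2 ∧
        (Function.Bijective (π.residueFieldMap (underlyingPoint x)) →
          ∀ i, p.appLE C.U ⊤ hA (C.t i) = c i) := by
      obtain ⟨C, hA, c, hp, hl, hl', hm⟩ := hfg.exists_chartData V
      -- With trivial residue field extension the chart is shrunk and its translation set to the
      -- parameters of the point; otherwise the original chart suffices, as only the matrices have
      -- to vanish.
      by_cases hb : Function.Bijective (π.residueFieldMap (underlyingPoint x))
      · obtain ⟨W, hW, t, hA', ht⟩ := C.exists_translate hfg.bundle₁ hfg.bundle₂ h𝒱 hx hb.2 hp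
        exact ⟨C.restrict hW t, hA', c, hp.restrict hW t hA', hl, hl', hm, fun _ => ht⟩
      · exact ⟨C, hA, c, hp, hl, hl', hm, fun h => absurd h hb⟩
    obtain ⟨φ, x', hφ, hx', hV⟩ := C.exists_iso_of_hasParams hfg.bundle₁ hfg.bundle₂ h𝒱 hx hp
    obtain ⟨-, hc, hM, hN⟩ := (C.classifies_univ_iff hp _).mp hV
    refine ⟨C.l, C.m, hl, hl', hm, C.openChart.locus 𝒱, C.U, φ, x', ?_, hφ, hx',
      (LocalModel.matrixCoordsVanish_iff _).mpr ⟨hM, hN⟩,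
      fun hb => (LocalModel.affineCoordsVanish_iff _).mpr fun i => ?_⟩
    -- The model maps onto the open set `C.U`, so the locus of the chart in `LG` has image exactly
    -- `C.U`.
    · have h1 : Set.range C.π = C.U := by
        rw [ChartData.π, Scheme.Hom.comp_base, TopCat.coe_comp, Set.range_comp,
          (LocalModel.toBase_surjective).range_eq, Set.image_univ, Scheme.Opens.range_ι]
      have h2 : Set.range (φ.hom ≫ C.π) = Set.range C.π := by
        rw [Scheme.Hom.comp_base, TopCat.coe_comp, Set.range_comp, φ.hom.surjective.range_eq,
          Set.image_univ]
      rw [← h1, ← h2, hφ, Scheme.Hom.comp_base, TopCat.coe_comp, Set.range_comp,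
        Scheme.Opens.range_ι]
    · obtain ⟨i, rfl⟩ := C.enum.surjective i
      rw [hc, ht hb, sub_self]
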